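/- Let $n\ge 2$ and let $\mathbf B(n)$ be the set of binary strings of length $n$. For $\omega=w_1w_2\cdots w_n\in\mathbf B(n)$ let $f(\omega)=w_1\oplus w_2\oplus w_n$, let $\hat\omega=\overline{w_1}w_2\cdots w_n$ be its conjugate, and let $\mathrm{PRR}(\omega)=w_2\cdots w_n f(\omega)$; the permutation $\mathrm{PRR}$ partitions $\mathbf B(n)$ into cycles. The run-length encoding (RLE) of a string is the sequence of the lengths of its maximal runs. For each cycle define: * the RL2-rep: the string of the cycle with the lexicographically smallest RLE; if there are two such strings, the one beginning with $0$; * the LC2-rep: $0^n$ and $1^n$ for the cycles $\{0^n\}$ and $\{1^n\}$; for every other cycle, the string $\omega$ with RLE $r_1r_2\cdots r_\ell$ such that $r_1=1$ and $\mathrm{PRR}^{r_2}(\omega)$ is the RL2-rep; * the opp-rep: the RL2-rep if that string begins with $1$ and has RLE of the form $1x^zy$ with $z$ odd and $y>x$; otherwise the LC2-rep. Let $O(\omega)=\overline{f(\omega)}$ if $\omega$ or $\hat\omega$ is an opp-rep different from $0^n$, and $O(\omega)=f(\omega)$ otherwise. Let $\mathcal Y_n=\mathrm{DB}(O,10^{n-1})=y_1\cdots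 y_{2^n}$ be the sequence obtained by starting with $\omega=10^{n-1}$ and, for $i=1,\dots,2^n$, setting $y_i=O(\omega)$ and then replacing $\omega=w_1\cdots w_n$ by $w_2\cdots w_ny_i$. Let $\mathcal O_n$ be the sequence produced by the Prefer-opposite construction: start with the seed $0^{n-1}$ and append $0$; then repeat until no new bit is added (a bit is only ever added if this creates no duplicate substring of length $n$): if the current suffix is $1^{n-1}$, append $1$ if this is the first occurrence of $1^{n-1}$ and $0$ otherwise; if the current suffix is not $1^{n-1}$, append the opposite of the last bit if this creates no duplicate substring of length $n$, and otherwise append the same bit as the last; finally remove the seed. **Theorem.** For every $n\ge2$, $\mathcal O_n$ is a de Bruijn sequence of order $n$ (it has length $2^n$ and, considered cyclically, contains every string of $\mathbf B(n)$ exactly once), and $\mathcal Y_n=\mathcal O_n$. Moreover, $\mathcal O_n$ can be constructed in $O(n)$ time per bit with $O(n)$ space: there are a constant $C$ and a single program for the unit-cost random access machine (with addition, subtraction and comparison as arithmetic operations) that, for every $n\ge2$, on input $n$ and using a memory of at most $Cn$ words, each holding a value less than $Cn$ (besides a fixed number of such words as variables), outputs the bits of $\mathcal O_n$ in order and halts,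 with at most $Cn$ elementary operations before the first bit, between any two consecutive bits, and after the last bit. -/

import Mathlib

namespace PreferOpposite

/-! ### Binary strings (lists of Booleans, `true` is the bit 1 and `false` the bit 0) -/

/-- The run-length encoding: the list of the lengths of the maximal runs. -/
def rle (w : List Bool) : List ℕ := (w.splitBy (· == ·)).map List.length

/-- The feedback function `f(w₁ ⋯ wₙ) = w₁ ⊕ w₂ ⊕ wₙ` (used for `n ≥ 2`). -/
def feedback (w : List Bool) : Bool :=
  xor (xor (w.getD 0 false) (w.getD 1 false)) (w.getLastD false)

/-- Drop the first bit and append the bit `b`. -/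
def shift (w : List Bool) (b : Bool) : List Bool := w.tail ++ [b]

/-- The pure run-length register `PRR(w₁ ⋯ wₙ) = w₂ ⋯ wₙ f(w)`. -/
def prr (w : List Bool) : List Bool := shift w (feedback w)

/-- The conjugate: the first bit is complemented. -/
def conj : List Bool → List Bool
  | [] => []
  | a :: w => (!a) :: w

/-- `u` lies in the cycle of `w` that is induced by the PRR. -/
def InCycle (w u : List Bool) : Prop := ∃ k : ℕ, prr^[k] w = u

/-- `w` is the RL2-rep of its cycle: the string with the lexicographically smallest run-length
encoding and, if there are two such strings, the one that begins with 0. -/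
def IsRL2Rep (w : List Bool) : Prop :=
  ∀ u, InCycle w u → rle w ≤ rle u ∧ (rle u = rle w → u ≠ w → w.head? = some false)

/-- `w` is the LC2-rep of its cycle: `0ⁿ`, `1ⁿ`, or a string with run-length encoding
`1 r₂ ⋯ r_ℓ` such that `r₂` applications of the PRR to it yield the RL2-rep. -/
def IsLC2Rep (w : List Bool) : Prop :=
  w = List.replicate w.length false ∨ w = List.replicate w.length true ∨
    ∃ (r₂ : ℕ) (r : List ℕ), rle w = 1 :: r₂ :: r ∧ IsRL2Rep (prr^[r₂] w)

/-- The special strings: they begin with 1 and have run-length encoding `1 x^z y` with `z` odd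
and `y > x`. -/
def IsSpecial2 (w : List Bool) : Prop :=
  w.head? = some true ∧
    ∃ x y z : ℕ, Odd z ∧ x < y ∧ rle w = 1 :: (List.replicate z x ++ [y])

/-- `w` is the opp-rep of its cycle: with `u` the RL2-rep of that cycle, it is `u` if `u` is
special, and the LC2-rep otherwise. -/
def IsOppRep (w : List Bool) : Prop :=
  ∃ u, InCycle w u ∧ IsRL2Rep u ∧ ((IsSpecial2 u ∧ w = u) ∨ (¬ IsSpecial2 u ∧ IsLC2Rep w))

/-- The set of all opp-reps other than the strings `0ⁿ`. -/
def oppReps : Set (List Bool) := {w | IsOppRep w ∧ w ≠ List.replicate w.length false}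

open Classical in
/-- The successor rule `O`. -/
noncomputable def succO (w : List Bool) : Bool :=
  if w ∈ oppReps ∨ conj w ∈ oppReps then !(feedback w) else feedback w

/-- The first `m` bits generated by the rule `g` from the string `w`. -/
def generate (g : List Bool → Bool) : ℕ → List Bool → List Bool
  | 0, _ => []
  | m + 1, w => g w :: generate g m (shift w (g w))

/-- `DB(g, w)`: the `2ⁿ` bits generated by `g` from the string `w` of length `n`. -/
def DB (g : List Bool → Bool) (w : List Bool) : List Bool := generate g (2 ^ w.length) w

/-- A de Bruijn sequence of order `n`: `2ⁿ` bits that contain, considered cyclically, every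
string of length `n` exactly once. -/
def IsDeBruijn (n : ℕ) (s : List Bool) : Prop :=
  s.length = 2 ^ n ∧
    ∀ w : List Bool, w.length = n → ∃! i : ℕ, i < 2 ^ n ∧ (s.rotate i).take n = w

/-! ### The greedy Prefer-opposite construction -/

/-- Appending `b` to `s` creates a duplicate substring of length `n`. -/
def CreatesDup (n : ℕ) (s : List Bool) (b : Bool) : Prop :=
  (s ++ [b]).drop (s.length + 1 - n) <:+: s

instance (n : ℕ) (s : List Bool) (b : Bool) : Decidable (CreatesDup n s b) :=
  inferInstanceAs (Decidable (_ <:+: _))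

/-- The bit that the construction wants to append to `s`. If the current suffix is `1ⁿ⁻¹`, this
is 1 if `1ⁿ⁻¹` is seen for the first time and 0 otherwise. If not, it is the opposite of the last
bit, unless that creates a duplicate substring of length `n`, and else the last bit. -/
def greedyBit (n : ℕ) (s : List Bool) : Bool :=
  if List.replicate (n - 1) true <:+ s then
    if List.replicate (n - 1) true <:+: s.dropLast then false else true
  else if CreatesDup n s (!(s.getLastD false)) then s.getLastD false
  else !(s.getLastD false)

/-- One round: the bit is appended unless it creates a duplicate substring of length `n`, in
which case no bit is added. -/
def greedyStep (n : ℕ) (s : List Bool) : List Bool :=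
  if CreatesDup n s (greedyBit n s) then s else s ++ [greedyBit n s]

/-- The string after the seed `0ⁿ⁻¹`, the bit 0, and rounds until no new bit is added; by
`greedyStep_greedyString` below this is reached after at most `2ⁿ` rounds. -/
def greedyString (n : ℕ) : List Bool :=
  (greedyStep n)^[2 ^ n] (List.replicate (n - 1) false ++ [false])

/-- The Prefer-opposite sequence: the seed `0ⁿ⁻¹` is removed. -/
def preferOpposite (n : ℕ) : List Bool := (greedyString n).drop (n - 1)

/-- All substrings of length `n` of `s` are distinct. -/
def DistinctWindows (n : ℕ) (s : List Bool) : Prop :=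
  ∀ i j : ℕ, i + n ≤ s.length → j + n ≤ s.length →
    (s.drop i).take n = (s.drop j).take n → i = j

theorem DistinctWindows.length_lt {n : ℕ} {s : List Bool} (h : DistinctWindows n s) :
    s.length < n + 2 ^ n := by
  by_contra hlt
  push Not at hlt
  let F : Fin (2 ^ n + 1) → List.Vector Bool n := fun i =>
    ⟨(s.drop i).take n, by have := i.2; simp; omega⟩
  have hF : Function.Injective F := by
    intro i j hij
    have h1 : (s.drop i).take n = (s.drop j).take n := congrArg Subtype.val hij
    exact Fin.ext (h i j (by have := i.2; omega) (by have := j.2; omega) h1)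
  have := Fintype.card_le_of_injective F hF
  simp at this

theorem DistinctWindows.snoc {n : ℕ} {s : List Bool} {b : Bool} (hn : n ≤ s.length)
    (h : DistinctWindows n s) (hd : ¬ CreatesDup n s b) : DistinctWindows n (s ++ [b]) := by
  have key : ∀ i, i + n ≤ s.length → ((s ++ [b]).drop i).take n = (s.drop i).take n := by
    intro i hi
    rw [List.drop_append_of_le_length (by omega), List.take_append_of_le_length (by simp; omega)]
  have last : ∀ i, i + n ≤ s.length → (s.drop i).take n ≠
      ((s ++ [b]).drop (s.length + 1 - n)).take n := by
    intro i hi he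
    apply hd
    rw [List.take_of_length_le (l := (s ++ [b]).drop (s.length + 1 - n)) (by simp; omega)] at he
    unfold CreatesDup
    rw [← he]
    exact (List.take_prefix _ _).isInfix.trans (List.drop_suffix _ _).isInfix
  intro i j hi hj he
  simp only [List.length_append, List.length_singleton] at hi hj
  by_cases hi' : i + n ≤ s.length <;> by_cases hj' : j + n ≤ s.length
  · rw [key i hi', key j hj'] at he
    exact h i j hi' hj' he
  · have : j = s.length + 1 - n := by omega
    subst this
    rw [key i hi'] at he
    exact absurd he (last i hi')
  · have : i = s.length + 1 - n := by omega
    subst this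
    rw [key j hj'] at he
    exact absurd he.symm (last j hj')
  · omega

/-- After `2ⁿ` rounds no new bit is added. -/
theorem greedyStep_greedyString (n : ℕ) (hn : 1 ≤ n) :
    greedyStep n (greedyString n) = greedyString n := by
  have inv : ∀ k : ℕ, let s := (greedyStep n)^[k] (List.replicate (n - 1) false ++ [false])
      DistinctWindows n s ∧ n ≤ s.length ∧ (greedyStep n s = s ∨ n + k ≤ s.length) := by
    intro k
    induction k with
    | zero =>
      refine ⟨?_, by simp; omega, Or.inr (by simp; omega)⟩
      intro i j hi hj _
      simp at hi hj
      omega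
    | succ k ih =>
      simp only [Function.iterate_succ_apply']
      obtain ⟨h1, h2, h3⟩ := ih
      set s := (greedyStep n)^[k] (List.replicate (n - 1) false ++ [false])
      by_cases hd : CreatesDup n s (greedyBit n s)
      · have hs : greedyStep n s = s := by simp [greedyStep, hd]
        rw [hs]
        exact ⟨h1, h2, Or.inl hs⟩
      · have hs : greedyStep n s = s ++ [greedyBit n s] := by simp [greedyStep, hd]
        rcases h3 with h3 | h3
        · rw [hs] at h3
          simp at h3
        · rw [hs]
          exact ⟨h1.snoc h2 hd, by simp; omega, Or.inr (by simp; omega)⟩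
  obtain ⟨h1, _, h3⟩ := inv (2 ^ n)
  rcases h3 with h3 | h3
  · exact h3
  · exact absurd h1.length_lt (by omega)

/-! ### A unit-cost random access machine

Programs are while-programs over word-valued variables and a word-addressed memory. The machine
with word bound `W` has a memory of `W` words, and every word, every address and every intermediate
value is smaller than `W`; a computation that violates this is stuck. -/

/-- Expressions. Comparisons have value 1 (true) or 0 (false); subtraction is truncated. -/
inductive Expr where
  | const (k : ℕ)
  | var (x : ℕ)
  | load (a : Expr)
  | add (a b : Expr)
  | sub (a b : Expr)
  | lt (a b : Expr)
  | eq (a b : Expr)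

/-- Programs. The command `emit a` appends the value of `a` to the output. -/
inductive Cmd where
  | skip
  | assign (x : ℕ) (a : Expr)
  | store (addr a : Expr)
  | emit (a : Expr)
  | seq (p q : Cmd)
  | ite (c : Expr) (p q : Cmd)
  | loop (c : Expr) (p : Cmd)

/-- A state: the variables, the memory, the number of elementary operations so far, and the
output so far, each item with the time at which it was emitted. -/
structure State where
  vars : ℕ → ℕ
  mem : ℕ → ℕ
  clock : ℕ
  out : List (ℕ × ℕ)

/-- The initial state on input `n`: variable 0 holds `n`, everything else is zero or empty. -/
def State.init (n : ℕ) : State where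
  vars := fun x => if x = 0 then n else 0
  mem := fun _ => 0
  clock := 0
  out := []

/-- The value of an expression. -/
def Expr.eval (s : State) : Expr → ℕ
  | const k => k
  | var x => s.vars x
  | load a => s.mem (a.eval s)
  | add a b => a.eval s + b.eval s
  | sub a b => a.eval s - b.eval s
  | lt a b => if a.eval s < b.eval s then 1 else 0
  | eq a b => if a.eval s = b.eval s then 1 else 0

/-- All values (hence all addresses) that occur in the evaluation are smaller than `W`. -/
def Expr.InBounds (W : ℕ) (s : State) : Expr → Prop
  | const k => k < W
  | var x => s.vars x < W
  | load a => a.InBounds W s ∧ s.mem (a.eval s) < W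
  | add a b => a.InBounds W s ∧ b.InBounds W s ∧ a.eval s + b.eval s < W
  | sub a b => a.InBounds W s ∧ b.InBounds W s
  | lt a b => a.InBounds W s ∧ b.InBounds W s
  | eq a b => a.InBounds W s ∧ b.InBounds W s

/-- The number of operations in the evaluation of an expression. -/
def Expr.cost : Expr → ℕ
  | const _ => 1
  | var _ => 1
  | load a => a.cost + 1
  | add a b => a.cost + b.cost + 1
  | sub a b => a.cost + b.cost + 1
  | lt a b => a.cost + b.cost + 1
  | eq a b => a.cost + b.cost + 1

/-- Let `t` elementary operations pass. -/
def State.tick (s : State) (t : ℕ) : State := { s with clock := s.clock + t }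

/-- `Exec W p s s'`: on the machine with word bound `W`, the program `p` started in the state `s`
terminates in the state `s'`. -/
inductive Exec (W : ℕ) : Cmd → State → State → Prop
  | skip (s : State) : Exec W .skip s (s.tick 1)
  | assign (s : State) (x : ℕ) (a : Expr) (ha : a.InBounds W s) :
      Exec W (.assign x a) s
        ({ s with vars := Function.update s.vars x (a.eval s) }.tick (a.cost + 1))
  | store (s : State) (addr a : Expr) (haddr : addr.InBounds W s) (ha : a.InBounds W s) :
      Exec W (.store addr a) s
        ({ s with mem := Function.update s.mem (addr.eval s) (a.eval s) }.tick
          (addr.cost + a.cost + 1))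
  | emit (s : State) (a : Expr) (ha : a.InBounds W s) :
      Exec W (.emit a) s
        ({ s with out := s.out ++ [(a.eval s, s.clock + a.cost + 1)] }.tick (a.cost + 1))
  | seq (s s' s'' : State) (p q : Cmd) (hp : Exec W p s s') (hq : Exec W q s' s'') :
      Exec W (.seq p q) s s''
  | iteTrue (s s' : State) (c : Expr) (p q : Cmd) (hc : c.InBounds W s) (h : c.eval s ≠ 0)
      (hp : Exec W p (s.tick (c.cost + 1)) s') : Exec W (.ite c p q) s s'
  | iteFalse (s s' : State) (c : Expr) (p q : Cmd) (hc : c.InBounds W s) (h : c.eval s = 0)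
      (hq : Exec W q (s.tick (c.cost + 1)) s') : Exec W (.ite c p q) s s'
  | loopDone (s : State) (c : Expr) (p : Cmd) (hc : c.InBounds W s) (h : c.eval s = 0) :
      Exec W (.loop c p) s (s.tick (c.cost + 1))
  | loopStep (s s' s'' : State) (c : Expr) (p : Cmd) (hc : c.InBounds W s) (h : c.eval s ≠ 0)
      (hp : Exec W p (s.tick (c.cost + 1)) s') (hl : Exec W (.loop c p) s' s'') :
      Exec W (.loop c p) s s''

/-- The program `p` generates the sequences `b n`, for all `n ≥ 2`, in `O(n)` time per bit and
`O(n)` space: there is a constant `C` such that on input `n`, with `C n` words of memory and all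
words smaller than `C n`, it outputs exactly the bits of `b n` in order and terminates, and at
most `C n` elementary operations pass from the start to the first bit, from each bit to the next
one, and from the last bit to the end. -/
def GeneratesLinearly (p : Cmd) (b : ℕ → List Bool) : Prop :=
  ∃ C : ℕ, ∀ n : ℕ, 2 ≤ n → ∃ s : State, Exec (C * n) p (State.init n) s ∧
    s.out.map Prod.fst = (b n).map Bool.toNat ∧
    List.IsChain (fun t t' => t' ≤ t + C * n) (0 :: (s.out.map Prod.snd ++ [s.clock]))

end PreferOpposite

namespace PreferOpposite

/-! ### Strings with prescribed run lengths -/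

/-! A nonconstant string is given by its first bit and its run lengths `p + 1`, `M`, `q` (`node`).
The PRR moves one unit from the first run to the last; when the first run has length 1, it is
dropped and a new run of length 1 opens at the end. So a nonconstant PRR cycle is a list of positive
numbers up to rotation, where each rotation by one complements the first bit
(`prr_iterate_full_self`, `inCycle_full_iff`). Its RL2-rep is given by the least rotation `s` and a
bit `c`, which is 1 only if no odd rotation fixes `s` (`Canon`).

The cycles form a tree with root `{0ⁿ}`. Complementing the first bit of an opp-rep merges two
cyclically adjacent runs, so the cycle of `u, a, b` is joined to the cycle with list `u, a + b` and
bit 0 (`Canon.conj_opp_inCycle`). The cycle of `[n - 1]` is joined to `0ⁿ`, and `1ⁿ` to the cycle of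
`[n - 1]`. The rule `O` follows the PRR, except that it enters a child cycle at the conjugate of an
opp-rep and returns to the parent at the opp-rep: it walks through the tree depth first. The `key`
of a string is its address in this walk, namely the key of the point where its cycle is attached,
followed by the number of PRR steps from the opp-rep. In lexicographic order the rule increases the
key everywhere except at `10ⁿ⁻¹`, from which it returns to the root (`key_lt_key_step`). A
permutation of a finite set with such a key is a single cycle (`step_cycle`); this gives the de
Bruijn property.

Key order is thus the order of visits. If `O` repeats the last bit and the suffix is not `1ⁿ⁻¹`, the
conjugate string has a smaller key (`key_lt_key_of_succO`); it came earlier and used up the opposite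
bit. If `O` takes the opposite bit, the new window has not occurred yet. So the greedy construction
makes the same choices (`preferOpposite_of_key`). The heart is `key_full_lt_key_conj`, for conjugate
strings neither of which is an opp-rep: the list of one arises from that of the other by merging two
adjacent entries. By `merge_cases` the keys differ already within `u`, or the lists share `u` and
positions have to be compared. In that comparison the exceptional opp-reps of special cycles become
necessary (`rotate_eq_self_or_spec`).

The program keeps only the current window and the run lengths of its tail. Whether the feedback is
complemented is decided by `flips_iff`: Duval's linear-time algorithm tests whether a rotation is
least and finds its period, whose parity settles the bit, and one more scan recognizes the special
shape. -/

/-- The string with first bit `h` whose runs have the lengths `rs`. -/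
def ofRuns : Bool → List ℕ → List Bool
  | _, [] => []
  | h, r :: rs => List.replicate r h ++ ofRuns (!h) rs

@[simp] theorem ofRuns_nil (h : Bool) : ofRuns h [] = [] := rfl

theorem ofRuns_cons (h : Bool) (r : ℕ) (rs : List ℕ) :
    ofRuns h (r :: rs) = List.replicate r h ++ ofRuns (!h) rs := rfl

theorem ofRuns_succ (h : Bool) (r : ℕ) (rs : List ℕ) :
    ofRuns h ((r + 1) :: rs) = h :: ofRuns h (r :: rs) := by
  simp [ofRuns_cons, List.replicate_succ]

theorem ofRuns_one (h : Bool) (rs : List ℕ) : ofRuns h (1 :: rs) = h :: ofRuns (!h) rs := by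
  simp [ofRuns_cons]

@[simp] theorem length_ofRuns (h : Bool) (rs : List ℕ) : (ofRuns h rs).length = rs.sum := by
  induction rs generalizing h with
  | nil => rfl
  | cons r rs ih => simp [ofRuns_cons, ih]

theorem ofRuns_append (h : Bool) (rs ts : List ℕ) :
    ofRuns h (rs ++ ts) = ofRuns h rs ++ ofRuns (xor h rs.length.bodd) ts := by
  induction rs generalizing h with
  | nil => simp
  | cons r rs ih =>
    simp only [List.cons_append, ofRuns_cons, ih, List.append_assoc, List.length_cons,
      Nat.bodd_succ]
    cases h <;> simp

theorem ofRuns_snoc_succ (h : Bool) (rs : List ℕ) (q : ℕ) :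
    ofRuns h (rs ++ [q + 1]) = ofRuns h (rs ++ [q]) ++ [xor h rs.length.bodd] := by
  simp [ofRuns_append, ofRuns_cons, List.replicate_succ']

theorem ofRuns_eq_cons (h : Bool) {rs : List ℕ} (hne : rs ≠ []) (hpos : ∀ r ∈ rs, 0 < r) :
    ∃ w, ofRuns h rs = h :: w := by
  cases rs with
  | nil => simp at hne
  | cons r rs =>
    obtain ⟨r, rfl⟩ : ∃ m, r = m + 1 := ⟨r - 1, by have := hpos r (by simp); omega⟩
    exact ⟨_, ofRuns_succ h r rs⟩

theorem rle_ofRuns (h : Bool) {rs : List ℕ} (hpos : ∀ r ∈ rs, 0 < r) :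
    rle (ofRuns h rs) = rs := by
  induction rs generalizing h with
  | nil => rfl
  | cons r rs ih =>
    have hr : r ≠ 0 := by have := hpos r (by simp); omega
    have hpos' : ∀ r ∈ rs, 0 < r := fun x hx => hpos x (by simp [hx])
    have ih := ih (!h) hpos'
    have hrep : (List.replicate r h).splitBy (· == ·) = [List.replicate r h] := by
      apply List.splitBy_of_isChain (by simpa using hr)
      exact List.isChain_replicate_of_rel _ (by simp)
    rw [rle, ofRuns_cons, List.splitBy_append, hrep]
    · rw [rle] at ih
      simp [ih]
    · intro x hx y hy
      rw [List.getLast?_replicate] at hx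
      by_cases hne : rs = []
      · simp [hne] at hy
      · obtain ⟨w, hw⟩ := ofRuns_eq_cons (!h) hne hpos'
        rw [hw] at hy
        simp [hr] at hx hy
        subst hx hy
        simp

theorem exists_ofRuns (h : Bool) (w : List Bool) :
    ∃ rs : List ℕ, rs ≠ [] ∧ (∀ r ∈ rs, 0 < r) ∧ h :: w = ofRuns h rs := by
  induction w generalizing h with
  | nil => exact ⟨[1], by simp [ofRuns_cons]⟩
  | cons b w ih =>
    obtain ⟨rs, hne, hpos, hw⟩ := ih b
    rw [hw]
    by_cases hb : b = h
    · subst hb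
      cases rs with
      | nil => simp at hne
      | cons r rs =>
        refine ⟨(r + 1) :: rs, by simp, ?_, (ofRuns_succ _ _ _).symm⟩
        intro x hx
        rcases List.mem_cons.1 hx with rfl | hx
        · omega
        · exact hpos x (by simp [hx])
    · have hb' : b = !h := by cases b <;> cases h <;> simp_all
      refine ⟨1 :: rs, by simp, ?_, by rw [ofRuns_one, hb']⟩
      intro x hx
      rcases List.mem_cons.1 hx with rfl | hx
      · omega
      · exact hpos x hx

theorem getLastD_ofRuns (h : Bool) (rs : List ℕ) {q : ℕ} (hq : 0 < q) (d : Bool) :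
    (ofRuns h (rs ++ [q])).getLastD d = xor h rs.length.bodd := by
  obtain ⟨q, rfl⟩ : ∃ m, q = m + 1 := ⟨q - 1, by omega⟩
  rw [ofRuns_snoc_succ, List.getLastD_concat]

/-- The string with first bit `h` and run lengths `p + 1`, `M`, `q`. -/
def node (h : Bool) (M : List ℕ) (p q : ℕ) : List Bool := ofRuns h ((p + 1) :: (M ++ [q]))

/-- The string with first bit `h` and run lengths `1`, `L`. -/
def full (h : Bool) (L : List ℕ) : List Bool := ofRuns h (1 :: L)

theorem node_zero (h : Bool) (M : List ℕ) (q : ℕ) : node h M 0 q = full h (M ++ [q]) := rfl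

theorem length_node (h : Bool) (M : List ℕ) (p q : ℕ) :
    (node h M p q).length = (M ++ [p + q]).sum + 1 := by
  simp [node]; omega

theorem length_full (h : Bool) (L : List ℕ) : (full h L).length = L.sum + 1 := by
  simp [full]; omega

/-- While the first run has length at least 2, the first two bits cancel in the feedback and the
last bit is repeated. -/
theorem prr_node_succ (h : Bool) (M : List ℕ) (p : ℕ) {q : ℕ} (hq : 0 < q) :
    prr (node h M (p + 1) q) = node h M p (q + 1) := by
  have h1 := getLastD_ofRuns h ((p + 1 + 1) :: M) hq false
  rw [List.cons_append] at h1
  have h2 : feedback (node h M (p + 1) q) = xor h (List.length ((p + 1) :: M)).bodd := by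
    rw [feedback, node, h1, ofRuns_succ, ofRuns_succ]
    simp
  rw [prr, h2, node, node, ofRuns_succ, shift, List.tail_cons]
  have h3 := ofRuns_snoc_succ h ((p + 1) :: M) q
  rw [List.cons_append] at h3
  rw [← List.cons_append, h3]

/-- A first run of length 1 makes the first two bits differ, so the feedback is the complement of
the last bit. -/
theorem prr_full (h : Bool) {L : List ℕ} (hne : L ≠ []) (hpos : ∀ r ∈ L, 0 < r) :
    prr (full h L) = ofRuns (!h) (L ++ [1]) := by
  obtain ⟨M, q, rfl⟩ : ∃ M q, L = M ++ [q] := ⟨_, _, (List.dropLast_append_getLast hne).symm⟩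
  have h1 := getLastD_ofRuns h (1 :: M) (hpos q (by simp)) false
  rw [List.cons_append] at h1
  obtain ⟨w, hw⟩ := ofRuns_eq_cons (!h) hne hpos
  have h2 : feedback (full h (M ++ [q])) = xor h (List.length M).bodd := by
    rw [feedback, full, h1, ofRuns_one, hw]
    simp only [List.getD_cons_zero, List.getD_cons_succ, List.length_cons, Nat.bodd_succ]
    cases h <;> cases M.length.bodd <;> rfl
  have h3 := ofRuns_snoc_succ (!h) ((M ++ [q])) 0
  rw [zero_add] at h3
  rw [prr, h2, full, ofRuns_one, shift, List.tail_cons, h3]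
  simp only [ofRuns_append, ofRuns_cons, List.length_append, List.length_singleton, Nat.bodd_succ]
  cases h <;> cases M.length.bodd <;> simp

theorem prr_full_cons (h : Bool) {l : ℕ} {L : List ℕ} (hpos : ∀ r ∈ l :: L, 0 < r) :
    prr (full h (l :: L)) = node (!h) L (l - 1) 1 := by
  rw [prr_full h (by simp) hpos, node]
  have := hpos l (by simp)
  rw [show l - 1 + 1 = l by omega]
  rfl

theorem prr_iterate_node (h : Bool) (M : List ℕ) (p : ℕ) {q : ℕ} (hq : 0 < q) (i : ℕ)
    (hi : i ≤ p) : prr^[i] (node h M p q) = node h M (p - i) (q + i) := by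
  induction i with
  | zero => rfl
  | succ i ih =>
    rw [Function.iterate_succ_apply', ih (by omega), show p - i = p - (i + 1) + 1 by omega,
      prr_node_succ _ _ _ (by omega)]
    rfl

theorem prr_iterate_full (h : Bool) {l : ℕ} {L : List ℕ} (hpos : ∀ r ∈ l :: L, 0 < r) {j : ℕ}
    (hj : 0 < j) (hjl : j ≤ l) : prr^[j] (full h (l :: L)) = node (!h) L (l - j) j := by
  obtain ⟨j, rfl⟩ : ∃ m, j = m + 1 := ⟨j - 1, by omega⟩
  rw [Function.iterate_succ_apply, prr_full_cons h hpos, prr_iterate_node _ _ _ one_pos _ (by omega)]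
  congr 1 <;> omega

/-- One lap of `l` steps carries the first entry to the end of the list and complements the first
bit; this turns PRR cycles into lists up to rotation. -/
theorem prr_iterate_full_self (h : Bool) {l : ℕ} {L : List ℕ} (hpos : ∀ r ∈ l :: L, 0 < r) :
    prr^[l] (full h (l :: L)) = full (!h) (L ++ [l]) := by
  rw [prr_iterate_full h hpos (hpos l (by simp)) le_rfl, Nat.sub_self, node_zero]

theorem conj_full_cons (h : Bool) (l : ℕ) (L : List ℕ) :
    conj (full h (l :: L)) = ofRuns (!h) ((l + 1) :: L) := by
  rw [full, ofRuns_one, ofRuns_succ, conj]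

theorem conj_full (h : Bool) (l : ℕ) (M : List ℕ) (q : ℕ) :
    conj (full h (l :: (M ++ [q]))) = node (!h) M l q := conj_full_cons h l (M ++ [q])

theorem rle_node (h : Bool) {M : List ℕ} (hM : ∀ r ∈ M, 0 < r) (p : ℕ) {q : ℕ} (hq : 0 < q) :
    rle (node h M p q) = (p + 1) :: (M ++ [q]) := by
  apply rle_ofRuns
  intro r hr
  simp at hr
  rcases hr with rfl | hr | rfl
  · omega
  · exact hM r hr
  · exact hq

theorem rle_full (h : Bool) {L : List ℕ} (hL : ∀ r ∈ L, 0 < r) : rle (full h L) = 1 :: L := by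
  apply rle_ofRuns
  intro r hr
  rcases List.mem_cons.1 hr with rfl | hr
  · omega
  · exact hL r hr

theorem head?_node (h : Bool) (M : List ℕ) (p q : ℕ) : (node h M p q).head? = some h := by
  rw [node, ofRuns_succ]; rfl

theorem node_inj {h h' : Bool} {M M' : List ℕ} {p p' q q' : ℕ} (hM : ∀ r ∈ M, 0 < r)
    (hM' : ∀ r ∈ M', 0 < r) (hq : 0 < q) (hq' : 0 < q') (he : node h M p q = node h' M' p' q') :
    h = h' ∧ M = M' ∧ p = p' ∧ q = q' := by
  have h1 := congrArg List.head? he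
  rw [head?_node, head?_node] at h1
  have h2 := congrArg rle he
  rw [rle_node h hM p hq, rle_node h' hM' p' hq'] at h2
  simp only [List.cons.injEq] at h2
  obtain ⟨h3, h4⟩ := List.append_inj' h2.2 rfl
  exact ⟨by simpa using h1, h3, by omega, by simpa using h4⟩

theorem eq_node_of_not_const {w : List Bool} (h0 : w ≠ List.replicate w.length false)
    (h1 : w ≠ List.replicate w.length true) :
    ∃ h M p q, 0 < q ∧ (∀ r ∈ M, 0 < r) ∧ w = node h M p q := by
  cases w with
  | nil => simp at h0
  | cons b w =>
    obtain ⟨rs, hne, hpos, hw⟩ := exists_ofRuns b w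
    obtain ⟨r, rs, rfl⟩ := List.exists_cons_of_ne_nil hne
    have hr := hpos r (by simp)
    by_cases hrs : rs = []
    · subst hrs
      have hl := congrArg List.length hw
      rw [length_ofRuns] at hl
      rw [hl, hw] at h0 h1
      cases b <;> simp [ofRuns_cons] at h0 h1
    · refine ⟨b, rs.dropLast, r - 1, rs.getLast hrs, hpos _ (by simp), ?_, ?_⟩
      · intro x hx
        exact hpos x (by simp [List.mem_of_mem_dropLast hx])
      · rw [hw, node, List.dropLast_append_getLast, show r - 1 + 1 = r by omega]

end PreferOpposite

namespace PreferOpposite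

/-! ### Cyclic shift rules and the greedy construction -/

/-- One step of the shift register with successor rule `g`. -/
def step (g : List Bool → Bool) (w : List Bool) : List Bool := shift w (g w)

theorem length_shift {w : List Bool} (b : Bool) (h : w ≠ []) : (shift w b).length = w.length := by
  cases w with
  | nil => simp at h
  | cons a w => simp [shift]

theorem length_step_iterate (g : List Bool → Bool) {n : ℕ} (hn : 1 ≤ n) {w : List Bool}
    (hw : w.length = n) (i : ℕ) : ((step g)^[i] w).length = n := by
  induction i with
  | zero => exact hw
  | succ i ih =>
    rw [Function.iterate_succ_apply', step, length_shift _ (by rintro h; simp [h] at ih; omega), ih]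

/-- Two strings with the same tail are equal or conjugate, and conjugates receive different bits. -/
theorem step_injOn {g : List Bool → Bool} {n : ℕ} (hn : 1 ≤ n)
    (hconj : ∀ w, w.length = n → g (conj w) = !g w) {w u : List Bool} (hw : w.length = n)
    (hu : u.length = n) (h : step g w = step g u) : w = u := by
  cases w with
  | nil => simp at hw; omega
  | cons a w =>
    cases u with
    | nil => simp at hu; omega
    | cons b u =>
      simp only [step, shift, List.tail_cons] at h
      obtain ⟨rfl, h2⟩ := List.append_inj' h rfl
      by_cases hab : a = b
      · rw [hab]
      · have := hconj _ hu
        have hb : (!b) = a := by cases a <;> cases b <;> simp_all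
        rw [conj, hb] at this
        simp [this] at h2

/-- A rule whose orbits strictly increase a key, except at one string, has a single cycle. -/
theorem step_cycle {α : Type*} [LinearOrder α] {g : List Bool → Bool} {n : ℕ} (hn : 1 ≤ n)
    (hconj : ∀ w, w.length = n → g (conj w) = !g w) (key : List Bool → α) (w₀ : List Bool)
    (hw₀ : w₀.length = n) (hkey : ∀ w, w.length = n → w ≠ w₀ → key w < key (step g w)) :
    (∀ w, w.length = n → ∀ i j, (step g)^[i] w = (step g)^[j] w ↔ i ≡ j [MOD 2 ^ n]) ∧
    ∀ w u, w.length = n → u.length = n → ∃ i < 2 ^ n, (step g)^[i] w = u := by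
  let V := {w : List Bool // w.length = n}
  have : Fintype V := (inferInstance : Fintype (List.Vector Bool n))
  have hcard : Fintype.card V = 2 ^ n := by
    have : Fintype.card (List.Vector Bool n) = 2 ^ n := by simp
    rw [← this]
    exact Fintype.card_congr (Equiv.refl _)
  let F : V → V := fun w => ⟨step g w.1, by
    have := length_step_iterate g hn w.2 1
    exact this⟩
  have hF : Function.Injective F := by
    intro w u h
    exact Subtype.ext (step_injOn hn hconj w.2 u.2 (congrArg Subtype.val h))
  let f : Equiv.Perm V := Equiv.ofBijective F (Finite.injective_iff_bijective.1 hF)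
  have hpow : ∀ (i : ℕ) (w : V), ((f ^ i) w).1 = (step g)^[i] w.1 := by
    intro i w
    induction i with
    | zero => rfl
    | succ i ih =>
      rw [pow_succ', Equiv.Perm.mul_apply, Function.iterate_succ_apply', ← ih]
      rfl
  have hreach : ∀ w : V, f.SameCycle w ⟨w₀, hw₀⟩ := by
    -- On a finite set the key cannot increase forever, so every orbit reaches `w₀`, the only string
    -- at which the key may fail to increase.
    have wf : WellFounded (fun u w : V => key w.1 < key u.1) :=
      have : IsTrans V (fun u w : V => key w.1 < key u.1) := ⟨fun _ _ _ h1 h2 => h2.trans h1⟩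
      have : Std.Irrefl (fun u w : V => key w.1 < key u.1) := ⟨fun _ h => lt_irrefl _ h⟩
      Finite.wellFounded_of_trans_of_irrefl _
    intro w
    induction w using wf.induction with
    | _ w ih =>
      by_cases hw : w.1 = w₀
      · have : w = ⟨w₀, hw₀⟩ := Subtype.ext hw
        rw [this]
      · exact Equiv.Perm.sameCycle_apply_left.1 (ih (f w) (hkey w.1 w.2 hw))
  have hcyc : f.IsCycleOn ((Finset.univ : Finset V) : Set V) := by
    refine ⟨by simp, fun x _ y _ => ?_⟩
    exact (hreach x).trans (hreach y).symm
  have hc : (Finset.univ : Finset V).card = 2 ^ n := by rw [Finset.card_univ, hcard]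
  refine ⟨fun w hw i j => ?_, fun w u hw hu => ?_⟩
  · rw [← hc, ← hcyc.pow_apply_eq_pow_apply (a := ⟨w, hw⟩) (Finset.mem_univ _), Subtype.ext_iff,
      hpow, hpow]
  · obtain ⟨i, hi, h⟩ := hcyc.exists_pow_eq (a := ⟨w, hw⟩) (b := ⟨u, hu⟩) (Finset.mem_univ _)
      (Finset.mem_univ _)
    refine ⟨i, hc ▸ hi, ?_⟩
    rw [← hpow i ⟨w, hw⟩, h]

/-! ### Generated sequences and their windows -/

theorem length_generate (g : List Bool → Bool) (m : ℕ) (w : List Bool) :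
    (generate g m w).length = m := by
  induction m generalizing w with
  | zero => rfl
  | succ m ih => simp [generate, ih]

theorem generate_succ_snoc (g : List Bool → Bool) (m : ℕ) (w : List Bool) :
    generate g (m + 1) w = generate g m w ++ [g ((step g)^[m] w)] := by
  induction m generalizing w with
  | zero => rfl
  | succ m ih =>
    rw [generate, ih, generate]
    rfl

theorem getElem_generate (g : List Bool → Bool) (m : ℕ) (w : List Bool) (i : ℕ)
    (h : i < (generate g m w).length) : (generate g m w)[i] = g ((step g)^[i] w) := by
  induction m generalizing w i with
  | zero => simp [generate] at h
  | succ m ih =>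
    cases i with
    | zero => simp [generate]
    | succ i =>
      simp only [generate, List.getElem_cons_succ]
      rw [ih]
      rfl

theorem window_append_generate (g : List Bool → Bool) (m : ℕ) {w : List Bool} (hw : w ≠ [])
    (i : ℕ) (h : i ≤ m) :
    ((w ++ generate g m w).drop i).take w.length = (step g)^[i] w := by
  induction i generalizing m w with
  | zero => simp
  | succ i ih =>
    cases m with
    | zero => omega
    | succ m =>
      cases w with
      | nil => simp at hw
      | cons a w =>
        have := ih m (w := step g (a :: w)) (by simp [step, shift]) (by omega)
        rw [Function.iterate_succ_apply, ← this, generate]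
        simp [step, shift]

theorem infix_iff_window {v s : List Bool} :
    v <:+: s ↔ ∃ i, i + v.length ≤ s.length ∧ (s.drop i).take v.length = v := by
  constructor
  · rintro ⟨a, b, rfl⟩
    exact ⟨a.length, by simp, by simp⟩
  · rintro ⟨i, _, h⟩
    rw [← h]
    exact (List.take_prefix _ _).isInfix.trans (List.drop_suffix _ _).isInfix

/-- After as many steps as the register has cells, all initial bits have left it. Hence the cyclic
windows of a generated sequence are states of the register. -/
theorem step_iterate_length (g : List Bool → Bool) {w : List Bool} (hw : w ≠ []) :
    (step g)^[w.length] w = generate g w.length w := by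
  rw [← window_append_generate g w.length hw _ le_rfl]
  simp [length_generate]

theorem isDeBruijn_generate {g : List Bool → Bool} {n : ℕ} (hn : 1 ≤ n) {w : List Bool}
    (hw : w.length = n)
    (hper : ∀ w, w.length = n → ∀ i j, (step g)^[i] w = (step g)^[j] w ↔ i ≡ j [MOD 2 ^ n])
    (hall : ∀ w u, w.length = n → u.length = n → ∃ i < 2 ^ n, (step g)^[i] w = u) :
    IsDeBruijn n (generate g (2 ^ n) w) := by
  have hlen := length_generate g (2 ^ n) w
  have hpos : 0 < 2 ^ n := by positivity
  have hn2 : n ≤ 2 ^ n := Nat.lt_two_pow_self.le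
  have key : ∀ i, ((generate g (2 ^ n) w).rotate i).take n = (step g)^[i] ((step g)^[n] w) := by
    intro i
    rw [← Function.iterate_add_apply, add_comm, Function.iterate_add_apply]
    have hl := length_step_iterate g hn hw i
    have h1 := step_iterate_length g (w := (step g)^[i] w) (by rintro h; simp [h] at hl; omega)
    rw [hl] at h1
    rw [h1]
    apply List.ext_getElem
    · simp [length_generate, hn2]
    · intro k h2 h3
      have hk : k < n := by simpa [length_generate] using h3
      rw [getElem_generate, ← Function.iterate_add_apply, List.getElem_take, List.getElem_rotate,
        getElem_generate, hlen]
      congr 1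
      rw [hper w hw]
      exact Nat.mod_modEq _ _
  refine ⟨hlen, fun u hu => ?_⟩
  have hl := length_step_iterate g hn hw n
  obtain ⟨i, hi, h⟩ := hall _ u hl hu
  refine ⟨i, ⟨hi, by rw [key, h]⟩, ?_⟩
  rintro j ⟨hj, h'⟩
  rw [key, ← h, hper _ hl] at h'
  exact Nat.ModEq.eq_of_lt_of_lt h' hj hi

theorem replicate_ne_of_head {n : ℕ} (hn : 1 ≤ n) (a : Bool) {v : List Bool} :
    List.replicate n a ≠ (!a) :: v := by
  cases n with
  | zero => omega
  | succ n => cases a <;> simp [List.replicate_succ]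

/-- A rule that increases a key, and that prefers the opposite of the last bit as the key
demands, generates the Prefer-opposite sequence, and this is a de Bruijn sequence. -/
theorem preferOpposite_of_key {α : Type*} [LinearOrder α] {g : List Bool → Bool} {n : ℕ}
    (hn : 2 ≤ n) (hconj : ∀ w, w.length = n → g (conj w) = !g w) (key : List Bool → α)
    (hkey : ∀ w, w.length = n → w ≠ true :: List.replicate (n - 1) false →
      key w < key (step g w))
    (hstart : g (true :: List.replicate (n - 1) false) = false)
    (hone : g (List.replicate n true) = false)
    (hord : ∀ a v, v.length = n - 1 → v ≠ List.replicate (n - 1) true →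
      g (a :: v) = v.getLastD false → key ((!a) :: v) < key (a :: v)) :
    IsDeBruijn n (preferOpposite n) ∧
      DB g (true :: List.replicate (n - 1) false) = preferOpposite n ∧
      (∀ w, w.length = n → ∀ i j, (step g)^[i] w = (step g)^[j] w ↔ i ≡ j [MOD 2 ^ n]) := by
  set w₀ := true :: List.replicate (n - 1) false with hw₀
  have hw₀l : w₀.length = n := by simp [w₀]; omega
  obtain ⟨hper, hall⟩ := step_cycle (by omega) hconj key w₀ hw₀l hkey
  have h2n : 2 ≤ 2 ^ n := by
    calc 2 = 2 ^ 1 := rfl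
      _ ≤ 2 ^ n := Nat.pow_le_pow_right (by omega) (by omega)
  set z₀ := List.replicate n false with hz₀
  have hz₀l : z₀.length = n := by simp [z₀]
  have hz₀e : z₀ = List.replicate (n - 1) false ++ [false] := by
    rw [hz₀, ← List.replicate_succ']
    congr 1
    omega
  have hw₀z : step g w₀ = z₀ := by
    simp only [step, shift, hstart]
    rw [hz₀e]
    rfl
  let z : ℕ → List Bool := fun i => (step g)^[i] z₀
  have hzl : ∀ i, (z i).length = n := fun i => length_step_iterate g (by omega) hz₀l i
  have hzs : ∀ i, z (i + 1) = step g (z i) := fun i => Function.iterate_succ_apply' _ _ _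
  have hzinj : ∀ i j, i < 2 ^ n → j < 2 ^ n → z i = z j → i = j := fun i j hi hj h =>
    Nat.ModEq.eq_of_lt_of_lt ((hper z₀ hz₀l i j).1 h) hi hj
  have hzall : ∀ u : List Bool, u.length = n → ∃ i < 2 ^ n, z i = u := fun u hu =>
    hall z₀ u hz₀l hu
  -- Since `w₀` is the predecessor of `0ⁿ`, the only possible failure of monotonicity is at the end
  -- of the orbit, and the keys increase along `z 0, …, z (2 ^ n - 1)`.
  have hzlast : z (2 ^ n - 1) = w₀ := by
    apply step_injOn (by omega) hconj (hzl _) hw₀l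
    rw [← hzs, hw₀z]
    exact (hper z₀ hz₀l _ 0).2 (by
      rw [show 2 ^ n - 1 + 1 = 2 ^ n by omega]; simp [Nat.ModEq])
  have hzne : ∀ i, i < 2 ^ n - 1 → z i ≠ w₀ := by
    intro i hi h
    rw [← hzlast] at h
    have := hzinj _ _ (by omega) (by omega) h
    omega
  have hmono : ∀ j, j < 2 ^ n → ∀ i, i < j → key (z i) < key (z j) := by
    intro j
    induction j with
    | zero => intro _ i hi; omega
    | succ j ih =>
      intro hj i hi
      have h1 : key (z j) < key (z (j + 1)) := by
        rw [hzs]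
        exact hkey _ (hzl j) (hzne j (by omega))
      rcases Nat.lt_succ_iff_lt_or_eq.1 hi with h | h
      · exact (ih (by omega) i h).trans h1
      · rw [h]; exact h1
  have hlt : ∀ i j, i < 2 ^ n → j < 2 ^ n → key (z i) < key (z j) → i < j := by
    intro i j hi hj h
    by_contra hc
    rcases Nat.lt_or_eq_of_le (not_lt.1 hc) with h1 | h1
    · exact absurd (hmono i hi j h1) (not_lt.2 h.le)
    · rw [h1] at h; exact lt_irrefl _ h
  let s : ℕ → List Bool := fun k => z₀ ++ generate g k z₀
  have hsl : ∀ k, (s k).length = n + k := fun k => by simp [s, length_generate, hz₀l]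
  have hsw : ∀ k i, i ≤ k → ((s k).drop i).take n = z i := fun k i hi => by
    have := window_append_generate g k (w := z₀) (by rw [hz₀e]; simp) i hi
    rwa [hz₀l] at this
  have hsuf : ∀ k, (s k).drop (k + 1) = (z k).tail := by
    intro k
    rw [← hsw k k le_rfl, List.take_of_length_le (by simp [hsl]), List.tail_drop]
  have hss : ∀ k, s (k + 1) = s k ++ [g (z k)] := fun k => by
    simp only [s, generate_succ_snoc, List.append_assoc]
    rfl
  have hdup : ∀ k b, CreatesDup n (s k) b ↔ ∃ i ≤ k, z i = (z k).tail ++ [b] := by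
    intro k b
    have h1 : (s k ++ [b]).drop ((s k).length + 1 - n) = (z k).tail ++ [b] := by
      rw [hsl, show n + k + 1 - n = k + 1 by omega,
        List.drop_append_of_le_length (by rw [hsl]; omega), hsuf]
    have h2 : ((z k).tail ++ [b]).length = n := by simp [hzl]; omega
    rw [CreatesDup, h1, infix_iff_window, h2, hsl]
    constructor
    · rintro ⟨i, hi, h⟩
      exact ⟨i, by omega, by rw [← h, hsw k i (by omega)]⟩
    · rintro ⟨i, hi, h⟩
      exact ⟨i, by omega, by rw [hsw k i hi, h]⟩
  have hlast : ∀ k, (s k).getLastD false = (z k).tail.getLastD false := by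
    intro k
    have h1 : (s k).drop (k + 1) ≠ [] := by
      intro h
      have := congrArg List.length h
      simp [hsl] at this
      omega
    rw [← hsuf, List.getLastD_eq_getLast?, List.getLastD_eq_getLast?,
      ← List.getLast?_append_of_ne_nil (List.take (k + 1) (s k)) h1, List.take_append_drop]
  have hsufiff : ∀ k, List.replicate (n - 1) true <:+ s k ↔
      (z k).tail = List.replicate (n - 1) true := by
    intro k
    rw [List.suffix_iff_eq_drop, List.length_replicate, hsl,
      show n + k - (n - 1) = k + 1 by omega, hsuf, eq_comm]
  have hcons : ∀ k, ∃ a, z k = a :: (z k).tail := by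
    intro k
    have := hzl k
    cases h : z k with
    | nil => simp [h] at this; omega
    | cons a v => exact ⟨a, rfl⟩
  have hones : ∀ j, (z j).tail = List.replicate (n - 1) true →
      z j = List.replicate n true ∨ z j = false :: List.replicate (n - 1) true := by
    intro j hj
    obtain ⟨a, ha⟩ := hcons j
    rw [hj] at ha
    cases a
    · exact Or.inr ha
    · left
      rw [ha, ← List.replicate_succ]
      congr 1
      omega
  have hn1 : List.replicate n true = true :: List.replicate (n - 1) true := by
    rw [← List.replicate_succ]; congr 1; omega
  have hg01 : g (false :: List.replicate (n - 1) true) = true := by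
    have h := hconj (List.replicate n true) (by simp)
    rw [hone] at h
    rw [hn1] at h
    exact h
  have hinf : ∀ k, k < 2 ^ n → (List.replicate (n - 1) true <:+: (s k).dropLast ↔
      ∃ j < k, (z j).tail = List.replicate (n - 1) true) := by
    intro k _
    have hw : ∀ j, j < k → (((s k).dropLast).drop (j + 1)).take (n - 1) = (z j).tail := by
      intro j hj
      rw [← hsw k j hj.le, ← List.drop_one, List.drop_take, List.drop_drop,
        List.dropLast_eq_take, hsl, List.drop_take, List.take_take]
      congr 1
      omega
    rw [infix_iff_window]
    simp only [List.length_replicate, List.length_dropLast, hsl]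
    constructor
    · rintro ⟨i, hi, h⟩
      cases i with
      | zero =>
        exfalso
        rw [List.dropLast_eq_take, List.drop_zero, List.take_take, hsl,
          min_eq_left (by omega)] at h
        simp only [s] at h
        rw [List.take_append_of_le_length (by omega), hz₀] at h
        have := congrArg List.head? h
        obtain ⟨m, rfl⟩ : ∃ m, n = m + 2 := ⟨n - 2, by omega⟩
        simp [List.replicate_succ] at this
      | succ j =>
        exact ⟨j, by omega, by rw [← hw j (by omega), h]⟩
    · rintro ⟨j, hj, h⟩
      exact ⟨j + 1, by omega, by rw [hw j hj, h]⟩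
  have hstep : ∀ k, k < 2 ^ n - 1 → greedyStep n (s k) = s (k + 1) := by
    intro k hk
    obtain ⟨a, ha⟩ := hcons k
    have hnew : ¬ ∃ i ≤ k, z i = z (k + 1) := by
      rintro ⟨i, hi, h⟩
      have := hzinj _ _ (by omega) (by omega) h
      omega
    have hzk : z (k + 1) = (z k).tail ++ [g (z k)] := hzs k
    have hb : greedyBit n (s k) = g (z k) := by
      unfold greedyBit
      by_cases hv : (z k).tail = List.replicate (n - 1) true
      · rw [if_pos ((hsufiff k).2 hv)]
        -- The string `01ⁿ⁻¹` is followed by `1ⁿ`. So the first occurrence of `1ⁿ⁻¹` is at `01ⁿ⁻¹`,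
        -- where the rule gives 1, and the second at `1ⁿ`, where it gives 0.
        rcases hones k hv with h | h
        · rw [h, hone, if_pos]
          rw [hinf k (by omega)]
          cases k with
          | zero =>
            exfalso
            have h0 : z 0 = z₀ := rfl
            rw [h0, hz₀, hn1] at h
            exact replicate_ne_of_head (by omega) false h
          | succ k =>
            refine ⟨k, by omega, ?_⟩
            have h3 : z k = false :: List.replicate (n - 1) true := by
              apply step_injOn (by omega) hconj (hzl k) (by simp; omega)
              rw [← hzs, h, step, shift, hg01, List.tail_cons, ← List.replicate_succ']
              congr 1
              omega
            rw [h3]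
            rfl
        · rw [h, hg01, if_neg]
          rw [hinf k (by omega)]
          rintro ⟨j, hj, hj'⟩
          rcases hones j hj' with h3 | h3
          · cases j with
            | zero =>
              have h0 : z 0 = z₀ := rfl
              rw [h0, hz₀, hn1] at h3
              exact replicate_ne_of_head (by omega) false h3
            | succ j =>
              have h4 : z j = false :: List.replicate (n - 1) true := by
                apply step_injOn (by omega) hconj (hzl j) (by simp; omega)
                rw [← hzs, h3, step, shift, hg01, List.tail_cons, ← List.replicate_succ']
                congr 1
                omega
              have := hzinj j k (by omega) (by omega) (h4.trans h.symm)
              omega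
          · have := hzinj j k (by omega) (by omega) (h3.trans h.symm)
            omega
      · rw [if_neg (fun h => hv ((hsufiff k).1 h)), hlast]
        -- If the rule repeats the last bit, the conjugate has a smaller key, hence was visited
        -- before and was followed by the opposite bit: that window is a duplicate. Otherwise the
        -- opposite bit leads to the state `z (k + 1)`, which is new.
        by_cases hg : g (z k) = (z k).tail.getLastD false
        · rw [if_pos, hg]
          rw [hdup]
          have h1 := hord a (z k).tail (by simp [hzl]) hv (by rw [← ha]; exact hg)
          rw [← ha] at h1
          obtain ⟨j, hj, hj'⟩ := hzall ((!a) :: (z k).tail) (by simp [hzl]; omega)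
          rw [← hj'] at h1
          have h2 := hlt j k hj (by omega) h1
          refine ⟨j + 1, by omega, ?_⟩
          have h3 := hconj (z k) (hzl k)
          rw [ha, conj, ← hj', ← ha, hg] at h3
          rw [hzs, step, shift, h3, hj', List.tail_cons]
        · have h1 : (!(z k).tail.getLastD false) = g (z k) := by
            revert hg
            cases g (z k) <;> cases (z k).tail.getLastD false <;> simp
          simp only [h1]
          rw [if_neg]
          rw [hdup, ← hzk]
          exact hnew
    rw [greedyStep, hb, if_neg, hss]
    rw [hdup, ← hzk]
    exact hnew
  -- At `10ⁿ⁻¹` both continuations are used up: `0ⁿ⁻¹1` is `z 1` and `0ⁿ` is `z 0`.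
  have hfin : greedyStep n (s (2 ^ n - 1)) = s (2 ^ n - 1) := by
    have htail : (z (2 ^ n - 1)).tail = List.replicate (n - 1) false := by rw [hzlast, hw₀]; rfl
    have hbit : greedyBit n (s (2 ^ n - 1)) = false := by
      unfold greedyBit
      obtain ⟨m, hm⟩ : ∃ m, n - 1 = m + 1 := ⟨n - 2, by omega⟩
      have hl : (List.replicate (n - 1) false).getLastD false = false := by
        rw [hm, List.replicate_succ']
        simp
      rw [if_neg, hlast, htail, hl, if_pos]
      · rw [hdup, htail]
        refine ⟨1, by omega, ?_⟩
        have h1 := hconj w₀ hw₀l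
        have h2 : conj w₀ = z₀ := by
          simp only [hw₀, conj, hz₀, Bool.not_true]
          rw [← List.replicate_succ]
          congr 1
          omega
        rw [h2, hstart] at h1
        rw [hzs]
        change step g z₀ = _
        rw [step, shift, h1, hz₀]
        simp
      · rw [hsufiff, htail, hm]
        simp [List.replicate_succ]
    rw [greedyStep, hbit, if_pos]
    rw [hdup, htail]
    exact ⟨0, by omega, hz₀e⟩
  have hiter : ∀ k, k ≤ 2 ^ n - 1 → (greedyStep n)^[k] z₀ = s k := by
    intro k
    induction k with
    | zero => intro _; simp [s, generate]
    | succ k ih =>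
      intro hk
      rw [Function.iterate_succ_apply', ih (by omega), hstep k (by omega)]
  have hgs : greedyString n = s (2 ^ n - 1) := by
    rw [greedyString, ← hz₀e]
    obtain ⟨m, hm⟩ : ∃ m, 2 ^ n = m + 1 := ⟨2 ^ n - 1, by omega⟩
    have h1 := hiter m (by omega)
    rw [hm] at hfin ⊢
    rw [Function.iterate_succ_apply', h1]
    exact hfin
  have hDB : DB g w₀ = preferOpposite n := by
    rw [preferOpposite, hgs, DB, hw₀l]
    obtain ⟨m, hm⟩ : ∃ m, 2 ^ n = m + 1 := ⟨2 ^ n - 1, by omega⟩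
    rw [hm, generate, hstart]
    change false :: generate g m (shift w₀ false) = List.drop (n - 1) (s m)
    have h3 : shift w₀ false = z₀ := by rw [← hw₀z, step, hstart]
    rw [h3]
    simp only [s]
    conv_rhs => rw [hz₀e]
    rw [List.append_assoc, List.drop_append_of_le_length (by simp),
      List.drop_of_length_le (by simp)]
    rw [← hz₀e]
    rfl
  refine ⟨?_, hDB, hper⟩
  rw [← hDB, DB, hw₀l]
  exact isDeBruijn_generate (by omega) hw₀l hper hall

end PreferOpposite

namespace PreferOpposite

/-! ### Lexicographic order and rotations -/

theorem cons_lt_cons_iff {a b : ℕ} {l m : List ℕ} : a :: l < b :: m ↔ a < b ∨ a = b ∧ l < m :=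
  List.cons_lt_cons_iff

theorem cons_le_cons_iff {a b : ℕ} {l m : List ℕ} : a :: l ≤ b :: m ↔ a < b ∨ a = b ∧ l ≤ m := by
  rw [← not_lt, cons_lt_cons_iff, ← not_lt]
  constructor
  · intro h
    push Not at h
    rcases lt_or_eq_of_le h.1 with h1 | h1
    · exact Or.inl h1
    · exact Or.inr ⟨h1, not_lt.2 (h.2 h1.symm)⟩
  · rintro (h | ⟨rfl, h⟩) (h' | ⟨h', h''⟩)
    · omega
    · omega
    · omega
    · exact h h''

theorem append_lt_append_left_iff (P l m : List ℕ) : P ++ l < P ++ m ↔ l < m := by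
  induction P with
  | nil => rfl
  | cons a P ih => simp [ih]

theorem append_le_append_left_iff (P l m : List ℕ) : P ++ l ≤ P ++ m ↔ l ≤ m := by
  rw [← not_lt, append_lt_append_left_iff, not_lt]

/-- No rotation of `s` is lexicographically smaller than `s`. -/
def IsMin (s : List ℕ) : Prop := ∀ i, s ≤ s.rotate i

theorem exists_rotate_isMin (L : List ℕ) : ∃ i, IsMin (L.rotate i) := by
  by_cases hL : L = []
  · exact ⟨0, fun i => by simp [hL]⟩
  have hpos : 0 < L.length := List.length_pos_iff.2 hL
  obtain ⟨i, _, hi⟩ := Finset.exists_min_image (Finset.range L.length) (fun i => L.rotate i)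
    ⟨0, by simpa using hpos⟩
  refine ⟨i, fun j => ?_⟩
  rw [List.rotate_rotate, ← List.rotate_mod L (i + j)]
  exact hi _ (by simpa using Nat.mod_lt _ hpos)

theorem rotate_add_length_mul (L : List ℕ) (i k : ℕ) :
    L.rotate (i + L.length * k) = L.rotate i := by
  rw [← List.rotate_mod, Nat.add_mul_mod_self_left, List.rotate_mod]

theorem exists_rotate_rotate (L : List ℕ) (i : ℕ) : ∃ j, (L.rotate i).rotate j = L := by
  refine ⟨L.length * i - i, ?_⟩
  rw [List.rotate_rotate]
  by_cases hL : L = []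
  · simp [hL]
  have : i ≤ L.length * i := Nat.le_mul_of_pos_left _ (List.length_pos_iff.2 hL)
  rw [show i + (L.length * i - i) = L.length * i by omega, List.rotate_length_mul]

theorem IsMin.eq_of_rotate {s t : List ℕ} (hs : IsMin s) (ht : IsMin t) {i : ℕ}
    (h : s.rotate i = t) : s = t := by
  apply le_antisymm
  · rw [← h]; exact hs i
  · obtain ⟨j, hj⟩ := exists_rotate_rotate s i
    rw [h] at hj
    have := ht j
    rwa [hj] at this

/-! ### The cycles of the pure run-length register -/

theorem feedback_conj {w : List Bool} (hw : 2 ≤ w.length) : feedback (conj w) = !feedback w := by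
  match w, hw with
  | a :: b :: w, _ =>
    simp only [feedback, conj, List.getD_cons_zero, List.getD_cons_succ, List.getLastD_cons]
    cases a <;> cases b <;> simp

theorem prr_injOn {n : ℕ} (hn : 2 ≤ n) {w u : List Bool} (hw : w.length = n) (hu : u.length = n)
    (h : prr w = prr u) : w = u :=
  step_injOn (g := feedback) (by omega) (fun v hv => feedback_conj (by omega)) hw hu h

theorem length_prr_iterate {n : ℕ} (hn : 2 ≤ n) {w : List Bool} (hw : w.length = n) (i : ℕ) :
    (prr^[i] w).length = n :=
  length_step_iterate feedback (by omega) hw i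

theorem prr_iterate_injOn {n : ℕ} (hn : 2 ≤ n) {w u : List Bool} (hw : w.length = n)
    (hu : u.length = n) {i : ℕ} (h : prr^[i] w = prr^[i] u) : w = u := by
  induction i with
  | zero => exact h
  | succ i ih =>
    rw [Function.iterate_succ_apply', Function.iterate_succ_apply'] at h
    exact ih (prr_injOn hn (length_prr_iterate hn hw i) (length_prr_iterate hn hu i) h)

theorem exists_prr_iterate_self {n : ℕ} (hn : 2 ≤ n) {w : List Bool} (hw : w.length = n) :
    ∃ k, 0 < k ∧ prr^[k] w = w := by
  let V := {w : List Bool // w.length = n}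
  have : Finite V := (inferInstance : Finite (List.Vector Bool n))
  let F : V → V := fun w => ⟨prr w.1, length_prr_iterate hn w.2 1⟩
  have hF : Function.Injective F := by
    intro w u h
    exact Subtype.ext (prr_injOn hn w.2 u.2 (congrArg Subtype.val h))
  have hpow : ∀ (i : ℕ) (w : V), (F^[i] w).1 = prr^[i] w.1 := by
    intro i w
    induction i with
    | zero => rfl
    | succ i ih =>
      rw [Function.iterate_succ_apply', Function.iterate_succ_apply', ← ih]
  obtain ⟨k, hk, h⟩ := Function.mem_periodicPts.1 (hF.mem_periodicPts ⟨w, hw⟩)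
  refine ⟨k, hk, ?_⟩
  have := congrArg Subtype.val h
  rwa [hpow] at this

theorem InCycle.refl (w : List Bool) : InCycle w w := ⟨0, rfl⟩

theorem InCycle.trans {w u v : List Bool} (h1 : InCycle w u) (h2 : InCycle u v) :
    InCycle w v := by
  obtain ⟨i, rfl⟩ := h1
  obtain ⟨j, rfl⟩ := h2
  exact ⟨j + i, Function.iterate_add_apply _ _ _ _⟩

theorem InCycle.prr {w u : List Bool} (h : InCycle w u) : InCycle w (prr u) := by
  obtain ⟨i, rfl⟩ := h
  exact ⟨i + 1, Function.iterate_succ_apply' _ _ _⟩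

theorem InCycle.length_eq {n : ℕ} (hn : 2 ≤ n) {w u : List Bool} (hw : w.length = n)
    (h : InCycle w u) : u.length = n := by
  obtain ⟨i, rfl⟩ := h
  exact length_prr_iterate hn hw i

theorem InCycle.symm {n : ℕ} (hn : 2 ≤ n) {w u : List Bool} (hw : w.length = n)
    (h : InCycle w u) : InCycle u w := by
  obtain ⟨j, rfl⟩ := h
  obtain ⟨k, hk, h⟩ := exists_prr_iterate_self hn hw
  refine ⟨k * j - j, ?_⟩
  have hj : j ≤ k * j := Nat.le_mul_of_pos_left _ hk
  rw [← Function.iterate_add_apply, Nat.sub_add_cancel hj, Function.iterate_mul]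
  exact Function.iterate_fixed h j

theorem inCycle_full_rotate (h : Bool) {L : List ℕ} (hL : L ≠ []) (hpos : ∀ r ∈ L, 0 < r) (i : ℕ) :
    InCycle (full h L) (full (xor h i.bodd) (L.rotate i)) := by
  induction i generalizing h L with
  | zero => simpa using InCycle.refl _
  | succ i ih =>
    cases L with
    | nil => simp at hL
    | cons l L =>
      rw [List.rotate_cons_succ, Nat.bodd_succ]
      refine InCycle.trans ⟨l, prr_iterate_full_self h hpos⟩ ?_
      have := ih (!h) (L := L ++ [l]) (by simp) (by
        intro r hr
        apply hpos
        simp at hr ⊢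
        tauto)
      convert this using 2
      cases h <;> simp

/-- The index `i` counts rotations, and `p + q` is the entry that is being carried from the front to
the end, `q` units of it having arrived. -/
theorem inCycle_full_iff (h : Bool) {L : List ℕ} (hL : L ≠ []) (hpos : ∀ r ∈ L, 0 < r)
    (u : List Bool) :
    InCycle (full h L) u ↔ ∃ i M p q, L.rotate i = M ++ [p + q] ∧ 0 < q ∧
      u = node (xor h i.bodd) M p q := by
  constructor
  · rintro ⟨k, rfl⟩
    induction k with
    | zero =>
      refine ⟨0, L.dropLast, 0, L.getLast hL, ?_, hpos _ (by simp), ?_⟩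
      · simp [List.dropLast_append_getLast]
      · simp [node_zero, List.dropLast_append_getLast]
    | succ k ih =>
      obtain ⟨i, M, p, q, h1, hq, h2⟩ := ih
      rw [Function.iterate_succ_apply', h2]
      cases p with
      | succ p =>
        exact ⟨i, M, p, q + 1, by rw [h1]; congr 2; omega, by omega, prr_node_succ _ _ _ hq⟩
      | zero =>
        rw [zero_add] at h1
        obtain ⟨l, L', hl⟩ := List.exists_cons_of_ne_nil (l := M ++ [q]) (by simp)
        have hp : ∀ r ∈ l :: L', 0 < r := by
          intro r hr
          rw [← hl, ← h1] at hr
          exact hpos r (List.mem_rotate.1 hr)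
        refine ⟨i + 1, L', l - 1, 1, ?_, one_pos, ?_⟩
        · rw [← List.rotate_rotate, h1, hl]
          have := hp l (by simp)
          rw [show l - 1 + 1 = l by omega]
          simp
        · rw [node_zero, hl, prr_full_cons _ hp]
          congr 1
          rw [Nat.bodd_succ]
          cases h <;> simp
  · rintro ⟨i, M, p, q, h1, hq, rfl⟩
    -- Adding `L.length * 2` changes neither the rotation nor the parity of `i`, and provides a
    -- predecessor `j`, from whose rotation the string is reached in `q` steps.
    obtain ⟨j, hj⟩ : ∃ j, i + L.length * 2 = j + 1 :=
      ⟨i + L.length * 2 - 1, by have := List.length_pos_iff.2 hL; omega⟩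
    have hb : (j + 1).bodd = i.bodd := by rw [← hj]; simp [Nat.bodd_add, Nat.bodd_mul]
    have hr : L.rotate (j + 1) = M ++ [p + q] := by rw [← hj, rotate_add_length_mul, h1]
    rw [← List.rotate_rotate] at hr
    obtain ⟨l, L', hl⟩ := List.exists_cons_of_ne_nil (l := L.rotate j) (by simpa using hL)
    have hp : ∀ r ∈ l :: L', 0 < r := by
      intro r hr
      rw [← hl] at hr
      exact hpos r (List.mem_rotate.1 hr)
    rw [hl] at hr
    simp only [List.rotate_cons_succ, List.rotate_zero] at hr
    obtain ⟨rfl, hlq⟩ := List.append_inj' hr rfl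
    have hlq : l = p + q := by simpa using hlq
    refine (inCycle_full_rotate h hL hpos j).trans ⟨q, ?_⟩
    rw [hl, prr_iterate_full _ hp hq (by omega), ← hb, Nat.bodd_succ]
    congr 1
    · cases h <;> simp
    · omega

/-- The pairs `(c, s)` for which `full c s` is an RL2-rep. -/
structure Canon (c : Bool) (s : List ℕ) : Prop where
  ne_nil : s ≠ []
  pos : ∀ r ∈ s, 0 < r
  isMin : IsMin s
  odd : c = true → ∀ i : ℕ, i.bodd = true → s.rotate i ≠ s

/-- The least rotation is unique, and the bit is ambiguous only if an odd rotation fixes it; in that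
case `odd` forbids the bit 1. -/
theorem Canon.unique {c c' : Bool} {s s' : List ℕ} (hs : Canon c s) (hs' : Canon c' s')
    (h : InCycle (full c s) (full c' s')) : c = c' ∧ s = s' := by
  rw [inCycle_full_iff c hs.ne_nil hs.pos] at h
  obtain ⟨i, M, p, q, h1, hq, h2⟩ := h
  have hM : ∀ r ∈ M, 0 < r := fun r hr =>
    hs.pos r (List.mem_rotate.1 (show r ∈ s.rotate i by rw [h1]; simp [hr]))
  have h3 := congrArg rle h2
  rw [rle_full _ hs'.pos, rle_node _ hM _ hq] at h3
  have hp : p = 0 := by simp at h3; omega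
  subst hp
  have h4 := congrArg List.head? h2
  rw [head?_node, full, ofRuns_one] at h4
  simp at h3 h4
  rw [zero_add, ← h3] at h1
  have := hs.isMin.eq_of_rotate hs'.isMin h1
  subst this
  refine ⟨?_, rfl⟩
  cases hi : i.bodd
  · simp [hi] at h4; exact h4.symm
  · have h5 := hs.odd
    have h6 := hs'.odd
    cases c <;> cases c'
    · rfl
    · exact absurd h1 (h6 rfl i hi)
    · exact absurd h1 (h5 rfl i hi)
    · rfl

theorem exists_canon {n : ℕ} (hn : 2 ≤ n) {w : List Bool} (hw : w.length = n)
    (h0 : w ≠ List.replicate w.length false) (h1 : w ≠ List.replicate w.length true) :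
    ∃ c s, Canon c s ∧ InCycle (full c s) w := by
  obtain ⟨h, M, p, q, hq, hM, rfl⟩ := eq_node_of_not_const h0 h1
  have h2 : InCycle (node h M p q) (full h (M ++ [q + p])) := by
    refine ⟨p, ?_⟩
    rw [prr_iterate_node _ _ _ hq _ le_rfl, Nat.sub_self, node_zero]
  set L := M ++ [q + p] with hL
  have hLne : L ≠ [] := by simp [hL]
  have hLpos : ∀ r ∈ L, 0 < r := by
    intro r hr
    simp [hL] at hr
    rcases hr with hr | hr
    · exact hM r hr
    · omega
  obtain ⟨i, hi⟩ := exists_rotate_isMin L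
  have h3 := h2.trans (inCycle_full_rotate h hLne hLpos i)
  have hne : L.rotate i ≠ [] := by simpa using hLne
  have hpos : ∀ r ∈ L.rotate i, 0 < r := fun r hr => hLpos r (List.mem_rotate.1 hr)
  set c := xor h i.bodd
  -- If an odd rotation fixes the list, the cycle contains this string with either first bit, and
  -- the bit 0 is chosen.
  by_cases hc : c = true ∧ ∃ j : ℕ, j.bodd = true ∧ (L.rotate i).rotate j = L.rotate i
  · obtain ⟨hc, j, hj, hj'⟩ := hc
    refine ⟨false, L.rotate i, ⟨hne, hpos, hi, by simp⟩, ?_⟩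
    have h4 := inCycle_full_rotate c hne hpos j
    rw [hj', hj, hc] at h4
    rw [hc] at h3
    exact (h3.trans h4).symm hn hw
  · refine ⟨c, L.rotate i, ⟨hne, hpos, hi, ?_⟩, h3.symm hn hw⟩
    intro hc' j hj hj'
    exact hc ⟨hc', j, hj, hj'⟩

theorem not_const_of_full {h : Bool} {L : List ℕ} (hL : L ≠ []) (hpos : ∀ r ∈ L, 0 < r)
    (m : ℕ) (b : Bool) : full h L ≠ List.replicate m b := by
  obtain ⟨w, hw⟩ := ofRuns_eq_cons (!h) hL hpos
  rw [full, ofRuns_one, hw]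
  intro he
  have h1 : ∀ x ∈ h :: (!h) :: w, x = b := by rw [he]; simp
  have h2 := h1 h (by simp)
  have h3 := h1 (!h) (by simp)
  rw [h2] at h3
  simp at h3

theorem Canon.isRL2Rep {c : Bool} {s : List ℕ} (hs : Canon c s) : IsRL2Rep (full c s) := by
  intro u hu
  rw [inCycle_full_iff c hs.ne_nil hs.pos] at hu
  obtain ⟨i, M, p, q, h1, hq, rfl⟩ := hu
  have hM : ∀ r ∈ M, 0 < r := fun r hr =>
    hs.pos r (List.mem_rotate.1 (show r ∈ s.rotate i by rw [h1]; simp [hr]))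
  rw [rle_full _ hs.pos, rle_node _ hM _ hq]
  refine ⟨?_, ?_⟩
  · rw [cons_le_cons_iff]
    cases p with
    | succ p => left; omega
    | zero =>
      right
      rw [zero_add] at h1
      refine ⟨rfl, ?_⟩
      rw [← h1]
      exact hs.isMin i
  · intro he hne
    have hp : p = 0 := by simp at he; omega
    subst hp
    simp at he
    rw [zero_add, he] at h1
    rw [full, ofRuns_one]
    cases c
    · rfl
    · exfalso
      cases hi : i.bodd
      · apply hne
        rw [node_zero, he, hi]
        rfl
      · exact hs.odd rfl i hi h1

theorem exists_canon_of_isRL2Rep {w : List Bool} (h0 : w ≠ List.replicate w.length false)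
    (h1 : w ≠ List.replicate w.length true) (hw : IsRL2Rep w) :
    ∃ c s, Canon c s ∧ w = full c s := by
  obtain ⟨h, M, p, q, hq, hM, rfl⟩ := eq_node_of_not_const h0 h1
  have h2 := (hw _ ⟨p, prr_iterate_node _ _ _ hq _ le_rfl⟩).1
  rw [Nat.sub_self, rle_node _ hM _ hq, rle_node _ hM _ (by omega), cons_le_cons_iff] at h2
  have hp : p = 0 := by omega
  subst hp
  rw [node_zero] at hw ⊢
  set L := M ++ [q] with hL
  have hLne : L ≠ [] := by simp [hL]
  have hLpos : ∀ r ∈ L, 0 < r := by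
    intro r hr
    simp [hL] at hr
    rcases hr with hr | hr
    · exact hM r hr
    · omega
  refine ⟨h, L, ⟨hLne, hLpos, fun i => ?_, fun hc i hi he => ?_⟩, rfl⟩
  · have h3 := (hw _ (inCycle_full_rotate h hLne hLpos i)).1
    rw [rle_full _ hLpos, rle_full _ (fun r hr => hLpos r (List.mem_rotate.1 hr)),
      cons_le_cons_iff] at h3
    simpa using h3
  · have h3 := (hw _ (inCycle_full_rotate h hLne hLpos i)).2
    rw [he, rle_full _ hLpos, rle_full _ hLpos, hi, hc] at h3
    have h4 := h3 rfl (by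
      intro h5
      have := congrArg List.head? h5
      simp [full, ofRuns_one] at this)
    simp [full, ofRuns_one] at h4

/-! ### Constant cycles and explicit opp-reps -/

theorem prr_replicate {n : ℕ} (hn : 2 ≤ n) (b : Bool) :
    prr (List.replicate n b) = List.replicate n b := by
  obtain ⟨m, rfl⟩ : ∃ m, n = m + 2 := ⟨n - 2, by omega⟩
  have h : feedback (List.replicate (m + 2) b) = b := by
    have h1 : (List.replicate (m + 2) b).getLastD false = b := by
      rw [List.replicate_succ', List.getLastD_concat]
    rw [feedback, h1]
    simp [List.replicate_succ]
  rw [prr, h, shift, List.tail_replicate, ← List.replicate_succ']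
  rfl

theorem inCycle_replicate_iff {n : ℕ} (hn : 2 ≤ n) (b : Bool) (u : List Bool) :
    InCycle (List.replicate n b) u ↔ u = List.replicate n b := by
  constructor
  · rintro ⟨k, rfl⟩
    exact Function.iterate_fixed (prr_replicate hn b) k
  · rintro rfl
    exact InCycle.refl _

/-- The shape `x^z y` with `z` odd and `x < y`. -/
def Spec (s : List ℕ) : Prop :=
  ∃ x y z : ℕ, Odd z ∧ x < y ∧ s = List.replicate z x ++ [y]

open Classical in
/-- The opp-rep of the cycle with the RL2-rep `full c s`. -/
noncomputable def opp (c : Bool) (s : List ℕ) : List Bool :=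
  if c = true ∧ Spec s then full c s else full (!c) (s.getLastD 0 :: s.dropLast)

theorem opp_of_spec {c : Bool} {s : List ℕ} (h : c = true ∧ Spec s) : opp c s = full c s :=
  if_pos h

theorem opp_snoc {c : Bool} {u : List ℕ} {b : ℕ} (h : ¬ (c = true ∧ Spec (u ++ [b]))) :
    opp c (u ++ [b]) = full (!c) (b :: u) := by
  rw [opp, if_neg h, List.getLastD_concat, List.dropLast_concat]

theorem isSpecial2_full {c : Bool} {s : List ℕ} (hs : ∀ r ∈ s, 0 < r) :
    IsSpecial2 (full c s) ↔ c = true ∧ Spec s := by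
  rw [IsSpecial2, rle_full _ hs, Spec, full, ofRuns_one]
  simp

theorem Canon.exists_snoc {c : Bool} {s : List ℕ} (hs : Canon c s) : ∃ u b, s = u ++ [b] :=
  ⟨_, _, (List.dropLast_append_getLast hs.ne_nil).symm⟩

theorem Canon.two_le_length_full {c : Bool} {s : List ℕ} (hs : Canon c s) (h : Bool) :
    2 ≤ (full h s).length := by
  rw [length_full]
  have := List.single_le_sum (l := s) (by simp) _ (List.getLast_mem hs.ne_nil)
  have := hs.pos _ (List.getLast_mem hs.ne_nil)
  omega

theorem Canon.opp_inCycle {c : Bool} {s : List ℕ} (hs : Canon c s) :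
    InCycle (full c s) (opp c s) := by
  by_cases h : c = true ∧ Spec s
  · rw [opp_of_spec h]
    exact InCycle.refl _
  · obtain ⟨u, b, rfl⟩ := hs.exists_snoc
    rw [opp_snoc h]
    have hp : ∀ r ∈ b :: u, 0 < r := fun r hr => hs.pos r (by simp at hr ⊢; tauto)
    have h1 : InCycle (full (!c) (b :: u)) (full c (u ++ [b])) :=
      ⟨b, by rw [prr_iterate_full_self _ hp, Bool.not_not]⟩
    have h2 := hs.two_le_length_full (!c)
    refine h1.symm (n := (u ++ [b]).sum + 1) ?_ ?_
    · rwa [length_full] at h2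
    · rw [length_full]
      simp
      omega

theorem isOppRep_iff {n : ℕ} (hn : 2 ≤ n) {w : List Bool} (hw : w.length = n)
    (h0 : w ≠ List.replicate w.length false) (h1 : w ≠ List.replicate w.length true) :
    IsOppRep w ↔ ∃ c s, Canon c s ∧ w = opp c s := by
  constructor
  · rintro ⟨u, hwu, hu, h⟩
    have hul := hwu.length_eq hn hw
    have huc : ∀ b, u ≠ List.replicate u.length b := by
      intro b hb
      rw [hul] at hb
      have h2 := hwu.symm hn hw
      rw [hb, inCycle_replicate_iff hn] at h2
      rw [hw] at h0 h1
      cases b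
      · exact h0 h2
      · exact h1 h2
    obtain ⟨c, s, hs, rfl⟩ := exists_canon_of_isRL2Rep (huc _) (huc _) hu
    refine ⟨c, s, hs, ?_⟩
    rw [isSpecial2_full hs.pos] at h
    rcases h with ⟨h2, h3⟩ | ⟨h2, h3⟩
    · rw [opp_of_spec h2, h3]
    · rcases h3 with h3 | h3 | ⟨r₂, r, h3, h4⟩
      · exact absurd h3 h0
      · exact absurd h3 h1
      · obtain ⟨h, M, p, q, hq, hM, rfl⟩ := eq_node_of_not_const h0 h1
        rw [rle_node _ hM _ hq] at h3
        simp only [List.cons.injEq] at h3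
        obtain ⟨hp, h3⟩ := h3
        have hp : p = 0 := by omega
        subst hp
        rw [node_zero, h3] at hwu h4 hw ⊢
        have hpos : ∀ x ∈ r₂ :: r, 0 < x := by
          intro x hx
          rw [← h3] at hx
          simp at hx
          rcases hx with hx | rfl
          · exact hM x hx
          · exact hq
        have h5 : InCycle (full h (r₂ :: r)) (full (!h) (r ++ [r₂])) :=
          ⟨r₂, prr_iterate_full_self h hpos⟩
        rw [prr_iterate_full_self h hpos] at h4
        have hpos' : ∀ x ∈ r ++ [r₂], 0 < x := fun x hx => hpos x (by simp at hx ⊢; tauto)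
        obtain ⟨c', s', hs', he⟩ := exists_canon_of_isRL2Rep
          (not_const_of_full (by simp) hpos' _ _) (not_const_of_full (by simp) hpos' _ _) h4
        have h6 := hs'.unique hs (by
          rw [← he]
          exact (h5.symm hn hw).trans hwu)
        obtain ⟨rfl, rfl⟩ := h6
        have h7 := congrArg rle he
        rw [rle_full _ hpos', rle_full _ hs.pos] at h7
        have h8 := congrArg List.head? he
        simp [full, ofRuns_one] at h7 h8
        rw [← h7] at h2 ⊢
        rw [opp_snoc h2, ← h8]
  · rintro ⟨c, s, hs, rfl⟩
    have hl := hs.opp_inCycle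
    have hfl : (full c s).length = n := by
      obtain ⟨k, hk⟩ := hl
      have h2 := length_prr_iterate (hs.two_le_length_full c) rfl k
      rw [hk, hw] at h2
      exact h2.symm
    refine ⟨full c s, hl.symm hn hfl, hs.isRL2Rep, ?_⟩
    rw [isSpecial2_full hs.pos]
    by_cases h : c = true ∧ Spec s
    · exact Or.inl ⟨h, opp_of_spec h⟩
    · refine Or.inr ⟨h, Or.inr (Or.inr ?_)⟩
      obtain ⟨u, b, rfl⟩ := hs.exists_snoc
      rw [opp_snoc h]
      have hp : ∀ r ∈ b :: u, 0 < r := fun r hr => hs.pos r (by simp at hr ⊢; tauto)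
      refine ⟨b, u, rle_full _ hp, ?_⟩
      rw [prr_iterate_full_self _ hp, Bool.not_not]
      exact hs.isRL2Rep

theorem isOppRep_replicate {n : ℕ} (hn : 2 ≤ n) (b : Bool) : IsOppRep (List.replicate n b) := by
  refine ⟨List.replicate n b, InCycle.refl _, ?_, Or.inr ⟨?_, ?_⟩⟩
  · intro u hu
    rw [inCycle_replicate_iff hn] at hu
    subst hu
    exact ⟨le_rfl, fun _ h => absurd rfl h⟩
  · rintro ⟨_, x, y, z, hz, _, h⟩
    have h2 : List.replicate n b = ofRuns b [n] := by simp [ofRuns_cons]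
    rw [h2, rle_ofRuns _ (by simp; omega)] at h
    simp at h
  · cases b
    · left; simp
    · right; left; simp

end PreferOpposite

namespace PreferOpposite

/-! ### Merging two cyclically adjacent runs -/

theorem append_lt_append_of_lt {l m : List ℕ} (h : l < m) (hl : l.length = m.length)
    (l' m' : List ℕ) : l ++ l' < m ++ m' := by
  induction l generalizing m with
  | nil =>
    have : m = [] := by simpa using hl.symm
    subst this
    exact absurd h (lt_irrefl _)
  | cons a l ih =>
    cases m with
    | nil => simp at hl
    | cons b m =>
      rw [cons_lt_cons_iff] at h
      rw [List.cons_append, List.cons_append, cons_lt_cons_iff]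
      rcases h with h | ⟨h1, h2⟩
      · exact Or.inl h
      · exact Or.inr ⟨h1, ih h2 (by simpa using hl)⟩

theorem lt_of_prefix {P A B : List ℕ} {e e' : ℕ} (he : e < e') (hA : P ++ [e] <+: A)
    (hB : P ++ [e'] <+: B) : A < B := by
  obtain ⟨A', rfl⟩ := hA
  obtain ⟨B', rfl⟩ := hB
  simp only [List.append_assoc, List.singleton_append]
  rw [append_lt_append_left_iff, cons_lt_cons_iff]
  exact Or.inl he

theorem prefix_cases {u V M Y : List ℕ} (h : u ++ V ≤ M ++ Y) (hl : M.length ≤ u.length) :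
    (∃ P e e', e < e' ∧ P ++ [e] <+: u ∧ P ++ [e'] <+: M) ∨
      ∃ u', u = M ++ u' ∧ u' ++ V ≤ Y := by
  induction M generalizing u with
  | nil => exact Or.inr ⟨u, rfl, h⟩
  | cons m M ih =>
    cases u with
    | nil => simp at hl
    | cons x u =>
      rw [List.cons_append, List.cons_append, cons_le_cons_iff] at h
      rcases h with h | ⟨rfl, h⟩
      · exact Or.inl ⟨[], x, m, h, by simp, by simp⟩
      · rcases ih h (by simpa using hl) with ⟨P, e, e', h1, h2, h3⟩ | ⟨u', h1, h2⟩
        · exact Or.inl ⟨x :: P, e, e', h1, by simpa using h2, by simpa using h3⟩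
        · exact Or.inr ⟨u', by rw [h1]; rfl, h2⟩

/-- `T` has the form `M₂, l₁ + lk, M₁`, and `M₂, lk, l₁, M₁` is a rotation of the least list, hence
not below it. Either `u` falls below inside `M₂`; or it begins with `M₂` followed by an entry `e ≤
lk < l₁ + lk`; or `u = M₂`, which forces `M₁ = []`. -/
theorem merge_cases {u M T : List ℕ} {a b l₁ lk i j : ℕ} (hs : IsMin (u ++ [a, b]))
    (hl₁ : 0 < l₁) (hrot : (u ++ [a, b]).rotate i = l₁ :: (M ++ [lk]))
    (hT : (M ++ [l₁ + lk]).rotate j = T) :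
    (∃ P e e', e < e' ∧ P ++ [e] <+: u ∧ P ++ [e'] <+: T) ∨
      (T = M ++ [l₁ + lk] ∧ M = u ∧ a ≤ lk ∧ l₁ + lk = a + b) := by
  have hlen : u.length = M.length := by
    have := congrArg List.length hrot
    simp at this
    omega
  have hsum : u.sum + (a + b) = M.sum + (l₁ + lk) := by
    have := ((List.rotate_perm (u ++ [a, b]) i).sum_eq).symm
    rw [hrot] at this
    simp at this
    omega
  obtain ⟨M₁, M₂, rfl, rfl⟩ : ∃ M₁ M₂, M = M₁ ++ M₂ ∧ T = M₂ ++ [l₁ + lk] ++ M₁ := by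
    rw [← List.rotate_mod] at hT
    have hj : j % (M ++ [l₁ + lk]).length < M.length + 1 := by
      have := Nat.mod_lt j (y := (M ++ [l₁ + lk]).length) (by simp)
      simpa using this
    set j' := j % (M ++ [l₁ + lk]).length
    refine ⟨M.take j', M.drop j', by simp, ?_⟩
    rw [← hT, List.rotate_eq_drop_append_take (by simp; omega),
      List.drop_append_of_le_length (by omega), List.take_append_of_le_length (by omega)]
  have hX : u ++ [a, b] ≤ M₂ ++ (lk :: l₁ :: M₁) := by
    have h1 := hs (i + (l₁ :: M₁).length)
    rw [← List.rotate_rotate, hrot, List.append_assoc, ← List.cons_append,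
      List.rotate_append_length_eq] at h1
    simpa using h1
  rcases prefix_cases hX (by simp at hlen; omega) with ⟨P, e, e', h1, h2, h3⟩ | ⟨u', rfl, h2⟩
  · exact Or.inl ⟨P, e, e', h1, h2, h3.trans (by simp [List.append_assoc])⟩
  · cases u' with
    | nil =>
      have h3 : M₁ = [] := by
        simp at hlen
        exact hlen
      subst h3
      right
      refine ⟨by simp, by simp, ?_, by simp at hsum; omega⟩
      simp only [List.nil_append] at h2
      rw [cons_le_cons_iff] at h2
      omega
    | cons e u' =>
      left
      rw [List.cons_append, cons_le_cons_iff] at h2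
      refine ⟨M₂, e, l₁ + lk, by omega, by simp, by simp⟩

/-- The case `l₁ = b`, `lk = a` of `merge_cases`. It allows the parent of a cycle to be read off
without searching for a new least rotation. -/
theorem IsMin.merge {u : List ℕ} {a b : ℕ} (hs : IsMin (u ++ [a, b])) (hb : 0 < b) :
    IsMin (u ++ [a + b]) := by
  have hrot : (u ++ [a, b]).rotate (u ++ [a]).length = b :: (u ++ [a]) := by
    have := List.rotate_append_length_eq (u ++ [a]) [b]
    simpa using this
  intro j
  rcases merge_cases (j := j) hs hb hrot rfl with ⟨P, e, e', h1, h2, h3⟩ | ⟨h1, -⟩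
  · rw [add_comm a b]
    exact (lt_of_prefix h1 (h2.trans (List.prefix_append _ _)) h3).le
  · rw [add_comm a b, h1]

theorem cons_eq_snoc {x a : ℕ} {u : List ℕ} (h : x :: u = u ++ [a]) :
    u = List.replicate u.length x ∧ a = x := by
  induction u with
  | nil => simp at h; simp [h]
  | cons y u ih =>
    simp only [List.cons_append, List.cons.injEq] at h
    obtain ⟨rfl, h⟩ := h
    obtain ⟨h1, h2⟩ := ih h
    exact ⟨by rw [List.length_cons, List.replicate_succ, ← h1], h2⟩

/-- This is the source of the special shape. A rotation by one that keeps `u` forces all entries but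
the last to be equal, so the list is constant or special; the even length makes the exponent odd.
For a longer rotation, with `s = V ++ B`, the tail `B` is also a prefix of `u`. If `s = B ++ W`,
minimality against `B ++ V` and `W ++ B` gives `V = W`. -/
theorem rotate_eq_self_or_spec {u : List ℕ} {a b c d j : ℕ} (hs : IsMin (u ++ [a, b]))
    (hk : (u ++ [a, b]).length.bodd = false) (hj : j.bodd = true)
    (hrot : (u ++ [a, b]).rotate j = u ++ [c, d]) (hc : a ≤ c) :
    (u ++ [a, b]).rotate j = u ++ [a, b] ∨ Spec (u ++ [a, b]) := by
  set s := u ++ [a, b] with hsdef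
  have hklen : s.length = u.length + 2 := by simp [hsdef]
  obtain ⟨j', hj', hj'b, hjj⟩ : ∃ j', j' < s.length ∧ j'.bodd = true ∧ s.rotate j = s.rotate j' := by
    refine ⟨j % s.length, Nat.mod_lt _ (by omega), ?_, (List.rotate_mod _ _).symm⟩
    have h1 := congrArg Nat.bodd (Nat.mod_add_div j s.length)
    rw [Nat.bodd_add, Nat.bodd_mul, hk, hj] at h1
    simpa using h1
  rw [hjj] at hrot ⊢
  clear hjj hj j
  have hj0 : j' ≠ 0 := by rintro rfl; simp at hj'b
  by_cases h1 : j' = 1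
  · subst h1
    obtain ⟨x, s', hx⟩ := List.exists_cons_of_ne_nil (l := s) (by simp [hsdef])
    rw [hx] at hrot
    simp only [List.rotate_cons_succ, List.rotate_zero] at hrot
    have h2 : s' ++ [x] = (u ++ [c]) ++ [d] := by rw [hrot]; simp
    obtain ⟨h3, h4⟩ := List.append_inj' h2 rfl
    rw [hsdef, h3] at hx
    have h5 : (u ++ [a]) ++ [b] = (x :: u) ++ [c] := by simpa using hx
    obtain ⟨h6, h7⟩ := List.append_inj' h5 rfl
    obtain ⟨h8, rfl⟩ := cons_eq_snoc h6.symm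
    have h9 : b = c := by simpa using h7
    subst h9
    have h10 : s = List.replicate (u.length + 1) a ++ [b] := by
      rw [hsdef, List.replicate_succ', ← h8]
      simp
    rcases Nat.lt_or_eq_of_le hc with h | h
    · right
      refine ⟨a, b, u.length + 1, ?_, h, h10⟩
      rw [hklen] at hk
      rw [Nat.odd_iff, Nat.mod_two_of_bodd]
      have : (u.length + 1 + 1).bodd = false := hk
      rw [Nat.bodd_succ] at this
      cases h : (u.length + 1).bodd
      · rw [h] at this; simp at this
      · rfl
    · left
      subst h
      rw [← List.replicate_succ'] at h10
      rw [h10, List.rotate_replicate]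
  · left
    obtain ⟨V, B, hVB, hV⟩ : ∃ V B, s = V ++ B ∧ V.length = j' :=
      ⟨s.take j', s.drop j', by simp, by simp; omega⟩
    have hBl : B.length = s.length - j' := by
      have := congrArg List.length hVB
      simp at this
      omega
    have hr : s.rotate j' = B ++ V := by
      rw [hVB, ← hV, List.rotate_append_length_eq]
    have hBu : B <+: u := by
      rw [hr] at hrot
      exact List.prefix_of_prefix_length_le ⟨V, hrot⟩ (List.prefix_append _ _) (by omega)
    obtain ⟨u', hu'⟩ := hBu
    have hsW : s = B ++ (u' ++ [a, b]) := by rw [hsdef, ← hu', List.append_assoc]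
    set W := u' ++ [a, b]
    have hWV : W ≤ V := by
      have := hs j'
      rw [hr] at this
      conv_lhs at this => rw [hsW]
      rwa [append_le_append_left_iff] at this
    have hVW : V ≤ W := by
      by_contra h
      have h2 := hs B.length
      conv_rhs at h2 => rw [hsW, List.rotate_append_length_eq]
      rw [hVB] at h2
      have hl : W.length = V.length := by
        have h3 := congrArg List.length hsW
        have h4 := congrArg List.length hVB
        simp only [List.length_append] at h3 h4
        omega
      exact absurd (append_lt_append_of_lt (not_le.1 h) hl B B) (not_lt.2 h2)
    rw [hr, le_antisymm hVW hWV, ← hsW]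

/-! ### The position of a string in its cycle -/

/-- The number of applications of the PRR, at least one, that lead from `r` to `w`. -/
noncomputable def position (r w : List Bool) : ℕ := sInf {m | 1 ≤ m ∧ prr^[m] r = w}

theorem position_le {r w : List Bool} {m : ℕ} (hm : 1 ≤ m) (h : prr^[m] r = w) :
    position r w ≤ m := Nat.sInf_le ⟨hm, h⟩

theorem position_spec {n : ℕ} (hn : 2 ≤ n) {r w : List Bool} (hr : r.length = n)
    (h : InCycle r w) : 1 ≤ position r w ∧ prr^[position r w] r = w := by
  apply Nat.sInf_mem (s := {m | 1 ≤ m ∧ prr^[m] r = w})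
  obtain ⟨k, rfl⟩ := h
  obtain ⟨p, hp, h⟩ := exists_prr_iterate_self hn hr
  exact ⟨k + p, by omega, by rw [Function.iterate_add_apply, h]⟩

/-- As at least one step is counted, `r` itself has the last position of its cycle, and positions
grow along the PRR until `r` is reached. -/
theorem position_prr {n : ℕ} (hn : 2 ≤ n) {r w : List Bool} (hr : r.length = n)
    (h : InCycle r w) (hne : w ≠ r) : position r (prr w) = position r w + 1 := by
  obtain ⟨h1, h2⟩ := position_spec hn hr h
  have h3 : prr^[position r w + 1] r = prr w := by rw [Function.iterate_succ_apply', h2]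
  apply le_antisymm (position_le (by omega) h3)
  have hw := h.length_eq hn hr
  obtain ⟨h4, h5⟩ := position_spec hn hr (h.trans ⟨1, rfl⟩ : InCycle r (prr w))
  obtain ⟨m, hm⟩ : ∃ m, position r (prr w) = m + 1 := ⟨position r (prr w) - 1, by omega⟩
  rw [hm] at h5 ⊢
  rw [Function.iterate_succ_apply'] at h5
  have h6 := prr_injOn hn (length_prr_iterate hn hr m) hw h5
  have : m ≠ 0 := by
    rintro rfl
    exact hne h6.symm
  have := position_le (by omega) h6
  omega

/-! ### The parent of a cycle -/

/-- The rotation by the full length fixes `s`, so it must not be odd. -/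
theorem Canon.length_even {s : List ℕ} (hs : Canon true s) : s.length.bodd = false := by
  by_contra h
  exact hs.odd rfl s.length (by simpa using h) (List.rotate_length s)

theorem Canon.two_le_length {s : List ℕ} (hs : Canon true s) : 2 ≤ s.length := by
  have h1 := hs.length_even
  have h2 := List.length_pos_iff.2 hs.ne_nil
  by_contra h
  have : s.length = 1 := by omega
  rw [this] at h1
  simp at h1

theorem Canon.parent {c : Bool} {u : List ℕ} {a b : ℕ} (hs : Canon c (u ++ [a, b])) :
    Canon false (u ++ [a + b]) := by
  have hb := hs.pos b (by simp)
  refine ⟨by simp, ?_, hs.isMin.merge hb, by simp⟩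
  intro r hr
  simp at hr
  rcases hr with hr | rfl
  · exact hs.pos r (by simp [hr])
  · omega

theorem Canon.opp_false {u : List ℕ} {S : ℕ} : opp false (u ++ [S]) = full true (S :: u) :=
  opp_snoc (by simp)

/-- The first `S` strings after the opp-rep of a cycle with bit 0 form one lap; all begin with 0,
and position and length of the last run coincide. -/
theorem Canon.prr_iterate_opp_false {u : List ℕ} {S : ℕ} (ht : Canon false (u ++ [S])) {m : ℕ}
    (h1 : 1 ≤ m) (h2 : m ≤ S) : prr^[m] (opp false (u ++ [S])) = node false u (S - m) m := by
  rw [Canon.opp_false, prr_iterate_full _ _ (by omega) h2]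
  · rfl
  · intro r hr
    exact ht.pos r (by simp at hr ⊢; tauto)

theorem Canon.length_opp {c : Bool} {s : List ℕ} (hs : Canon c s) :
    (opp c s).length = s.sum + 1 := by
  have h := hs.two_le_length_full c
  rw [length_full] at h
  exact hs.opp_inCycle.length_eq h (length_full c s)

theorem Canon.two_le {c : Bool} {s : List ℕ} (hs : Canon c s) : 2 ≤ s.sum + 1 := by
  have h := hs.two_le_length_full c
  rwa [length_full] at h

theorem Canon.inCycle_opp {c : Bool} {s : List ℕ} {w : List Bool} (hs : Canon c s)
    (hw : InCycle (full c s) w) : InCycle (opp c s) w :=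
  (hs.opp_inCycle.symm hs.two_le (length_full c s)).trans hw

theorem Canon.position_spec {c : Bool} {s : List ℕ} {w : List Bool} (hs : Canon c s)
    (hw : InCycle (full c s) w) :
    1 ≤ position (opp c s) w ∧ prr^[position (opp c s) w] (opp c s) = w :=
  PreferOpposite.position_spec hs.two_le hs.length_opp (hs.inCycle_opp hw)

theorem Canon.position_eq {u : List ℕ} {p q : ℕ} (ht : Canon false (u ++ [p + q])) (hq : 0 < q) :
    position (opp false (u ++ [p + q])) (node false u p q) = q := by
  have h1 := ht.prr_iterate_opp_false hq (by omega)
  rw [Nat.add_sub_cancel] at h1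
  have hin : InCycle (full false (u ++ [p + q])) (node false u p q) :=
    (inCycle_full_iff _ ht.ne_nil ht.pos _).2 ⟨0, u, p, q, by simp, hq, by simp⟩
  obtain ⟨h2, h3⟩ := ht.position_spec hin
  have h4 := position_le hq h1
  rw [ht.prr_iterate_opp_false h2 (by omega)] at h3
  have hu : ∀ r ∈ u, 0 < r := fun r hr => ht.pos r (by simp [hr])
  exact (node_inj hu hu h2 hq h3).2.2.2

/-- The first `S` positions are taken by strings that begin with 0. -/
theorem Canon.lt_position {u M : List ℕ} {S p q : ℕ} (ht : Canon false (u ++ [S]))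
    (hM : ∀ r ∈ M, 0 < r) (hq : 0 < q)
    (hin : InCycle (full false (u ++ [S])) (node true M p q)) :
    S < position (opp false (u ++ [S])) (node true M p q) := by
  by_contra h
  obtain ⟨h2, h3⟩ := ht.position_spec hin
  rw [ht.prr_iterate_opp_false h2 (by omega)] at h3
  have hu : ∀ r ∈ u, 0 < r := fun r hr => ht.pos r (by simp [hr])
  have := (node_inj hu hM h2 hq h3).1
  simp at this

theorem Canon.conj_opp {c : Bool} {u : List ℕ} {a b : ℕ}
    (h : ¬ (c = true ∧ Spec (u ++ [a, b]))) : conj (opp c (u ++ [a, b])) = node c u b a := by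
  have h1 : u ++ [a, b] = (u ++ [a]) ++ [b] := by simp
  rw [h1] at h ⊢
  rw [opp_snoc h, conj_full, Bool.not_not]

theorem spec_append_pair {u : List ℕ} {a b : ℕ} (h : Spec (u ++ [a, b])) :
    a < b ∧ u = List.replicate u.length a := by
  obtain ⟨x, y, z, hz, hxy, h⟩ := h
  obtain ⟨z, rfl⟩ : ∃ m, z = m + 1 := ⟨z - 1, by have := hz.pos; omega⟩
  have h1 : u ++ [a] ++ [b] = List.replicate z x ++ [x] ++ [y] := by
    rw [← List.replicate_succ', ← h]
    simp
  obtain ⟨h2, h3⟩ := List.append_inj' h1 rfl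
  obtain ⟨h4, h5⟩ := List.append_inj' h2 rfl
  simp at h3 h5
  subst h3 h5 h4
  simp [hxy]

/-- All entries before `b` equal `a`, so one of them can be read as the first; complementing the
first bit merges it cyclically with the last entry `b`. -/
theorem Canon.conj_opp_of_spec {u : List ℕ} {a b : ℕ} (h : Spec (u ++ [a, b])) :
    conj (opp true (u ++ [a, b])) = node false u a b := by
  have h2 := (spec_append_pair h).2
  have h1 : u ++ [a, b] = a :: (u ++ [b]) := by
    have h3 : u ++ [a] = a :: u := by
      rw [h2, ← List.replicate_succ', ← List.replicate_succ]
    rw [← List.singleton_append, ← List.append_assoc, h3]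
    simp
  rw [opp_of_spec ⟨rfl, h⟩, h1, conj_full]
  rfl

theorem Canon.conj_opp_inCycle {c : Bool} {u : List ℕ} {a b : ℕ} (hs : Canon c (u ++ [a, b])) :
    InCycle (full false (u ++ [a + b])) (conj (opp c (u ++ [a, b]))) := by
  have ht := hs.parent
  rw [inCycle_full_iff _ ht.ne_nil ht.pos]
  by_cases h : c = true ∧ Spec (u ++ [a, b])
  · obtain ⟨rfl, h⟩ := h
    rw [Canon.conj_opp_of_spec h]
    exact ⟨0, u, a, b, by simp, hs.pos b (by simp), by simp⟩
  · rw [Canon.conj_opp h]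
    have ha := hs.pos a (by simp)
    cases c
    · exact ⟨0, u, b, a, by simp [add_comm], ha, by simp⟩
    -- The merged list has odd length, so the full rotation fixes it but complements the bit: the
    -- parent also contains the strings that begin with 1.
    · refine ⟨(u ++ [a + b]).length, u, b, a, by rw [List.rotate_length, add_comm], ha, ?_⟩
      have h1 := hs.length_even
      have h2 : (u ++ [a, b]).length = (u ++ [a + b]).length + 1 := by simp
      rw [h2, Nat.bodd_succ] at h1
      have h3 : (u ++ [a + b]).length.bodd = true := by simpa using h1
      rw [h3]
      rfl

/-- The position at which the cycle of `full c (u ++ [a, b])` is attached to its parent. -/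
noncomputable def attach (c : Bool) (u : List ℕ) (a b : ℕ) : ℕ :=
  position (opp false (u ++ [a + b])) (conj (opp c (u ++ [a, b])))

theorem Canon.attach_false {u : List ℕ} {a b : ℕ} (hs : Canon false (u ++ [a, b])) :
    attach false u a b = a := by
  rw [attach, Canon.conj_opp (by simp), add_comm]
  apply Canon.position_eq _ (hs.pos a (by simp))
  rw [add_comm]
  exact hs.parent

theorem Canon.attach_spec {u : List ℕ} {a b : ℕ} (hs : Canon true (u ++ [a, b]))
    (h : Spec (u ++ [a, b])) : attach true u a b = b := by
  rw [attach, Canon.conj_opp_of_spec h]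
  exact hs.parent.position_eq (hs.pos b (by simp))

/-- A special list is attached at position `b > a`; otherwise the attachment point begins with 1 and
lies beyond position `a + b`. -/
theorem Canon.lt_attach {u : List ℕ} {a b : ℕ} (hs : Canon true (u ++ [a, b])) :
    a < attach true u a b := by
  by_cases h : Spec (u ++ [a, b])
  · rw [hs.attach_spec h]
    exact (spec_append_pair h).1
  · have h1 := hs.conj_opp_inCycle
    have h2 : ¬ (true = true ∧ Spec (u ++ [a, b])) := by simp [h]
    rw [attach]
    rw [Canon.conj_opp h2] at h1 ⊢
    have := hs.parent.lt_position (fun r hr => hs.pos r (by simp [hr])) (hs.pos a (by simp)) h1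
    omega

theorem Canon.le_attach {c : Bool} {u : List ℕ} {a b : ℕ} (hs : Canon c (u ++ [a, b])) :
    a ≤ attach c u a b := by
  cases c
  · rw [hs.attach_false]
  · exact hs.lt_attach.le

end PreferOpposite

namespace PreferOpposite

/-! ### The key that the successor rule increases -/

open Classical in
/-- The pair `(c, s)` such that `full c s` is the RL2-rep of the cycle of `w`. -/
noncomputable def canonOf (w : List Bool) : Bool × List ℕ :=
  if h : ∃ r : Bool × List ℕ, Canon r.1 r.2 ∧ InCycle (full r.1 r.2) w then h.choose
  else (false, [])

theorem Canon.canonOf_eq {c : Bool} {s : List ℕ} {w : List Bool} (hs : Canon c s)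
    (hw : InCycle (full c s) w) : canonOf w = (c, s) := by
  have h : ∃ r : Bool × List ℕ, Canon r.1 r.2 ∧ InCycle (full r.1 r.2) w := ⟨(c, s), hs, hw⟩
  rw [canonOf, dif_pos h]
  obtain ⟨h1, h2⟩ := h.choose_spec
  have h3 := hw.symm hs.two_le (length_full c s)
  have h4 := hw.length_eq hs.two_le (length_full c s)
  have h5 := h2.length_eq h1.two_le (length_full _ _)
  have h6 := h1.unique hs (h2.trans h3)
  exact Prod.ext h6.1 h6.2

/-- The key of the strings in the cycle of `full c s`, without its last entry. -/
noncomputable def keyPrefix (c : Bool) (s : List ℕ) : List ℕ :=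
  if s.length ≤ 1 then []
  else s.dropLast.dropLast ++ [attach c s.dropLast.dropLast (s.dropLast.getLastD 0) (s.getLastD 0)]

/-- The key of a string. -/
noncomputable def key (w : List Bool) : List ℕ :=
  if w = List.replicate w.length false then []
  else if w = List.replicate w.length true then [w.length - 1, 1]
  else keyPrefix (canonOf w).1 (canonOf w).2 ++
    [position (opp (canonOf w).1 (canonOf w).2) w]

theorem keyPrefix_singleton (c : Bool) (S : ℕ) : keyPrefix c [S] = [] := by simp [keyPrefix]

theorem keyPrefix_append (c : Bool) (u : List ℕ) (a b : ℕ) :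
    keyPrefix c (u ++ [a, b]) = u ++ [attach c u a b] := by
  have h1 : u ++ [a, b] = (u ++ [a]) ++ [b] := by simp
  rw [h1, keyPrefix, if_neg (by simp), List.dropLast_concat, List.dropLast_concat,
    List.getLastD_concat, List.getLastD_concat]

theorem Canon.keyPrefix_false {u : List ℕ} {S : ℕ} (ht : Canon false (u ++ [S])) :
    keyPrefix false (u ++ [S]) = u := by
  rcases List.eq_nil_or_concat u with rfl | ⟨u', a, rfl⟩
  · exact keyPrefix_singleton _ _
  · have h1 : u' ++ [a] ++ [S] = u' ++ [a, S] := by simp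
    rw [List.concat_eq_append] at ht ⊢
    rw [h1] at ht ⊢
    rw [keyPrefix_append, ht.attach_false]

theorem Canon.not_const {c : Bool} {s : List ℕ} {w : List Bool} (hs : Canon c s)
    (hw : InCycle (full c s) w) (b : Bool) : w ≠ List.replicate w.length b := by
  intro h
  have h3 := hw.symm hs.two_le (length_full c s)
  have h4 := hw.length_eq hs.two_le (length_full c s)
  have h5 := hs.two_le
  rw [h, h4, inCycle_replicate_iff h5] at h3
  exact not_const_of_full hs.ne_nil hs.pos _ _ h3

theorem Canon.key_eq {c : Bool} {s : List ℕ} {w : List Bool} (hs : Canon c s)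
    (hw : InCycle (full c s) w) : key w = keyPrefix c s ++ [position (opp c s) w] := by
  rw [key, if_neg (hs.not_const hw _), if_neg (hs.not_const hw _), hs.canonOf_eq hw]

theorem key_replicate_false (n : ℕ) : key (List.replicate n false) = [] := by simp [key]

theorem key_replicate_true {n : ℕ} (hn : 1 ≤ n) : key (List.replicate n true) = [n - 1, 1] := by
  rw [key, if_neg, if_pos]
  · simp
  · simp
  · simp; omega

/-- This explains `keyPrefix`: the keys in a cycle extend the key of its attachment point by one
entry, so lexicographic order is the preorder of the tree. -/
theorem Canon.key_conj_opp {c : Bool} {u : List ℕ} {a b : ℕ} (hs : Canon c (u ++ [a, b])) :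
    key (conj (opp c (u ++ [a, b]))) = keyPrefix c (u ++ [a, b]) := by
  rw [hs.parent.key_eq hs.conj_opp_inCycle, hs.parent.keyPrefix_false, keyPrefix_append]
  rfl

theorem Canon.key_conj_opp_lt {c : Bool} {u : List ℕ} {a b : ℕ} {w : List Bool}
    (hs : Canon c (u ++ [a, b])) (hw : InCycle (full c (u ++ [a, b])) w) :
    key (conj (opp c (u ++ [a, b]))) < key w := by
  rw [hs.key_conj_opp, hs.key_eq hw]
  conv_lhs => rw [← List.append_nil (keyPrefix c (u ++ [a, b]))]
  rw [append_lt_append_left_iff]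
  exact List.nil_lt_cons _ _

/-- An attachment point begins with a run of length at least 2, an opp-rep with a run of length 1.
Hence an attachment point never has the last position of its cycle. -/
theorem Canon.conj_opp_ne {c c' : Bool} {u : List ℕ} {a b : ℕ} {t : List ℕ}
    (hs : Canon c (u ++ [a, b])) (ht : Canon c' t) : conj (opp c (u ++ [a, b])) ≠ opp c' t := by
  have h1 : ∃ h p q, 0 < p ∧ 0 < q ∧ conj (opp c (u ++ [a, b])) = node h u p q := by
    have ha := hs.pos a (by simp)
    have hb := hs.pos b (by simp)
    by_cases h : c = true ∧ Spec (u ++ [a, b])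
    · obtain ⟨rfl, h⟩ := h
      exact ⟨_, _, _, ha, hb, Canon.conj_opp_of_spec h⟩
    · exact ⟨_, _, _, hb, ha, Canon.conj_opp h⟩
  obtain ⟨h, p, q, hp, hq, h1⟩ := h1
  obtain ⟨h', L, hL, h2⟩ : ∃ h' L, (∀ r ∈ L, 0 < r) ∧ opp c' t = full h' L := by
    by_cases h : c' = true ∧ Spec t
    · exact ⟨_, _, ht.pos, opp_of_spec h⟩
    · obtain ⟨v, d, rfl⟩ := ht.exists_snoc
      exact ⟨_, _, fun r hr => ht.pos r (by simp at hr ⊢; tauto), opp_snoc h⟩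
  rw [h1, h2]
  intro he
  have h3 := congrArg rle he
  rw [rle_full _ hL, rle_node _ (fun r hr => hs.pos r (by simp [hr])) _ hq] at h3
  simp at h3
  omega

/-- Of two conjugate strings that are not opp-reps, the one that begins with a run of length 1 has
the smaller key. -/
theorem key_full_lt_key_conj {h : Bool} {l₁ lk : ℕ} {M : List ℕ}
    (hpos : ∀ r ∈ l₁ :: (M ++ [lk]), 0 < r)
    (hopp : ∀ c s, Canon c s → full h (l₁ :: (M ++ [lk])) ≠ opp c s) :
    key (full h (l₁ :: (M ++ [lk]))) < key (conj (full h (l₁ :: (M ++ [lk])))) := by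
  have hl₁ : 0 < l₁ := hpos l₁ (by simp)
  have hlk : 0 < lk := hpos lk (by simp)
  have hM : ∀ r ∈ M, 0 < r := fun r hr => hpos r (by simp [hr])
  set x := full h (l₁ :: (M ++ [lk])) with hx
  have hxl : x.length = (l₁ :: (M ++ [lk])).sum + 1 := length_full _ _
  have hx2 : 2 ≤ (l₁ :: (M ++ [lk])).sum + 1 := by simp; omega
  obtain ⟨c, s, hs, hin⟩ : ∃ c s, Canon c s ∧ InCycle (full c s) x :=
    exists_canon hx2 hxl (not_const_of_full (by simp) hpos _ _)
      (not_const_of_full (by simp) hpos _ _)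
  obtain ⟨i, hrot, hh⟩ : ∃ i, s.rotate i = l₁ :: (M ++ [lk]) ∧ h = xor c i.bodd := by
    obtain ⟨i, M', p, q, h1, hq, h2⟩ := (inCycle_full_iff c hs.ne_nil hs.pos x).1 hin
    have hx' : x = node h (l₁ :: M) 0 lk := rfl
    have hM' : ∀ r ∈ M', 0 < r := fun r hr =>
      hs.pos r (List.mem_rotate.1 (show r ∈ s.rotate i by rw [h1]; simp [hr]))
    rw [hx'] at h2
    obtain ⟨h3, h4, h5, h6⟩ := node_inj (fun r hr => hpos r (by simp at hr ⊢; tauto)) hM' hlk hq h2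
    exact ⟨i, by rw [h1, ← h4, ← h5, ← h6]; simp, h3⟩
  have hslen : s.length = M.length + 2 := by
    have := congrArg List.length hrot
    simpa using this
  obtain ⟨u, a, b, rfl⟩ : ∃ u a b, s = u ++ [a, b] := by
    obtain ⟨v, b, rfl⟩ := hs.exists_snoc
    have hv : v ≠ [] := by rintro rfl; simp at hslen
    exact ⟨v.dropLast, v.getLast hv, b, by
      conv_lhs => rw [← List.dropLast_append_getLast hv]
      simp⟩
  have hx' : conj x = node (!h) M l₁ lk := conj_full h l₁ M lk
  have hx'l : (conj x).length = (M ++ [l₁ + lk]).sum + 1 := by rw [hx', length_node]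
  have hLpos : ∀ r ∈ M ++ [l₁ + lk], 0 < r := by
    intro r hr
    simp at hr
    rcases hr with hr | rfl
    · exact hM r hr
    · omega
  have hx'in : InCycle (full (!h) (M ++ [l₁ + lk])) (conj x) :=
    (inCycle_full_iff _ (by simp) hLpos _).2 ⟨0, M, l₁, lk, by simp, hlk, by simp [hx']⟩
  have h2' : 2 ≤ (M ++ [l₁ + lk]).sum + 1 := by simp; omega
  have hc0 : ∀ bb, conj x ≠ List.replicate (conj x).length bb := by
    intro bb he
    have h3 := hx'in.symm h2' (length_full _ _)
    rw [he, hx'l, inCycle_replicate_iff h2'] at h3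
    exact not_const_of_full (by simp) hLpos _ _ h3
  obtain ⟨c', t, ht, hin'⟩ := exists_canon h2' hx'l (hc0 _) (hc0 _)
  obtain ⟨j, hj⟩ : ∃ j, (M ++ [l₁ + lk]).rotate j = t := by
    have h3 := hin'.trans (hx'in.symm h2' (length_full _ _))
    obtain ⟨j, M', p, q, h4, hq, h5⟩ := (inCycle_full_iff c' ht.ne_nil ht.pos _).1 h3
    have h6 := congrArg rle h5
    rw [rle_full _ hLpos, rle_node _ (fun r hr => ht.pos r
      (List.mem_rotate.1 (show r ∈ t.rotate j by rw [h4]; simp [hr]))) _ hq] at h6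
    simp only [List.cons.injEq] at h6
    have hp : p = 0 := by omega
    rw [hp, zero_add, ← h6.2] at h4
    rw [← h4]
    exact exists_rotate_rotate t j
  rw [hs.key_eq hin, ht.key_eq hin', keyPrefix_append]
  -- In the first case the keys differ already at an entry of `u`; if the larger entry is `a'`, the
  -- key has the attachment position in its place, which is at least `a'`. In the second case only
  -- the entries after `M = u` matter.
  rcases merge_cases hs.isMin hl₁ hrot hj with ⟨P, e, e', he, hu, hP⟩ | ⟨rfl, rfl, hle, hsum⟩
  · have htlen : t.length = u.length + 1 := by
      rw [← hj]
      simp at hslen ⊢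
      omega
    have hPu := hu.length_le
    simp only [List.length_append, List.length_singleton] at hPu
    obtain ⟨u', a', b', rfl⟩ : ∃ u' a' b', t = u' ++ [a', b'] := by
      obtain ⟨v, b, rfl⟩ := ht.exists_snoc
      have hv : v ≠ [] := by
        rintro rfl
        rw [List.nil_append, List.length_singleton] at htlen
        omega
      exact ⟨v.dropLast, v.getLast hv, b, by
        conv_lhs => rw [← List.dropLast_append_getLast hv]
        simp⟩
    have hA : P ++ [e] <+: u ++ [attach c u a b] ++ [position (opp c (u ++ [a, b])) x] := by
      rw [List.append_assoc]
      exact hu.trans (List.prefix_append _ _)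
    rw [keyPrefix_append]
    simp at htlen
    have h3 : P ++ [e'] <+: u' ++ [a'] := by
      refine List.prefix_of_prefix_length_le hP (l₂ := u' ++ [a']) ⟨[b'], by simp⟩ ?_
      simp
      omega
    rcases List.prefix_concat_iff.1 h3 with h4 | h4
    · obtain ⟨h5, h6⟩ := List.append_inj' h4 rfl
      simp at h6
      subst h5 h6
      exact lt_of_prefix (lt_of_lt_of_le he ht.le_attach) hA (List.prefix_append _ _)
    · refine lt_of_prefix he hA (h4.trans ?_)
      rw [List.append_assoc]
      exact List.prefix_append _ _
  · have hl₁b : l₁ = a + b - lk := by omega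
    have hconj : lk = a → h = !c → x = full (!c) (b :: (M ++ [a])) := by
      intro h3 h4
      have : l₁ = b := by omega
      rw [hx, h3, h4, this]
    have hoppsnoc : ¬ (c = true ∧ Spec (M ++ [a, b])) →
        opp c (M ++ [a, b]) = full (!c) (b :: (M ++ [a])) := by
      intro h3
      have h4 : M ++ [a, b] = (M ++ [a]) ++ [b] := by simp
      rw [h4] at h3 ⊢
      exact opp_snoc h3
    have hrot2 : (M ++ [a, b]).rotate (i + 1) = M ++ [lk, l₁] := by
      rw [← List.rotate_rotate, hrot]
      simp
    cases c with
    | false =>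
      rw [hs.attach_false]
      cases c' with
      | false =>
        rw [ht.keyPrefix_false, List.append_assoc, append_lt_append_left_iff]
        rw [List.singleton_append, cons_lt_cons_iff]
        left
        obtain ⟨h3, h4⟩ := ht.position_spec hin'
        -- A position of at most `a` would put the conjugate into the first lap, with last run `lk ≤
        -- a`; since also `a ≤ lk`, the string would be the opp-rep.
        by_contra hcon
        rw [ht.prr_iterate_opp_false h3 (by omega), hx'] at h4
        obtain ⟨h5, -, h6, h7⟩ := node_inj hM hM h3 hlk h4
        refine hopp _ _ hs ?_
        rw [hoppsnoc (by simp)]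
        refine hconj (by omega) ?_
        cases h
        · simp at h5
        · rfl
      | true =>
        have hM0 : M ≠ [] := by
          rintro rfl
          have := ht.two_le_length
          simp at this
        obtain ⟨M', d, rfl⟩ : ∃ M' d, M = M' ++ [d] :=
          ⟨_, _, (List.dropLast_append_getLast hM0).symm⟩
        have h3 : M' ++ [d] ++ [l₁ + lk] = M' ++ [d, l₁ + lk] := by simp
        rw [h3] at ht ⊢
        rw [keyPrefix_append]
        -- The conjugate lies in the cycle with the list of the parent but bit 1; its key has an
        -- attachment position larger than `d` where the other key has `d`.
        refine lt_of_prefix ht.lt_attach (P := M') ?_ ?_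
        · simp
        · simp
    | true =>
      have hc' : c' = false := by
        by_contra hcon
        have hcon : c' = true := by simpa using hcon
        subst hcon
        have h3 := hs.length_even
        have h4 := ht.length_even
        have h5 : (M ++ [a, b]).length = (M ++ [l₁ + lk]).length + 1 := by simp
        rw [h5, Nat.bodd_succ, h4] at h3
        simp at h3
      subst hc'
      rw [ht.keyPrefix_false, List.append_assoc, append_lt_append_left_iff]
      rw [List.singleton_append, cons_lt_cons_iff]
      left
      have ha := hs.pos a (by simp)
      have hin'' := hin'
      rw [hx'] at hin''
      by_cases hspec : Spec (M ++ [a, b])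
      · rw [hs.attach_spec hspec]
        cases h with
        | false =>
          rw [hx']
          have := ht.lt_position hM hlk hin''
          simp only [Bool.not_false] at this ⊢
          omega
        | true =>
          -- The odd rotation by `i + 1` ends in `a, b` or in `b, a`. The former would fix the list;
          -- in the latter case the string is the special opp-rep.
          exfalso
          have hi : (i + 1).bodd = true := by
            rw [Nat.bodd_succ]
            cases h3 : i.bodd
            · rfl
            · rw [h3] at hh; simp at hh
          have hperm : ([lk, l₁] : List ℕ).Perm [a, b] := by
            have h3 := List.rotate_perm (M ++ [a, b]) (i + 1)
            rw [hrot2] at h3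
            exact (List.perm_append_left_iff M).1 h3
          have h3 : lk = a ∨ lk = b := by
            have : lk ∈ [a, b] := hperm.subset (by simp)
            simpa using this
          rcases h3 with h3 | h3
          · refine hs.odd rfl _ hi ?_
            rw [hrot2, h3, show l₁ = b by omega]
          · refine hopp _ _ hs ?_
            rw [opp_of_spec ⟨rfl, hspec⟩, hx, h3, show l₁ = a by omega]
            have h4 := (spec_append_pair hspec).2
            congr 1
            have h5 : M ++ [a] = a :: M := by
              rw [h4, ← List.replicate_succ', ← List.replicate_succ]
            rw [← List.cons_append, ← h5]
            simp
      · have hns : ¬ (true = true ∧ Spec (M ++ [a, b])) := by simp [hspec]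
        -- Otherwise the rotation by `i + 1` is odd and keeps `M`, so it fixes the list, which the
        -- bit 1 forbids, or the list is special, which is why special cycles need another opp-rep.
        have hi : i.bodd = true := by
          by_contra hi
          have hi' : (i + 1).bodd = true := by rw [Nat.bodd_succ]; simpa using hi
          rcases rotate_eq_self_or_spec hs.isMin hs.length_even hi' hrot2 hle with h3 | h3
          · exact hs.odd rfl _ hi' h3
          · exact hspec h3
        have hh' : h = false := by rw [hh, hi]; rfl
        have hlt : a < lk := by
          rcases Nat.lt_or_eq_of_le hle with h3 | h3
          · exact h3
          · exact absurd (hconj h3.symm hh') (by rw [← hoppsnoc hns]; exact hopp _ _ hs)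
        have hpos' := ht.lt_position (p := l₁) (q := lk) hM hlk (by simpa [hh'] using hin'')
        have h3 : conj x = node true M l₁ lk := by rw [hx', hh']; rfl
        rw [← h3] at hpos'
        obtain ⟨h4, h5⟩ := ht.position_spec hin'
        set m := position (opp false (M ++ [l₁ + lk])) (conj x)
        rw [attach, Canon.conj_opp hns, ← hsum]
        -- The conjugate comes `lk - a` steps after the attachment point in the same lap. Its
        -- position exceeds `l₁ + lk`, so tracing it back that far does not pass the start.
        have h6 : prr^[lk - a] (node true M b a) = conj x := by
          rw [prr_iterate_node _ _ _ ha _ (by omega), h3]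
          congr 1 <;> omega
        have h7 : prr^[m - (lk - a)] (opp false (M ++ [l₁ + lk])) = node true M b a := by
          have hl := ht.length_opp
          have hl2 : (node true M b a).length = (M ++ [l₁ + lk]).sum + 1 := by
            rw [length_node, hsum, add_comm a b]
          apply prr_iterate_injOn ht.two_le (length_prr_iterate ht.two_le hl _) hl2
            (i := lk - a)
          rw [← Function.iterate_add_apply, h6, ← h5]
          congr 1
          omega
        have := position_le (by omega) h7
        omega

end PreferOpposite

namespace PreferOpposite

/-! ### The successor rule generates the Prefer-opposite sequence -/

theorem conj_conj (w : List Bool) : conj (conj w) = w := by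
  cases w with
  | nil => rfl
  | cons a w => simp [conj]

theorem length_conj (w : List Bool) : (conj w).length = w.length := by
  cases w with
  | nil => rfl
  | cons a w => rfl

theorem shift_conj (w : List Bool) (b : Bool) : shift (conj w) b = shift w b := by
  cases w with
  | nil => rfl
  | cons a w => rfl

theorem succO_conj {w : List Bool} (hw : 2 ≤ w.length) : succO (conj w) = !succO w := by
  rw [succO, succO, conj_conj, feedback_conj hw]
  by_cases h : w ∈ oppReps ∨ conj w ∈ oppReps
  · rw [if_pos h, if_pos h.symm]
  · rw [if_neg h, if_neg (fun h' => h h'.symm)]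

theorem step_succO_of_mem {w : List Bool} (hw : 2 ≤ w.length)
    (h : w ∈ oppReps ∨ conj w ∈ oppReps) : step succO w = prr (conj w) := by
  rw [step, succO, if_pos h, prr, shift_conj, feedback_conj hw]

theorem step_succO_of_notMem {w : List Bool}
    (h : ¬ (w ∈ oppReps ∨ conj w ∈ oppReps)) : step succO w = prr w := by
  rw [step, succO, if_neg h, prr]

theorem feedback_replicate {n : ℕ} (hn : 2 ≤ n) (b : Bool) :
    feedback (List.replicate n b) = b := by
  obtain ⟨m, rfl⟩ : ∃ m, n = m + 2 := ⟨n - 2, by omega⟩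
  have h1 : (List.replicate (m + 2) b).getLastD false = b := by
    rw [List.replicate_succ', List.getLastD_concat]
  rw [feedback, h1]
  simp [List.replicate_succ]

theorem Canon.eq_false_of_singleton {c : Bool} {S : ℕ} (hs : Canon c [S]) : c = false := by
  by_contra h
  exact hs.odd (by simpa using h) 1 rfl (by simp)

theorem Canon.opp_singleton {c : Bool} {S : ℕ} (hs : Canon c [S]) :
    opp c [S] = true :: List.replicate S false := by
  rw [hs.eq_false_of_singleton]
  have := Canon.opp_false (u := []) (S := S)
  rw [List.nil_append] at this
  rw [this]
  simp [full, ofRuns_cons]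

theorem canon_singleton {S : ℕ} (hS : 0 < S) : Canon false [S] :=
  ⟨by simp, by simpa using hS, fun i => by simp, by simp⟩

theorem Canon.exists_singleton_or {c : Bool} {s : List ℕ} (hs : Canon c s) :
    (∃ S, s = [S]) ∨ ∃ u a b, s = u ++ [a, b] := by
  obtain ⟨v, b, rfl⟩ := hs.exists_snoc
  rcases List.eq_nil_or_concat v with rfl | ⟨u, a, rfl⟩
  · exact Or.inl ⟨b, rfl⟩
  · exact Or.inr ⟨u, a, b, by simp⟩

theorem mem_oppReps_cases {w : List Bool} (hw : 2 ≤ w.length) (h : w ∈ oppReps) :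
    w = List.replicate w.length true ∨ w = true :: List.replicate (w.length - 1) false ∨
      ∃ c u a b, Canon c (u ++ [a, b]) ∧ w = opp c (u ++ [a, b]) := by
  by_cases h1 : w = List.replicate w.length true
  · exact Or.inl h1
  · right
    obtain ⟨c, s, hs, rfl⟩ := (isOppRep_iff hw rfl h.2 h1).1 h.1
    rcases hs.exists_singleton_or with ⟨S, rfl⟩ | ⟨u, a, b, rfl⟩
    · left
      rw [hs.opp_singleton]
      simp
    · exact Or.inr ⟨c, u, a, b, hs, rfl⟩

theorem Canon.opp_mem {c : Bool} {s : List ℕ} (hs : Canon c s) : opp c s ∈ oppReps := by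
  have h2 := hs.two_le
  rw [← hs.length_opp] at h2
  have h3 := hs.not_const hs.opp_inCycle
  exact ⟨(isOppRep_iff h2 rfl (h3 _) (h3 _)).2 ⟨c, s, hs, rfl⟩, h3 _⟩

theorem replicate_true_mem {n : ℕ} (hn : 2 ≤ n) : List.replicate n true ∈ oppReps := by
  refine ⟨isOppRep_replicate hn true, ?_⟩
  simp
  omega

theorem cons_replicate_mem {n : ℕ} (hn : 2 ≤ n) :
    true :: List.replicate (n - 1) false ∈ oppReps := by
  rw [← (canon_singleton (S := n - 1) (by omega)).opp_singleton]
  exact (canon_singleton (S := n - 1) (by omega)).opp_mem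

theorem Canon.key_prr {c : Bool} {s : List ℕ} {w : List Bool} (hs : Canon c s)
    (hw : InCycle (full c s) w) (hne : w ≠ opp c s) : key w < key (prr w) := by
  rw [hs.key_eq hw, hs.key_eq hw.prr,
    position_prr hs.two_le hs.length_opp (hs.inCycle_opp hw) hne, append_lt_append_left_iff,
    cons_lt_cons_iff]
  exact Or.inl (Nat.lt_succ_self _)

/-- On the return to the parent, the attachment position in the key grows by one, which beats every
extension of the old key. -/
theorem Canon.key_opp_lt {c : Bool} {u : List ℕ} {a b : ℕ} (hs : Canon c (u ++ [a, b])) :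
    key (opp c (u ++ [a, b])) < key (prr (conj (opp c (u ++ [a, b])))) := by
  have hin := hs.conj_opp_inCycle
  have ht := hs.parent
  rw [hs.key_eq hs.opp_inCycle, ht.key_eq hin.prr,
    position_prr ht.two_le ht.length_opp (ht.inCycle_opp hin) (hs.conj_opp_ne ht),
    keyPrefix_append, ht.keyPrefix_false]
  exact lt_of_prefix (Nat.lt_succ_self _) (List.prefix_append _ _) List.prefix_rfl

theorem conj_cons_replicate_true {n : ℕ} (hn : 2 ≤ n) :
    conj (List.replicate n true) = full false [n - 1] := by
  obtain ⟨m, rfl⟩ : ∃ m, n = m + 1 := ⟨n - 1, by omega⟩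
  simp [List.replicate_succ, conj, full, ofRuns_cons]

/-- The cycle `{1ⁿ}` is attached to that of `[n - 1]` at `01ⁿ⁻¹`, which has position `n - 1`; hence
the key `[n - 1, 1]` of `1ⁿ`. -/
theorem key_conj_replicate_true {n : ℕ} (hn : 2 ≤ n) :
    key (conj (List.replicate n true)) = [n - 1] := by
  have hs := canon_singleton (S := n - 1) (by omega)
  rw [conj_cons_replicate_true hn, hs.key_eq (InCycle.refl _), keyPrefix_singleton]
  have := Canon.position_eq (u := []) (p := 0) (q := n - 1) (by simpa using hs) (by omega)
  rw [node_zero] at this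
  simpa using this

theorem key_prr_conj_replicate_true {n : ℕ} (hn : 2 ≤ n) :
    key (prr (conj (List.replicate n true))) = [n] := by
  have hs := canon_singleton (S := n - 1) (by omega)
  have h1 := key_conj_replicate_true hn
  rw [conj_cons_replicate_true hn] at h1 ⊢
  rw [hs.key_eq (InCycle.refl _), keyPrefix_singleton] at h1
  rw [hs.key_eq (InCycle.refl _).prr, position_prr hs.two_le hs.length_opp
    (hs.inCycle_opp (InCycle.refl _)), keyPrefix_singleton]
  · simp at h1 ⊢
    omega
  · rw [hs.opp_singleton]
    simp [full, ofRuns_one]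

/-- At an opp-rep the walk returns to the parent just behind the attachment point, at the conjugate
of an opp-rep it enters a child and extends the key, and elsewhere it advances by one position. The
excluded string is the one from which it returns to the root `0ⁿ`. -/
theorem key_lt_key_step {w : List Bool} (hw : 2 ≤ w.length)
    (hne : w ≠ true :: List.replicate (w.length - 1) false) : key w < key (step succO w) := by
  by_cases h : w ∈ oppReps ∨ conj w ∈ oppReps
  · rw [step_succO_of_mem hw h]
    rcases h with h | h
    · rcases mem_oppReps_cases hw h with h1 | h1 | ⟨c, u, a, b, hs, h1⟩
      · rw [h1, key_prr_conj_replicate_true hw, key_replicate_true (by omega), cons_lt_cons_iff]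
        omega
      · exact absurd h1 hne
      · rw [h1]
        exact hs.key_opp_lt
    · have hw' : 2 ≤ (conj w).length := by rwa [length_conj]
      have hcc := conj_conj w
      rcases mem_oppReps_cases hw' h with h1 | h1 | ⟨c, u, a, b, hs, h1⟩
      · rw [h1, prr_replicate hw', key_replicate_true (by omega), ← hcc, h1,
          key_conj_replicate_true hw', cons_lt_cons_iff]
        right
        simp [length_conj]
      · have hs := canon_singleton (S := (conj w).length - 1) (by omega)
        rw [h1, ← hs.opp_singleton, hs.key_eq hs.opp_inCycle.prr]
        have h2 : w = List.replicate w.length false := by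
          rw [← hcc, h1, length_conj]
          simp only [conj, Bool.not_true, List.length_cons, List.length_replicate]
          rw [← List.replicate_succ]
        rw [h2, key_replicate_false]
        simp [keyPrefix_singleton]
      · rw [h1]
        conv_lhs => rw [← hcc, h1]
        exact hs.key_conj_opp_lt hs.opp_inCycle.prr
  · rw [step_succO_of_notMem h]
    push Not at h
    have h0 : w ≠ List.replicate w.length false := by
      intro h1
      apply h.2
      have h2 := cons_replicate_mem hw
      rw [h1]
      obtain ⟨m, hm⟩ : ∃ m, w.length = m + 1 := ⟨w.length - 1, by omega⟩
      rw [hm] at h2 ⊢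
      simpa [List.replicate_succ, conj] using h2
    have h1 : w ≠ List.replicate w.length true := by
      intro h1
      apply h.1
      rw [h1]
      exact replicate_true_mem hw
    obtain ⟨c, s, hs, hin⟩ := exists_canon hw rfl h0 h1
    refine hs.key_prr hin ?_
    rintro rfl
    exact h.1 hs.opp_mem

/-- If `a` equals the first bit of `v`, the feedback is the last bit, so neither conjugate is an
opp-rep and `key_full_lt_key_conj` applies. If it differs, the feedback has been complemented; then
`a :: v` is itself the opp-rep, and its conjugate is an attachment point of smaller key. -/
theorem key_lt_key_of_succO {a : Bool} {v : List Bool} (hv : v ≠ [])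
    (hv1 : v ≠ List.replicate v.length true) (hg : succO (a :: v) = v.getLastD false) :
    key ((!a) :: v) < key (a :: v) := by
  have hlen : 2 ≤ (a :: v).length := by
    have := List.length_pos_iff.2 hv
    simp
    omega
  have hlen' : 2 ≤ (v.length + 1) := by simpa using hlen
  by_cases hv0 : v = List.replicate v.length false
  · have hmem := cons_replicate_mem hlen'
    rw [Nat.add_sub_cancel, ← hv0] at hmem
    have hlast : v.getLastD false = false := by
      rw [hv0]
      obtain ⟨m, hm⟩ : ∃ m, v.length = m + 1 := ⟨v.length - 1, by omega⟩
      rw [hm, List.replicate_succ', List.getLastD_concat]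
    have hf : feedback (false :: v) = false := by
      have h1 := feedback_replicate hlen' false
      rw [List.replicate_succ, ← hv0] at h1
      exact h1
    cases a with
    | false =>
      rw [succO, if_pos (show false :: v ∈ oppReps ∨ conj (false :: v) ∈ oppReps from Or.inr hmem), hf, hlast] at hg
      simp at hg
    | true =>
      have h1 : (!true) :: v = List.replicate (v.length + 1) false := by
        rw [List.replicate_succ, ← hv0]
        rfl
      have hs := canon_singleton (S := v.length) (by omega)
      have h2 : true :: v = opp false [v.length] := by rw [hs.opp_singleton, ← hv0]
      rw [h1, key_replicate_false, h2, hs.key_eq hs.opp_inCycle]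
      simp [keyPrefix_singleton]
  · obtain ⟨v0, v', rfl⟩ := List.exists_cons_of_ne_nil hv
    obtain ⟨L, hLne, hLpos, hL⟩ := exists_ofRuns v0 v'
    obtain ⟨l₁, L', rfl⟩ := List.exists_cons_of_ne_nil hLne
    have hL' : L' ≠ [] := by
      rintro rfl
      have hl := congrArg List.length hL
      rw [length_ofRuns] at hl
      rw [hl, hL] at hv0 hv1
      cases v0 <;> simp [ofRuns_cons] at hv0 hv1
    obtain ⟨M, lk, rfl⟩ : ∃ M lk, L' = M ++ [lk] :=
      ⟨_, _, (List.dropLast_append_getLast hL').symm⟩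
    have hx : (!v0) :: v0 :: v' = full (!v0) (l₁ :: (M ++ [lk])) := by
      rw [full, ofRuns_one, Bool.not_not, ← hL]
    have hx' : v0 :: v0 :: v' = conj (full (!v0) (l₁ :: (M ++ [lk]))) := by
      rw [← hx, conj, Bool.not_not]
    have hl₁ := hLpos l₁ (by simp)
    have hlk := hLpos lk (by simp)
    have hM : ∀ r ∈ M, 0 < r := fun r hr => hLpos r (by simp [hr])
    have hnotmem : v0 :: v0 :: v' ∉ oppReps := by
      intro hmem
      rw [hx', conj_full, Bool.not_not] at hmem
      have hl2 : 2 ≤ (node v0 M l₁ lk).length := by rw [length_node]; simp; omega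
      rcases mem_oppReps_cases hl2 hmem with h1 | h1 | ⟨c, u, x, y, hs, h1⟩
      · have h2 := congrArg rle h1
        have h3 : List.replicate (node v0 M l₁ lk).length true =
            ofRuns true [(node v0 M l₁ lk).length] := by simp [ofRuns_cons]
        rw [h3, rle_ofRuns _ (by simp; omega), rle_node _ hM _ hlk] at h2
        simp at h2
      · have hs := canon_singleton (S := (node v0 M l₁ lk).length - 1) (by omega)
        have h2 := congrArg rle h1
        rw [← hs.opp_singleton, ← List.nil_append [(node v0 M l₁ lk).length - 1],
          Canon.opp_false, rle_full _ (by simp; omega), rle_node _ hM _ hlk] at h2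
        simp at h2
        omega
      · have h2 := congrArg rle h1
        obtain ⟨h', L, hL, h3⟩ : ∃ h' L, (∀ r ∈ L, 0 < r) ∧ opp c (u ++ [x, y]) = full h' L := by
          by_cases h : c = true ∧ Spec (u ++ [x, y])
          · exact ⟨_, _, hs.pos, opp_of_spec h⟩
          · have h4 : u ++ [x, y] = (u ++ [x]) ++ [y] := by simp
            rw [h4] at h hs ⊢
            exact ⟨_, _, fun r hr => hs.pos r (by simp at hr ⊢; tauto), opp_snoc h⟩
        rw [h3, rle_full _ hL, rle_node _ hM _ hlk] at h2
        simp at h2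
        omega
    have hfb : feedback (a :: v0 :: v') = xor (xor a v0) ((v0 :: v').getLastD false) := rfl
    rw [succO, hfb] at hg
    by_cases hav : a = v0
    · subst hav
      have hnot : ¬ (a :: a :: v' ∈ oppReps ∨ conj (a :: a :: v') ∈ oppReps) := by
        intro h
        rw [if_pos h] at hg
        simp at hg
      push Not at hnot
      rw [hx, hx']
      refine key_full_lt_key_conj hLpos ?_
      intro c s hs he
      apply hnot.2
      have : conj (a :: a :: v') = full (!a) (l₁ :: (M ++ [lk])) := by rw [hx', conj_conj]
      rw [this, he]
      exact hs.opp_mem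
    · have ha : a = !v0 := Bool.eq_not_iff.2 hav
      subst ha
      have hmem : (!v0) :: v0 :: v' ∈ oppReps ∨ conj ((!v0) :: v0 :: v') ∈ oppReps := by
        by_contra h
        rw [if_neg h] at hg
        cases v0 <;> simp at hg
      have hc : conj ((!v0) :: v0 :: v') = v0 :: v0 :: v' := by rw [conj, Bool.not_not]
      rw [hc] at hmem
      have hmem := hmem.resolve_right hnotmem
      have h2 : full (!v0) (l₁ :: (M ++ [lk])) ≠ List.replicate
          (full (!v0) (l₁ :: (M ++ [lk]))).length true := not_const_of_full (by simp) hLpos _ _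
      rw [Bool.not_not, hx', hx]
      rw [hx] at hmem
      rcases mem_oppReps_cases (by rw [length_full]; simp; omega) hmem with h3 | h3 |
        ⟨c, u, x, y, hs, h3⟩
      · exact absurd h3 h2
      · exfalso
        rw [← hx] at h3
        simp only [List.cons.injEq, List.length_cons, Nat.add_sub_cancel] at h3
        apply hv0
        simpa using h3.2
      · rw [h3]
        exact hs.key_conj_opp_lt hs.opp_inCycle

theorem preferOpposite_succO {n : ℕ} (hn : 2 ≤ n) :
    IsDeBruijn n (preferOpposite n) ∧
      DB succO (true :: List.replicate (n - 1) false) = preferOpposite n ∧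
      ∀ w, w.length = n → ∀ i j, (step succO)^[i] w = (step succO)^[j] w ↔ i ≡ j [MOD 2 ^ n] := by
  have hn1 : true :: List.replicate (n - 1) false = conj (List.replicate n false) := by
    obtain ⟨m, rfl⟩ : ∃ m, n = m + 1 := ⟨n - 1, by omega⟩
    simp [List.replicate_succ, conj]
  refine preferOpposite_of_key hn (fun w hw => succO_conj (by omega)) key ?_ ?_ ?_ ?_
  · intro w hw hne
    exact key_lt_key_step (by omega) (by rwa [hw])
  · rw [succO, if_pos (Or.inl (cons_replicate_mem hn)), hn1, feedback_conj (by simpa using hn),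
      feedback_replicate hn]
    rfl
  · rw [succO, if_pos (Or.inl (replicate_true_mem hn)), feedback_replicate hn]
    rfl
  · intro a v hv hv1 hg
    refine key_lt_key_of_succO ?_ (by rwa [hv]) hg
    rintro rfl
    simp at hv
    omega

end PreferOpposite

namespace PreferOpposite

/-! ### Testing for least rotations -/

theorem lt_of_getD {l m : List ℕ} (hlen : l.length = m.length) {t : ℕ} (ht : t < l.length)
    (heq : ∀ j < t, l.getD j 0 = m.getD j 0) (hlt : l.getD t 0 < m.getD t 0) : l < m := by
  rw [List.lt_iff_exists]
  right
  refine ⟨t, ht, by omega, fun j hj => ?_, ?_⟩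
  · have := heq j hj
    rwa [List.getD_eq_getElem _ _ (by omega), List.getD_eq_getElem _ _ (by omega)] at this
  · rwa [List.getD_eq_getElem _ _ (by omega), List.getD_eq_getElem _ _ (by omega)] at hlt

theorem getD_rotate (s : List ℕ) (t : ℕ) {j : ℕ} (hj : j < s.length) :
    (s.rotate t).getD j 0 = s.getD ((j + t) % s.length) 0 := by
  rw [List.getD_eq_getElem _ _ (by simpa using hj), List.getElem_rotate,
    List.getD_eq_getElem]

/-- The first `i` entries of `s` have the period `p`, and the first `p` entries form a list that
is smaller than its proper suffixes. -/
structure LyndonPeriod (s : List ℕ) (i p : ℕ) : Prop where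
  pos : 0 < p
  le : p ≤ i
  periodic : ∀ j < i, s.getD j 0 = s.getD (j % p) 0
  lyndon : ∀ m, 0 < m → m < p → ∃ t, m + t < p ∧ s.getD t 0 < s.getD (m + t) 0 ∧
    ∀ t' < t, s.getD t' 0 = s.getD (m + t') 0

theorem lyndonPeriod_one (s : List ℕ) : LyndonPeriod s 1 1 where
  pos := one_pos
  le := le_rfl
  periodic := fun j hj => by simp [Nat.lt_one_iff.1 hj]
  lyndon := fun m h1 h2 => by omega

namespace LyndonPeriod

variable {s : List ℕ} {i p : ℕ}

theorem step_eq (h : LyndonPeriod s i p) (he : s.getD i 0 = s.getD (i % p) 0) :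
    LyndonPeriod s (i + 1) p where
  pos := h.pos
  le := by have := h.le; omega
  periodic := fun j hj => by
    rcases Nat.lt_succ_iff_lt_or_eq.1 hj with h1 | rfl
    · exact h.periodic j h1
    · exact he
  lyndon := h.lyndon

/-- Duval's step at an ascent: the whole prefix becomes the new Lyndon word. The suffix at `m`
agrees with the suffix at `m % p` of the old word until it exceeds the prefix there, or until it
meets the new, larger entry. -/
theorem step_lt (h : LyndonPeriod s i p) (hlt : s.getD (i % p) 0 < s.getD i 0) :
    LyndonPeriod s (i + 1) (i + 1) where
  pos := by omega
  le := le_rfl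
  periodic := fun j hj => by rw [Nat.mod_eq_of_lt hj]
  lyndon := fun m h0 hm => by
    have hp := h.pos
    have hmod : ∀ j, m % p + j < p → (m + j) % p = m % p + j := by
      intro j hj
      rw [Nat.add_mod, ← Nat.mod_eq_of_lt hj, Nat.add_mod (m % p) j, Nat.mod_mod]
    by_cases hb : m % p = 0
    · have hz : ∀ j, (m + j) % p = j % p := by
        intro j
        rw [Nat.add_mod, hb, zero_add, Nat.mod_mod]
      have he : ∀ j, m + j < i → s.getD j 0 = s.getD (m + j) 0 := by
        intro j hj
        rw [h.periodic (m + j) hj, hz, h.periodic j (by omega)]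
      refine ⟨i - m, by omega, ?_, fun t' ht' => he t' (by omega)⟩
      rw [show m + (i - m) = i by omega]
      have h1 := hz (i - m)
      rw [show m + (i - m) = i by omega] at h1
      rwa [h.periodic (i - m) (by omega), ← h1]
    · obtain ⟨t, ht, ht1, ht2⟩ := h.lyndon (m % p) (by omega) (Nat.mod_lt _ hp)
      have he : ∀ j, j ≤ t → m + j < i → s.getD (m + j) 0 = s.getD (m % p + j) 0 := by
        intro j hj hj'
        rw [h.periodic (m + j) hj', hmod j (by omega)]
      rcases lt_trichotomy (m + t) i with h1 | h1 | h1
      · refine ⟨t, by omega, ?_, fun t' ht' => ?_⟩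
        · rwa [he t le_rfl h1]
        · rw [he t' ht'.le (by omega), ht2 t' ht']
      · refine ⟨t, by omega, ?_, fun t' ht' => ?_⟩
        · rw [← h1, hmod t ht] at hlt
          exact ht1.trans hlt
        · rw [he t' ht'.le (by omega), ht2 t' ht']
      · refine ⟨i - m, by omega, ?_, fun t' ht' => ?_⟩
        · rw [show m + (i - m) = i by omega, ht2 (i - m) (by omega), ← hmod (i - m) (by omega),
            show m + (i - m) = i by omega]
          exact hlt
        · rw [he t' (by omega) (by omega), ht2 t' (by omega)]

/-- The rotation to the start of the last incomplete period exposes the smaller entry after an equal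
stretch. -/
theorem not_isMin_of_gt (h : LyndonPeriod s i p) (hi : i < s.length)
    (hgt : s.getD i 0 < s.getD (i % p) 0) : ¬ IsMin s := by
  intro hmin
  have hd := Nat.div_add_mod i p
  have hp := Nat.mod_lt i h.pos
  set r := i % p with hr
  have hrot : ∀ j, j ≤ r → (s.rotate (i - r)).getD j 0 = s.getD (i - r + j) 0 := by
    intro j hj
    rw [getD_rotate _ _ (by omega), Nat.mod_eq_of_lt (by omega), add_comm]
  refine absurd (hmin (i - r)) (not_le.2 (lt_of_getD (t := r) (by simp) (by simp; omega)
    (fun j hj => ?_) ?_))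
  · rw [hrot j hj.le, h.periodic _ (by omega), show i - r + j = j + p * (i / p) by omega,
      Nat.add_mul_mod_self_left, ← h.periodic j (by omega)]
  · rw [hrot r le_rfl, show i - r + r = i by omega]
    exact hgt

/-- The rotation that begins with the incomplete last period, of length `r`, agrees with `s` for `r`
entries and then restarts `s`, where the Lyndon property of the suffix at `r` makes it smaller. -/
theorem not_isMin_of_mod (h : LyndonPeriod s s.length p) (hr : s.length % p ≠ 0) :
    ¬ IsMin s := by
  intro hmin
  have hle := h.le
  have hd := Nat.div_add_mod s.length p
  have hp := Nat.mod_lt s.length h.pos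
  set r := s.length % p with hrdef
  obtain ⟨t, ht, ht1, ht2⟩ := h.lyndon r (by omega) hp
  have h1 : ∀ j, j < r → (s.rotate (s.length - r)).getD j 0 = s.getD j 0 := by
    intro j hj
    rw [getD_rotate _ _ (by omega), Nat.mod_eq_of_lt (by omega), h.periodic _ (by omega),
      show j + (s.length - r) = j + p * (s.length / p) by omega, Nat.add_mul_mod_self_left,
      ← h.periodic j (by omega)]
  have h2 : ∀ j, r + j < s.length → (s.rotate (s.length - r)).getD (r + j) 0 = s.getD j 0 := by
    intro j hj
    rw [getD_rotate _ _ hj, show r + j + (s.length - r) = j + s.length by omega,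
      Nat.add_mod_right, Nat.mod_eq_of_lt (by omega)]
  refine absurd (hmin (s.length - r)) (not_le.2 (lt_of_getD (t := r + t) (by simp)
    (by simp; omega) (fun j hj => ?_) ?_))
  · rcases Nat.lt_or_ge j r with h3 | h3
    · exact h1 j h3
    · obtain ⟨j', rfl⟩ := Nat.exists_eq_add_of_le h3
      rw [h2 j' (by omega), ht2 j' (by omega)]
  · rw [h2 t (by omega)]
    exact ht1

theorem getD_rotate_of_dvd (h : LyndonPeriod s s.length p) (hr : p ∣ s.length) (t : ℕ) {j : ℕ}
    (hj : j < s.length) : (s.rotate t).getD j 0 = s.getD ((j + t) % p) 0 := by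
  rw [getD_rotate _ _ hj, h.periodic _ (Nat.mod_lt _ (by omega)), Nat.mod_mod_of_dvd _ hr]

theorem rotate_eq_self (h : LyndonPeriod s s.length p) (hr : p ∣ s.length) {t : ℕ}
    (ht : p ∣ t) : s.rotate t = s := by
  apply List.ext_getElem (by simp)
  intro j h1 h2
  have h3 := h.getD_rotate_of_dvd hr t h2
  obtain ⟨m, rfl⟩ := ht
  rw [Nat.add_mul_mod_self_left, ← h.periodic j h2] at h3
  rwa [List.getD_eq_getElem _ _ h1, List.getD_eq_getElem _ _ h2] at h3

theorem lt_rotate (h : LyndonPeriod s s.length p) (hr : p ∣ s.length) {t : ℕ}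
    (ht : ¬ p ∣ t) : s < s.rotate t := by
  have hle := h.le
  have hp := Nat.mod_lt t h.pos
  obtain ⟨d, hd, hd1, hd2⟩ := h.lyndon (t % p)
    (Nat.pos_of_ne_zero fun h0 => ht (Nat.dvd_of_mod_eq_zero h0)) hp
  have he : ∀ j, t % p + j < p → (s.rotate t).getD j 0 = s.getD (t % p + j) 0 := by
    intro j hj
    rw [h.getD_rotate_of_dvd hr t (by omega), add_comm j t, ← Nat.mod_add_mod,
      Nat.mod_eq_of_lt hj]
  refine lt_of_getD (t := d) (by simp) (by omega) (fun j hj => ?_) ?_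
  · rw [he j (by omega), hd2 j hj]
  · rw [he d hd]
    exact hd1

theorem isMin (h : LyndonPeriod s s.length p) (hr : p ∣ s.length) : IsMin s := by
  intro t
  by_cases ht : p ∣ t
  · rw [h.rotate_eq_self hr ht]
  · exact (h.lt_rotate hr ht).le

/-- The rotations that fix `s` are those by multiples of `p`. -/
theorem exists_odd_iff (h : LyndonPeriod s s.length p) (hr : p ∣ s.length) :
    (∀ i : ℕ, i.bodd = true → s.rotate i ≠ s) ↔ p.bodd = false := by
  constructor
  · intro h1
    by_contra hp
    exact h1 p (by simpa using hp) (h.rotate_eq_self hr dvd_rfl)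
  · intro hp i hi he
    by_cases ht : p ∣ i
    · obtain ⟨m, rfl⟩ := ht
      rw [Nat.bodd_mul, hp] at hi
      simp at hi
    · have := h.lt_rotate hr ht
      rw [he] at this
      exact lt_irrefl _ this

end LyndonPeriod

/-! ### A criterion for the opp-reps in terms of run lengths -/

theorem spec_iff {s : List ℕ} (hs : 2 ≤ s.length) :
    Spec s ↔ s.length % 2 = 0 ∧ (∀ j, j + 1 < s.length → s.getD j 0 = s.getD 0 0) ∧
      s.getD 0 0 < s.getD (s.length - 1) 0 := by
  constructor
  · rintro ⟨x, y, z, hz, hxy, rfl⟩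
    have hz1 : z % 2 = 1 := Nat.odd_iff.1 hz
    have h0 : ∀ j, j < z → (List.replicate z x ++ [y]).getD j 0 = x := by
      intro j hj
      rw [List.getD_append _ _ _ _ (by simpa using hj)]
      simp [List.getD_eq_getElem?_getD, hj]
    refine ⟨by simp; omega, fun j hj => ?_, ?_⟩
    · simp at hj
      rw [h0 j (by omega), h0 0 (by omega)]
    · rw [h0 0 (by omega)]
      simp [List.getD_eq_getElem?_getD]
      exact hxy
  · rintro ⟨h1, h2, h3⟩
    refine ⟨s.getD 0 0, s.getD (s.length - 1) 0, s.length - 1, ?_, h3, ?_⟩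
    · rw [Nat.odd_iff]
      omega
    · apply List.ext_getElem (by simp; omega)
      intro j hj hj'
      rcases Nat.lt_or_ge (j + 1) s.length with h4 | h4
      · rw [List.getElem_append_left (by simp; omega), List.getElem_replicate, ← h2 j h4,
          List.getD_eq_getElem _ _ hj]
      · have : j = s.length - 1 := by omega
        subst this
        have h5 := List.getD_eq_getElem s 0 hj
        rw [List.getElem_append_right (by simp), List.getElem_singleton, h5]

/-- A proper rotation meets `y > x` earlier, so it is strictly larger, and the length `z + 1` is
even. Hence special lists need no test for minimality. -/
theorem canon_of_spec {s : List ℕ} (hpos : ∀ r ∈ s, 0 < r) (h : Spec s) : Canon true s := by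
  obtain ⟨x, y, z, hz, hxy, rfl⟩ := h
  have hlt : ∀ i : ℕ, i % (z + 1) ≠ 0 →
      List.replicate z x ++ [y] < (List.replicate z x ++ [y]).rotate i := by
    intro i hi
    rw [← List.rotate_mod]
    have hm := Nat.mod_lt i (Nat.succ_pos z)
    simp only [List.length_append, List.length_replicate, List.length_singleton]
    set j := i % (z + 1)
    have h1 : List.replicate z x ++ [y] =
        List.replicate j x ++ (List.replicate (z - j) x ++ [y]) := by
      rw [← List.append_assoc, ← List.replicate_add, show j + (z - j) = z by omega]
    have h2 : (List.replicate z x ++ [y]).rotate j =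
        List.replicate (z - j) x ++ ([y] ++ List.replicate j x) := by
      rw [h1]
      have := List.rotate_append_length_eq (List.replicate j x) (List.replicate (z - j) x ++ [y])
      rw [List.length_replicate] at this
      rw [this, List.append_assoc]
    rw [h2]
    refine lt_of_prefix hxy (P := List.replicate (z - j) x) ?_ ?_
    · have h3 : z - j + 1 + (j - 1) = z := by omega
      have h4 : List.replicate z x = List.replicate (z - j + 1) x ++ List.replicate (j - 1) x := by
        rw [← List.replicate_add, h3]
      rw [← List.replicate_succ', h4, List.append_assoc]
      exact List.prefix_append _ _
    · rw [← List.append_assoc]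
      exact List.prefix_append _ _
  have hself : ∀ i : ℕ, i % (z + 1) = 0 →
      (List.replicate z x ++ [y]).rotate i = List.replicate z x ++ [y] := by
    intro i hi
    rw [← List.rotate_mod]
    simp [hi]
  refine ⟨by simp, hpos, fun i => ?_, fun _ i hi he => ?_⟩
  · by_cases h : i % (z + 1) = 0
    · rw [hself i h]
    · exact (hlt i h).le
  · by_cases h : i % (z + 1) = 0
    · have h1 := Nat.mod_two_of_bodd i
      rw [hi] at h1
      have h2 : 2 ∣ z + 1 := by
        have := Nat.odd_iff.1 hz
        omega
      have h3 := h2.trans (Nat.dvd_of_mod_eq_zero h)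
      simp at h1
      omega
    · have := hlt i h
      rw [he] at this
      exact lt_irrefl _ this

theorem flips_of_length_one {a b : Bool} {S : ℕ} (hS : 0 < S) :
    a :: ofRuns b [S] ∈ oppReps ∨ conj (a :: ofRuns b [S]) ∈ oppReps := by
  have h1 : ofRuns b [S] = List.replicate S b := by simp [ofRuns_cons]
  have h2 : b = false → true :: List.replicate S b ∈ oppReps := by
    rintro rfl
    exact cons_replicate_mem (n := S + 1) (by omega)
  have h3 : b = true → true :: List.replicate S b ∈ oppReps := by
    rintro rfl
    exact replicate_true_mem (n := S + 1) (by omega)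
  have h4 : true :: List.replicate S b ∈ oppReps := by
    cases b
    · exact h2 rfl
    · exact h3 rfl
  rw [h1]
  cases a
  · exact Or.inr h4
  · exact Or.inl h4

/-- The string is a special RL2-rep, which must begin with 1, or an LC2-rep. In the latter case the
first entry of `L` is the last one of the least rotation, whence `L.rotate 1`. -/
theorem full_mem_iff {b : Bool} {L : List ℕ} (hne : L ≠ []) (hpos : ∀ r ∈ L, 0 < r) :
    full (!b) L ∈ oppReps ↔ (b = false ∧ Spec L) ∨
      (Canon b (L.rotate 1) ∧ ¬ (b = true ∧ Spec (L.rotate 1))) := by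
  have hlen : 2 ≤ (full (!b) L).length := by
    rw [length_full]
    have h1 := hpos _ (List.getLast_mem hne)
    have h2 := List.single_le_sum (l := L) (by simp) _ (List.getLast_mem hne)
    omega
  have hmem : full (!b) L ∈ oppReps ↔ ∃ c s, Canon c s ∧ full (!b) L = opp c s := by
    rw [← isOppRep_iff hlen rfl (not_const_of_full hne hpos _ _)
      (not_const_of_full hne hpos _ _)]
    exact ⟨fun h => h.1, fun h => ⟨h, not_const_of_full hne hpos _ _⟩⟩
  have hinj : ∀ {h h' : Bool} {L' : List ℕ}, (∀ r ∈ L', 0 < r) → full h L = full h' L' →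
      h = h' ∧ L = L' := by
    intro h h' L' hpos' he
    have h1 := congrArg rle he
    rw [rle_full _ hpos, rle_full _ hpos'] at h1
    have h2 := congrArg List.head? he
    simp [full, ofRuns_one] at h1 h2
    exact ⟨h2, h1⟩
  rw [hmem]
  constructor
  · rintro ⟨c, s, hs, he⟩
    by_cases h : c = true ∧ Spec s
    · rw [opp_of_spec h] at he
      obtain ⟨h1, rfl⟩ := hinj hs.pos he
      left
      rw [h.1] at h1
      exact ⟨by simpa using h1, h.2⟩
    · obtain ⟨u, d, rfl⟩ := hs.exists_snoc
      rw [opp_snoc h] at he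
      obtain ⟨h1, rfl⟩ := hinj (fun r hr => hs.pos r (by simp at hr ⊢; tauto)) he
      right
      have h2 : b = c := by simpa using h1
      subst h2
      exact ⟨by simpa using hs, by simpa using h⟩
  · rintro (⟨rfl, h⟩ | ⟨h1, h2⟩)
    · exact ⟨true, L, canon_of_spec hpos h, by rw [opp_of_spec ⟨rfl, h⟩]; rfl⟩
    · refine ⟨b, L.rotate 1, h1, ?_⟩
      obtain ⟨l, L', rfl⟩ := List.exists_cons_of_ne_nil hne
      simp only [List.rotate_cons_succ, List.rotate_zero] at h2 ⊢
      rw [opp_snoc h2]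

/-- Of the two conjugates only the one with a first run of length 1 can be an opp-rep. -/
theorem flips_iff {a b : Bool} {L : List ℕ} (hlen : 2 ≤ L.length) (hpos : ∀ r ∈ L, 0 < r) :
    (a :: ofRuns b L ∈ oppReps ∨ conj (a :: ofRuns b L) ∈ oppReps) ↔
      (b = false ∧ Spec L) ∨ (Canon b (L.rotate 1) ∧ ¬ (b = true ∧ Spec (L.rotate 1))) := by
  have hne : L ≠ [] := by rintro rfl; simp at hlen
  rw [← full_mem_iff hne hpos, full, ofRuns_one, Bool.not_not]
  have h1 : b :: ofRuns b L ∉ oppReps := by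
    obtain ⟨l, L', rfl⟩ := List.exists_cons_of_ne_nil hne
    have hl := hpos l (by simp)
    rw [← ofRuns_succ]
    have hpos' : ∀ r ∈ (l + 1) :: L', 0 < r := by
      intro r hr
      rcases List.mem_cons.1 hr with rfl | hr
      · omega
      · exact hpos r (by simp [hr])
    have hne1 : ∀ h m, ofRuns b ((l + 1) :: L') ≠ List.replicate m h := by
      intro h m he
      have h2 : List.replicate m h = ofRuns h [m] := by simp [ofRuns_cons]
      have hm : 0 < m := by
        have := congrArg List.length he
        simp at this
        omega
      have h3 := congrArg rle he
      rw [h2, rle_ofRuns _ hpos', rle_ofRuns _ (by simpa using hm)] at h3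
      simp at h3
      rw [h3.2] at hlen
      simp at hlen
    intro hmem
    obtain ⟨c, s, hs, he⟩ := (isOppRep_iff (by simp; omega) rfl (hne1 _ _) (hne1 _ _)).1 hmem.1
    obtain ⟨h', L'', hL, h3⟩ : ∃ h' L'', (∀ r ∈ L'', 0 < r) ∧ opp c s = full h' L'' := by
      by_cases h : c = true ∧ Spec s
      · exact ⟨_, _, hs.pos, opp_of_spec h⟩
      · obtain ⟨u, d, rfl⟩ := hs.exists_snoc
        exact ⟨_, _, fun r hr => hs.pos r (by simp at hr ⊢; tauto), opp_snoc h⟩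
    rw [h3] at he
    have h4 := congrArg rle he
    rw [rle_full _ hL, rle_ofRuns _ hpos'] at h4
    simp at h4
    omega
  by_cases hab : a = b
  · subst hab
    simp only [conj, h1, false_or]
  · have ha : a = !b := Bool.eq_not_iff.2 hab
    subst ha
    simp only [conj, Bool.not_not, h1, or_false]

end PreferOpposite

namespace PreferOpposite

/-! ### Total correctness on the random access machine -/

/-- `p`, started in `s`, terminates in a state that satisfies `Q`. -/
def WP (W : ℕ) (p : Cmd) (Q : State → Prop) (s : State) : Prop := ∃ s', Exec W p s s' ∧ Q s'

section WP

variable {W : ℕ} {Q : State → Prop} {s : State}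

theorem wp_skip : WP W .skip Q s ↔ Q (s.tick 1) := by
  constructor
  · rintro ⟨s', h, hQ⟩
    cases h
    exact hQ
  · exact fun h => ⟨_, .skip s, h⟩

theorem wp_assign {x : ℕ} {a : Expr} : WP W (.assign x a) Q s ↔ a.InBounds W s ∧
    Q ({ s with vars := Function.update s.vars x (a.eval s) }.tick (a.cost + 1)) := by
  constructor
  · rintro ⟨s', h, hQ⟩
    cases h with
    | assign _ _ _ ha => exact ⟨ha, hQ⟩
  · exact fun h => ⟨_, .assign s x a h.1, h.2⟩

theorem wp_store {e a : Expr} : WP W (.store e a) Q s ↔ e.InBounds W s ∧ a.InBounds W s ∧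
    Q ({ s with mem := Function.update s.mem (e.eval s) (a.eval s) }.tick
      (e.cost + a.cost + 1)) := by
  constructor
  · rintro ⟨s', h, hQ⟩
    cases h with
    | store _ _ _ he ha => exact ⟨he, ha, hQ⟩
  · exact fun h => ⟨_, .store s e a h.1 h.2.1, h.2.2⟩

theorem wp_emit {a : Expr} : WP W (.emit a) Q s ↔ a.InBounds W s ∧
    Q ({ s with out := s.out ++ [(a.eval s, s.clock + a.cost + 1)] }.tick (a.cost + 1)) := by
  constructor
  · rintro ⟨s', h, hQ⟩
    cases h with
    | emit _ _ ha => exact ⟨ha, hQ⟩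
  · exact fun h => ⟨_, .emit s a h.1, h.2⟩

theorem wp_seq {p q : Cmd} : WP W (.seq p q) Q s ↔ WP W p (fun s' => WP W q Q s') s := by
  constructor
  · rintro ⟨s'', h, hQ⟩
    cases h with
    | seq _ s' _ _ _ hp hq => exact ⟨s', hp, s'', hq, hQ⟩
  · rintro ⟨s', hp, s'', hq, hQ⟩
    exact ⟨s'', .seq _ _ _ _ _ hp hq, hQ⟩

theorem wp_ite {c : Expr} {p q : Cmd} : WP W (.ite c p q) Q s ↔ c.InBounds W s ∧
    (c.eval s ≠ 0 → WP W p Q (s.tick (c.cost + 1))) ∧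
    (c.eval s = 0 → WP W q Q (s.tick (c.cost + 1))) := by
  constructor
  · rintro ⟨s', h, hQ⟩
    cases h with
    | iteTrue _ _ _ _ _ hc h hp => exact ⟨hc, fun _ => ⟨s', hp, hQ⟩, fun h' => absurd h' h⟩
    | iteFalse _ _ _ _ _ hc h hp => exact ⟨hc, fun h' => absurd h h', fun _ => ⟨s', hp, hQ⟩⟩
  · rintro ⟨hc, h1, h2⟩
    by_cases h : c.eval s = 0
    · obtain ⟨s', hq, hQ⟩ := h2 h
      exact ⟨s', .iteFalse _ _ _ _ _ hc h hq, hQ⟩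
    · obtain ⟨s', hp, hQ⟩ := h1 h
      exact ⟨s', .iteTrue _ _ _ _ _ hc h hp, hQ⟩

theorem WP.loop {c : Expr} {p : Cmd} (I : State → Prop) (μ : State → ℕ)
    (hI : ∀ s, I s → c.InBounds W s ∧
      (c.eval s ≠ 0 → WP W p (fun s' => I s' ∧ μ s' < μ s) (s.tick (c.cost + 1))) ∧
      (c.eval s = 0 → Q (s.tick (c.cost + 1)))) (hs : I s) : WP W (.loop c p) Q s := by
  generalize hm : μ s = m
  induction m using Nat.strong_induction_on generalizing s with
  | _ m ih =>
    obtain ⟨hc, h1, h2⟩ := hI s hs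
    by_cases h : c.eval s = 0
    · exact ⟨_, .loopDone _ _ _ hc h, h2 h⟩
    · obtain ⟨s', hp, hI', hlt⟩ := h1 h
      obtain ⟨s'', hl, hQ⟩ := ih (μ s') (hm ▸ hlt) hI' rfl
      exact ⟨s'', .loopStep _ _ _ _ _ hc h hp hl, hQ⟩

end WP

/-! ### Parity -/

/-- Variable `dst` receives the parity of variable `src`. -/
def parityCmd (src dst : ℕ) : Cmd :=
  .seq (.assign dst (.var src))
    (.loop (.lt (.const 1) (.var dst)) (.assign dst (.sub (.var dst) (.const 2))))

theorem wp_parityCmd {W : ℕ} {Q : State → Prop} {s : State} {src dst : ℕ} (hW : 3 ≤ W)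
    (hsrc : s.vars src < W)
    (hQ : ∀ s' : State, s'.vars = Function.update s.vars dst (s.vars src % 2) →
      s'.mem = s.mem → s'.out = s.out → s'.clock ≤ s.clock + 8 * s.vars src + 10 → Q s') :
    WP W (parityCmd src dst) Q s := by
  rw [parityCmd, wp_seq, wp_assign]
  refine ⟨hsrc, ?_⟩
  -- Here and in the later scans, the invariant bounds the clock plus a fixed price for each
  -- remaining unit of the measure; at the exit this is the time bound.
  refine WP.loop (fun t => ∃ m, t.vars = Function.update s.vars dst m ∧ m % 2 = s.vars src % 2 ∧
    m ≤ s.vars src ∧ t.mem = s.mem ∧ t.out = s.out ∧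
    t.clock + 8 * m ≤ s.clock + 8 * s.vars src + 2) (fun t => t.vars dst) ?_ ?_
  · rintro t ⟨m, h1, h2, h3, h4, h5, h6⟩
    simp only [Expr.InBounds, Expr.eval, wp_assign, State.tick, h1, Function.update_self,
      Expr.cost]
    refine ⟨⟨by omega, by omega⟩, fun hc => ⟨⟨by omega, by omega⟩, ⟨m - 2, ?_, ?_, ?_, ?_⟩, ?_⟩,
      fun hc => ?_⟩
    · simp
    · split_ifs at hc <;> omega
    · omega
    · refine ⟨h4, h5, ?_⟩
      split_ifs at hc <;> omega
    · split_ifs at hc <;> omega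
    · apply hQ
      · simp only
        congr 1
        split_ifs at hc
        omega
      · exact h4
      · exact h5
      · simp only
        omega
  · exact ⟨s.vars src, rfl, rfl, le_rfl, rfl, rfl, by simp [State.tick, Expr.cost]; omega⟩

/-! ### The shift -/

/-- The entries `1, …, n - 1` of the memory move one place down, and variable 6 is stored behind
them. -/
def shiftCmd : Cmd :=
  .seq (.assign 1 (.const 1))
    (.seq (.loop (.lt (.var 1) (.var 0))
        (.seq (.store (.sub (.var 1) (.const 1)) (.load (.var 1)))
          (.assign 1 (.add (.var 1) (.const 1)))))
      (.store (.sub (.var 0) (.const 1)) (.var 6)))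

theorem wp_shiftCmd {W n : ℕ} {Q : State → Prop} {s : State} (hW : n + 3 ≤ W)
    (hn : s.vars 0 = n) (hn1 : 1 ≤ n) (h6 : s.vars 6 < W) (hmem : ∀ i < n, s.mem i < W)
    (hQ : ∀ s' : State, (∀ x, x ≠ 1 → s'.vars x = s.vars x) →
      (∀ i, i + 1 < n → s'.mem i = s.mem (i + 1)) → s'.mem (n - 1) = s.vars 6 →
      s'.out = s.out → s'.clock ≤ s.clock + 20 * n + 20 → Q s') :
    WP W shiftCmd Q s := by
  rw [shiftCmd, wp_seq, wp_assign]
  refine ⟨by simp [Expr.InBounds]; omega, ?_⟩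
  rw [wp_seq]
  refine WP.loop (fun t => (∀ x, x ≠ 1 → t.vars x = s.vars x) ∧ 1 ≤ t.vars 1 ∧ t.vars 1 ≤ n ∧
    (∀ i, i + 1 < t.vars 1 → t.mem i = s.mem (i + 1)) ∧
    (∀ i, t.vars 1 ≤ i → t.mem i = s.mem i) ∧ t.out = s.out ∧
    t.clock + 20 * (n - t.vars 1) ≤ s.clock + 20 * n) (fun t => n - t.vars 1) ?_ ?_
  · rintro t ⟨h1, h2, h3, h4, h5, h7, h8⟩
    have h0 : t.vars 0 = n := by rw [h1 0 (by omega), hn]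
    have h6' : t.vars 6 = s.vars 6 := h1 6 (by omega)
    simp only [Expr.InBounds, Expr.eval, wp_assign, wp_seq, wp_store, State.tick, Expr.cost, h0, h6']
    refine ⟨⟨by omega, by omega⟩, fun hc => ?_, fun hc => ?_⟩
    · have hlt : t.vars 1 < n := by
        by_contra hlt
        simp [hlt] at hc
      refine ⟨⟨by omega, by omega⟩, ⟨by omega, ?_⟩, ⟨by omega, by omega, by omega⟩, ?_, ?_⟩
      · rw [h5 _ le_rfl]
        exact hmem _ hlt
      · refine ⟨fun x hx => ?_, ?_, ?_, fun i hi => ?_, fun i hi => ?_, h7, ?_⟩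
        · rw [Function.update_of_ne hx, h1 x hx]
        · simp
        · simp; omega
        · simp only [Function.update_self] at hi
          by_cases hi' : i = t.vars 1 - 1
          · subst hi'
            rw [Function.update_self, h5 _ le_rfl]
            congr 1
            omega
          · rw [Function.update_of_ne hi', h4 i (by omega)]
        · simp only [Function.update_self] at hi
          rw [Function.update_of_ne (by omega), h5 i (by omega)]
        · simp only [Function.update_self]
          omega
      · simp only [Function.update_self]
        omega
    · have hge : t.vars 1 = n := by
        by_contra hlt
        rw [if_pos (by omega)] at hc
        omega
      refine ⟨⟨by omega, by omega⟩, h6, hQ _ h1 (fun i hi => ?_) ?_ h7 ?_⟩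
      · simp only
        rw [Function.update_of_ne (by omega), h4 i (by omega)]
      · simp
      · simp only
        omega
  · refine ⟨fun x hx => ?_, ?_, ?_, fun i hi => ?_, fun i hi => rfl, rfl, ?_⟩
    · simp [State.tick, hx]
    · simp [State.tick, Expr.eval]
    · simpa [State.tick, Expr.eval] using hn1
    · simp [State.tick, Expr.eval] at hi
    · simp [State.tick, Expr.eval, Expr.cost]
      omega

end PreferOpposite

namespace PreferOpposite

/-! ### Run lengths -/

theorem ofRuns_snoc_one (h : Bool) (rs : List ℕ) :
    ofRuns h (rs ++ [1]) = ofRuns h rs ++ [xor h rs.length.bodd] := by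
  simp [ofRuns_append, ofRuns_cons]

theorem length_le_sum {L : List ℕ} (hpos : ∀ r ∈ L, 0 < r) : L.length ≤ L.sum := by
  induction L with
  | nil => simp
  | cons a L ih =>
    have := hpos a (by simp)
    have := ih (fun r hr => hpos r (by simp [hr]))
    simp
    omega

theorem getD_le_sum (L : List ℕ) (j : ℕ) : L.getD j 0 ≤ L.sum := by
  by_cases hj : j < L.length
  · rw [List.getD_eq_getElem _ _ hj]
    exact List.single_le_sum (by simp) _ (List.getElem_mem hj)
  · rw [List.getD_eq_default _ _ (by omega)]
    omega

/-- With the string `w` of length `n` in the memory, the run lengths of `w.tail` are stored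
from address `n` on, followed by the first of them, and their number in variable 2. -/
def runsCmd : Cmd :=
  .seq (.store (.var 0) (.const 1)) (.seq (.assign 2 (.const 0)) (.seq (.assign 1 (.const 2))
    (.seq (.loop (.lt (.var 1) (.var 0))
      (.seq (.ite (.eq (.load (.var 1)) (.load (.sub (.var 1) (.const 1))))
          (.store (.add (.var 0) (.var 2)) (.add (.load (.add (.var 0) (.var 2))) (.const 1)))
          (.seq (.assign 2 (.add (.var 2) (.const 1)))
            (.store (.add (.var 0) (.var 2)) (.const 1))))
        (.assign 1 (.add (.var 1) (.const 1)))))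
      (.seq (.assign 2 (.add (.var 2) (.const 1)))
        (.store (.add (.var 0) (.var 2)) (.load (.var 0)))))))

/-- The memory holds the string `β 0, …, β (n - 1)`, and behind it the list `L` of run lengths,
followed by its first entry. -/
structure HasRuns (n : ℕ) (β : ℕ → Bool) (L : List ℕ) (s : State) : Prop where
  var_zero : s.vars 0 = n
  bits : ∀ i < n, s.mem i = (β i).toNat
  ne_nil : L ≠ []
  pos : ∀ r ∈ L, 0 < r
  runs : (List.range (n - 1)).map (fun j => β (j + 1)) = ofRuns (β 1) L
  length : s.vars 2 = L.length
  mem : ∀ j < L.length, s.mem (n + j) = L.getD j 0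
  mem_last : s.mem (n + L.length) = L.getD 0 0

theorem HasRuns.tick {n : ℕ} {β : ℕ → Bool} {L : List ℕ} {s : State} (h : HasRuns n β L s)
    (t : ℕ) : HasRuns n β L (s.tick t) :=
  ⟨h.1, h.2, h.3, h.4, h.5, h.6, h.7, h.8⟩

theorem wp_runsCmd {W n : ℕ} {Q : State → Prop} {s : State} {β : ℕ → Bool} (hn2 : 2 ≤ n)
    (hW : 4 * n + 10 ≤ W) (hn : s.vars 0 = n) (hb : ∀ i < n, s.mem i = (β i).toNat)
    (hQ : ∀ (s' : State) (L : List ℕ), HasRuns n β L s' →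
      (∀ x, x ≠ 1 → x ≠ 2 → s'.vars x = s.vars x) →
      s'.out = s.out → s'.clock ≤ s.clock + 40 * n + 40 → Q s') :
    WP W runsCmd Q s := by
  rw [runsCmd, wp_seq, wp_store]
  refine ⟨by simp [Expr.InBounds]; omega, by simp [Expr.InBounds]; omega, ?_⟩
  rw [wp_seq, wp_assign]
  refine ⟨by simp [Expr.InBounds]; omega, ?_⟩
  rw [wp_seq, wp_assign]
  refine ⟨by simp [Expr.InBounds]; omega, ?_⟩
  rw [wp_seq]
  -- `rs` are the finished runs and `q` is the current one. The scan starts at index 2, since the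
  -- first bit is ignored and the bit at index 1 opens the first run.
  refine WP.loop (fun t => (∀ x, x ≠ 1 → x ≠ 2 → t.vars x = s.vars x) ∧ 2 ≤ t.vars 1 ∧
    t.vars 1 ≤ n ∧ (∀ i < n, t.mem i = (β i).toNat) ∧ t.out = s.out ∧
    t.clock + 40 * (n - t.vars 1) ≤ s.clock + 40 * n ∧
    ∃ rs q, (∀ r ∈ rs, 0 < r) ∧ 0 < q ∧
      (List.range (t.vars 1 - 1)).map (fun j => β (j + 1)) = ofRuns (β 1) (rs ++ [q]) ∧
      t.vars 2 = rs.length ∧ t.mem (n + rs.length) = q ∧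
      ∀ j < rs.length, t.mem (n + j) = rs.getD j 0) (fun t => n - t.vars 1) ?_ ?_
  · rintro t ⟨h1, h2, h3, h4, h5, h6, rs, q, hrs, hq, h7, h8, h9, h10⟩
    have h0 : t.vars 0 = n := by rw [h1 0 (by omega) (by omega), hn]
    have hsum : rs.sum + q = t.vars 1 - 1 := by
      have := congrArg List.length h7
      simp at this
      exact this.symm
    have hlen := length_le_sum hrs
    simp only [Expr.InBounds, Expr.eval, State.tick, Expr.cost, h0]
    refine ⟨⟨by omega, by omega⟩, fun hc => ?_, fun hc => ?_⟩
    · have hlt : t.vars 1 < n := by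
        by_contra hlt
        simp [hlt] at hc
      have hb1 := h4 (t.vars 1) hlt
      have hb2 := h4 (t.vars 1 - 1) (by omega)
      have hb1' := Bool.toNat_le (β (t.vars 1))
      have hb2' := Bool.toNat_le (β (t.vars 1 - 1))
      have hcur : (List.range (t.vars 1 + 1 - 1)).map (fun j => β (j + 1)) =
          ofRuns (β 1) (rs ++ [q]) ++ [β (t.vars 1)] := by
        obtain ⟨m, hm⟩ : ∃ m, t.vars 1 = m + 1 := ⟨t.vars 1 - 1, by omega⟩
        rw [hm] at h7 ⊢
        simp only [Nat.add_sub_cancel] at h7 ⊢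
        rw [← h7, List.range_succ, List.map_append]
        rfl
      have hlast : β (t.vars 1 - 1) = xor (β 1) rs.length.bodd := by
        have h11 := getLastD_ofRuns (β 1) rs hq false
        rw [← h7] at h11
        obtain ⟨m, hm⟩ : ∃ m, t.vars 1 = m + 2 := ⟨t.vars 1 - 2, by omega⟩
        rw [hm, show m + 2 - 1 = m + 1 by omega, List.range_succ, List.map_append,
          List.map_singleton, List.getLastD_concat] at h11
        rw [hm]
        exact h11
      rw [wp_seq, wp_ite]
      simp only [Expr.InBounds, Expr.eval, Expr.cost, wp_seq, wp_assign, wp_store, State.tick, h0,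
        h8, Function.update_self, h9, hb1, hb2]
      refine ⟨⟨⟨by omega, by omega⟩, ⟨by omega, by omega⟩, by omega⟩, fun he => ?_, fun he => ?_⟩
      · have he' : β (t.vars 1) = β (t.vars 1 - 1) := by
          by_contra hne
          apply he
          rw [if_neg]
          revert hne
          cases β (t.vars 1) <;> cases β (t.vars 1 - 1) <;> simp
        refine ⟨⟨by omega, by omega, by omega⟩, ⟨⟨⟨by omega, by omega, by omega⟩, by omega⟩,
          by omega, by omega⟩, ⟨by omega, by omega, by omega⟩, ?_, by omega⟩
        refine ⟨fun x hx hx' => ?_, by omega, by omega, fun i hi => ?_, h5, by omega,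
          rs, q + 1, hrs, by omega, ?_, ?_, Function.update_self .., fun j hj => ?_⟩
        · rw [Function.update_of_ne hx, h1 x hx hx']
        · rw [Function.update_of_ne (by omega), h4 i hi]
        · rw [hcur, ofRuns_snoc_succ, ← hlast, he']
        · rw [Function.update_of_ne (by omega), h8]
        · rw [Function.update_of_ne (by omega), h10 j hj]
      · have he' : β (t.vars 1) = !β (t.vars 1 - 1) := by
          apply Bool.eq_not_iff.2
          intro heq
          rw [heq, if_pos rfl] at he
          omega
        have hv0 : Function.update t.vars 2 (rs.length + 1) 0 = n := by
          rw [Function.update_of_ne (by omega), h0]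
        have hv1 : Function.update t.vars 2 (rs.length + 1) 1 = t.vars 1 := by
          rw [Function.update_of_ne (by omega)]
        simp only [hv0, hv1]
        refine ⟨⟨by omega, by omega, by omega⟩, ⟨by omega, by omega, by omega⟩, by omega,
          ⟨by omega, by omega, by omega⟩, ?_, by omega⟩
        refine ⟨fun x hx hx' => ?_, by omega, by omega, fun i hi => ?_, h5, by omega,
          rs ++ [q], 1, ?_, one_pos, ?_, ?_, ?_, fun j hj => ?_⟩
        · rw [Function.update_of_ne hx, Function.update_of_ne hx', h1 x hx hx']
        · rw [Function.update_of_ne (by omega), h4 i hi]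
        · intro r hr
          simp at hr
          rcases hr with hr | rfl
          · exact hrs r hr
          · exact hq
        · rw [hcur, ofRuns_snoc_one, he', hlast]
          simp
        · rw [Function.update_of_ne (by omega), Function.update_self]
          simp
        · simp
        · simp only [List.length_append, List.length_singleton] at hj
          rw [Function.update_of_ne (by omega)]
          by_cases hj' : j < rs.length
          · rw [h10 j hj', List.getD_append _ _ _ _ hj']
          · have : j = rs.length := by omega
            subst this
            rw [h9, List.getD_append_right _ _ _ _ le_rfl]
            simp
    · have hge : t.vars 1 = n := by
        by_contra hlt
        rw [if_pos (by omega)] at hc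
        omega
      rw [wp_seq, wp_assign]
      simp only [Expr.InBounds, Expr.eval, State.tick, Expr.cost, wp_store, h8,
        Function.update_self]
      have hv0 : Function.update t.vars 2 (rs.length + 1) 0 = n := by
        rw [Function.update_of_ne (by omega), h0]
      simp only [hv0]
      have hL : ∀ j < (rs ++ [q]).length, t.mem (n + j) = (rs ++ [q]).getD j 0 := by
        intro j hj
        simp only [List.length_append, List.length_singleton] at hj
        by_cases hj' : j < rs.length
        · rw [h10 j hj', List.getD_append _ _ _ _ hj']
        · have : j = rs.length := by omega
          subst this
          rw [h9, List.getD_append_right _ _ _ _ le_rfl]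
          simp
      have hmn := hL 0 (by simp)
      rw [add_zero] at hmn
      have hmn' := getD_le_sum (rs ++ [q]) 0
      simp only [List.sum_append, List.sum_singleton] at hmn'
      refine ⟨⟨by omega, by omega, by omega⟩, ⟨by omega, by omega, by omega⟩,
        ⟨by omega, by omega⟩, ?_⟩
      refine hQ _ (rs ++ [q]) ⟨hv0, fun i hi => ?_, by simp, ?_, ?_, ?_, fun j hj => ?_, ?_⟩
        (fun x hx hx' => ?_) h5 ?_
      · simp only
        rw [Function.update_of_ne (by omega), h4 i hi]
      · intro r hr
        simp at hr
        rcases hr with hr | rfl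
        · exact hrs r hr
        · exact hq
      · rw [← h7, hge]
      · simp
      · simp only [List.length_append, List.length_singleton] at hj
        simp only
        rw [Function.update_of_ne (by omega), hL j (by simpa using hj)]
      · simp only [List.length_append, List.length_singleton, Function.update_self]
        exact hmn
      · simp only
        rw [Function.update_of_ne hx', h1 x hx hx']
      · simp only
        omega
  · simp only [State.tick, Expr.eval, Expr.cost, hn, Function.update_self]
    refine ⟨fun x hx hx' => ?_, le_rfl, hn2, fun i hi => ?_, trivial, by omega, [], 1, by simp,
      one_pos, ?_, ?_, ?_, ?_⟩
    · rw [Function.update_of_ne hx, Function.update_of_ne hx']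
    · rw [Function.update_of_ne (by omega), hb i hi]
    · simp [ofRuns_cons]
    · simp
    · simp
    · simp

end PreferOpposite

namespace PreferOpposite

/-! ### Minimal rotations -/

theorem succ_mod_eq_ite {i p : ℕ} (hp : 0 < p) :
    (i + 1) % p = if i % p + 1 = p then 0 else i % p + 1 := by
  have hlt := Nat.mod_lt i hp
  rw [← Nat.mod_add_mod]
  split_ifs with h
  · rw [h, Nat.mod_self]
  · exact Nat.mod_eq_of_lt (by omega)

/-- Variable 5 receives the truth value of the assertion that the list behind address `n + 1`, of
the length given by variable 2, is minimal among its rotations, and variable 4 its period. -/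
def minCmd : Cmd :=
  let A : ℕ → Expr := fun x => .load (.add (.add (.var 0) (.const 1)) (.var x))
  .seq (.assign 1 (.const 1)) (.seq (.assign 3 (.const 0)) (.seq (.assign 4 (.const 1))
    (.seq (.assign 5 (.const 1))
      (.seq (.loop (.lt (.var 1) (.var 2))
        (.ite (.eq (A 1) (A 3))
          (.seq (.assign 3 (.add (.var 3) (.const 1)))
            (.seq (.ite (.eq (.var 3) (.var 4)) (.assign 3 (.const 0)) .skip)
              (.assign 1 (.add (.var 1) (.const 1)))))
          (.ite (.lt (A 3) (A 1))
            (.seq (.assign 1 (.add (.var 1) (.const 1)))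
              (.seq (.assign 4 (.var 1)) (.assign 3 (.const 0))))
            (.seq (.assign 5 (.const 0)) (.assign 1 (.var 2))))))
        (.ite (.eq (.var 3) (.const 0)) .skip (.assign 5 (.const 0)))))))

theorem wp_minCmd {W n : ℕ} {Q : State → Prop} {s : State} {S : List ℕ}
    (hW : n + S.length + 10 ≤ W) (hn : s.vars 0 = n) (hK : s.vars 2 = S.length)
    (hK1 : 1 ≤ S.length) (hS : ∀ j < S.length, s.mem (n + 1 + j) = S.getD j 0)
    (hSW : ∀ j, S.getD j 0 < W)
    (hQ : ∀ s' : State, (∀ x, x ≠ 1 → x ≠ 3 → x ≠ 4 → x ≠ 5 → s'.vars x = s.vars x) →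
      s'.vars 4 ≤ S.length → (s'.vars 5 = 1 ∧ LyndonPeriod S S.length (s'.vars 4) ∧
        s'.vars 4 ∣ S.length ∨ s'.vars 5 = 0 ∧ ¬ IsMin S) →
      s'.mem = s.mem → s'.out = s.out → s'.clock ≤ s.clock + 60 * S.length + 60 → Q s') :
    WP W minCmd Q s := by
  rw [minCmd]
  simp only [wp_seq, wp_assign]
  refine ⟨by simp [Expr.InBounds]; omega, by simp [Expr.InBounds]; omega,
    by simp [Expr.InBounds]; omega, by simp [Expr.InBounds]; omega, ?_⟩
  -- Variable 1 is the length of the scanned prefix, variable 4 its Lyndon period and variable 3 the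
  -- residue of the former modulo the latter. After a descent variable 1 jumps to the end, which
  -- leaves the loop.
  refine WP.loop (fun t => (∀ x, x ≠ 1 → x ≠ 3 → x ≠ 4 → x ≠ 5 → t.vars x = s.vars x) ∧
    1 ≤ t.vars 1 ∧ t.vars 1 ≤ S.length ∧ t.vars 3 < S.length ∧ t.vars 4 ≤ S.length ∧
    t.mem = s.mem ∧ t.out = s.out ∧
    t.clock + 60 * (S.length - t.vars 1) ≤ s.clock + 60 * S.length ∧
    (t.vars 5 = 1 ∧ LyndonPeriod S (t.vars 1) (t.vars 4) ∧ t.vars 3 = t.vars 1 % t.vars 4 ∨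
      t.vars 5 = 0 ∧ t.vars 1 = S.length ∧ ¬ IsMin S)) (fun t => S.length - t.vars 1) ?_ ?_
  · rintro t ⟨h1, h2, h3, h4, h5, h6, h7, h8, h9⟩
    have h0 : t.vars 0 = n := by rw [h1 0 (by omega) (by omega) (by omega) (by omega), hn]
    have hK' : t.vars 2 = S.length := by
      rw [h1 2 (by omega) (by omega) (by omega) (by omega), hK]
    refine ⟨by simp only [Expr.InBounds]; omega, fun hc => ?_, fun hc => ?_⟩
    · have hlt : t.vars 1 < S.length := by
        by_contra hlt
        simp [Expr.eval, hK', hlt] at hc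
      rcases h9 with ⟨h9, hL, hr⟩ | ⟨_, h10, _⟩
      swap
      · omega
      have hA := hS _ hlt
      have hB := hS _ h4
      rw [← h6] at hA hB
      have hAW := hSW (t.vars 1)
      have hBW := hSW (t.vars 3)
      have hle := hL.le
      have hm := succ_mod_eq_ite (i := t.vars 1) hL.pos
      have hml := Nat.mod_lt (t.vars 1) hL.pos
      rw [← hr] at hm hml
      simp only [wp_seq, wp_ite, wp_assign, wp_skip, Expr.InBounds, Expr.eval, State.tick,
        Expr.cost, h0, hK', hA, hB, Function.update_apply, reduceIte,
        Nat.reduceEqDiff,        OfNat.ofNat_ne_one, OfNat.one_ne_ofNat]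
      refine ⟨by omega, fun he => ⟨by omega, by omega, fun hp => ?_, fun hp => ?_⟩,
        fun he => ⟨by omega, fun hlt' => ?_, fun hlt' => ?_⟩⟩
      · have he' : S.getD (t.vars 1) 0 = S.getD (t.vars 3) 0 := by
          by_contra hne
          exact he (if_neg hne)
        have hp' : t.vars 3 + 1 = t.vars 4 := by
          by_contra hne
          exact hp (if_neg hne)
        rw [if_pos hp'] at hm
        refine ⟨by omega, by omega, ⟨fun x a b c d => ?_, by omega, by omega, by omega, by omega,
          h6, h7, by omega, Or.inl ⟨h9, hL.step_eq (hr ▸ he'), hm.symm⟩⟩, by omega⟩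
        simp only [if_neg a, if_neg b, h1 x a b c d]
      · have he' : S.getD (t.vars 1) 0 = S.getD (t.vars 3) 0 := by
          by_contra hne
          exact he (if_neg hne)
        have hp' : t.vars 3 + 1 ≠ t.vars 4 := by
          intro hne
          rw [if_pos hne] at hp
          omega
        rw [if_neg hp'] at hm
        refine ⟨by omega, ⟨fun x a b c d => ?_, by omega, by omega, by omega, by omega,
          h6, h7, by omega, Or.inl ⟨h9, hL.step_eq (hr ▸ he'), hm.symm⟩⟩, by omega⟩
        simp only [if_neg a, if_neg b, h1 x a b c d]
      · have hlt'' : S.getD (t.vars 3) 0 < S.getD (t.vars 1) 0 := by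
          by_contra hne
          exact hlt' (if_neg hne)
        refine ⟨by omega, by omega, by omega, ⟨fun x a b c d => ?_, by omega, by omega, by omega,
          by omega, h6, h7, by omega, Or.inl ⟨h9, hL.step_lt (hr ▸ hlt''), ?_⟩⟩, by omega⟩
        · simp only [if_neg a, if_neg b, if_neg c, h1 x a b c d]
        · rw [Nat.mod_self]
      · have hgt : S.getD (t.vars 1) 0 < S.getD (t.vars 3) 0 := by
          rcases lt_trichotomy (S.getD (t.vars 1) 0) (S.getD (t.vars 3) 0) with h | h | h
          · exact h
          · rw [if_pos h] at he
            omega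
          · rw [if_pos h] at hlt'
            omega
        refine ⟨by omega, by omega, ⟨fun x a b c d => ?_, by omega, by omega, by omega, by omega,
          h6, h7, by omega, Or.inr ⟨trivial, trivial, hL.not_isMin_of_gt hlt (hr ▸ hgt)⟩⟩, by omega⟩
        simp only [if_neg a, if_neg d, h1 x a b c d]
    · have hge : t.vars 1 = S.length := by
        by_contra hlt
        simp only [Expr.eval, hK'] at hc
        rw [if_pos (by omega)] at hc
        omega
      simp only [wp_ite, wp_assign, wp_skip, Expr.InBounds, Expr.eval, State.tick, Expr.cost]
      refine ⟨by omega, fun hz => ?_, fun hz => ⟨by omega, ?_⟩⟩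
      · have hz' : t.vars 3 = 0 := by
          by_contra hne
          exact hz (if_neg hne)
        refine hQ _ h1 h5 ?_ h6 h7 (by simp only; omega)
        rcases h9 with ⟨h9, hL, hr⟩ | ⟨h9, _, hm⟩
        · rw [hge] at hL hr
          exact Or.inl ⟨h9, hL, Nat.dvd_of_mod_eq_zero (hr.symm.trans hz')⟩
        · exact Or.inr ⟨h9, hm⟩
      · have hz' : t.vars 3 ≠ 0 := by
          intro hne
          simp [hne] at hz
        refine hQ _ (fun x a b c d => ?_) ?_ (Or.inr ⟨?_, ?_⟩) h6 h7 (by simp only; omega)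
        · simp only [Function.update_of_ne d, h1 x a b c d]
        · simpa using h5
        · simp
        · rcases h9 with ⟨h9, hL, hr⟩ | ⟨h9, _, hm⟩
          · rw [hge] at hL hr
            exact hL.not_isMin_of_mod (by omega)
          · exact hm
  · simp only [State.tick, Expr.eval, Expr.cost, Function.update_apply, reduceIte,
        Nat.reduceEqDiff,        OfNat.ofNat_ne_one, OfNat.one_ne_ofNat]
    refine ⟨fun x a b c d => ?_, le_rfl, hK1, by omega, hK1, trivial, trivial, by omega,
      Or.inl ⟨trivial, lyndonPeriod_one S, trivial⟩⟩
    simp only [if_neg a, if_neg b, if_neg c, if_neg d]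

/-! ### Special lists -/

/-- Variable 9 receives the truth value of the assertion that the list behind address `n + o`, of
the length given by variable 2, with the parity given by variable 8, is special. -/
def specCmd (o : ℕ) : Cmd :=
  .seq (.assign 9 (.sub (.const 1) (.var 8))) (.seq (.assign 1 (.const 1))
    (.seq (.loop (.lt (.add (.var 1) (.const 1)) (.var 2))
      (.seq (.ite (.eq (.load (.add (.add (.var 0) (.const o)) (.var 1)))
          (.load (.add (.var 0) (.const o)))) .skip (.assign 9 (.const 0)))
        (.assign 1 (.add (.var 1) (.const 1)))))
      (.ite (.lt (.load (.add (.var 0) (.const o)))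
          (.load (.sub (.add (.add (.var 0) (.const o)) (.var 2)) (.const 1))))
        .skip (.assign 9 (.const 0)))))

open Classical in
theorem wp_specCmd {W n o : ℕ} {Q : State → Prop} {s : State} {S : List ℕ}
    (hW : n + o + S.length + 10 ≤ W) (hn : s.vars 0 = n) (hK : s.vars 2 = S.length)
    (hK2 : 2 ≤ S.length) (h8 : s.vars 8 = S.length % 2)
    (hS : ∀ j < S.length, s.mem (n + o + j) = S.getD j 0) (hSW : ∀ j, S.getD j 0 < W)
    (hQ : ∀ s' : State, (∀ x, x ≠ 1 → x ≠ 9 → s'.vars x = s.vars x) →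
      s'.vars 9 = (if Spec S then 1 else 0) →
      s'.mem = s.mem → s'.out = s.out → s'.clock ≤ s.clock + 60 * S.length + 60 → Q s') :
    WP W (specCmd o) Q s := by
  rw [specCmd]
  simp only [wp_seq, wp_assign]
  refine ⟨by simp [Expr.InBounds]; omega, by simp [Expr.InBounds]; omega, ?_⟩
  refine WP.loop (fun t => (∀ x, x ≠ 1 → x ≠ 9 → t.vars x = s.vars x) ∧
    1 ≤ t.vars 1 ∧ t.vars 1 < S.length ∧ t.mem = s.mem ∧ t.out = s.out ∧
    t.clock + 60 * (S.length - t.vars 1) ≤ s.clock + 60 * S.length ∧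
    t.vars 9 = if S.length % 2 = 0 ∧ ∀ j < t.vars 1, S.getD j 0 = S.getD 0 0 then 1 else 0)
    (fun t => S.length - t.vars 1) ?_ ?_
  · rintro t ⟨h1, h2, h3, h4, h5, h6, h7⟩
    have h0 : t.vars 0 = n := by rw [h1 0 (by omega) (by omega), hn]
    have hK' : t.vars 2 = S.length := by rw [h1 2 (by omega) (by omega), hK]
    have hA := hS _ h3
    have hB := hS 0 (by omega)
    have hC := hS (S.length - 1) (by omega)
    rw [add_zero] at hB
    rw [← h4] at hA hB hC
    rw [show n + o + (S.length - 1) = n + o + S.length - 1 by omega] at hC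
    have hAW := hSW (t.vars 1)
    have hBW := hSW 0
    have hCW := hSW (S.length - 1)
    refine ⟨by simp only [Expr.InBounds, Expr.eval]; omega, fun hc => ?_, fun hc => ?_⟩
    · have hlt : t.vars 1 + 1 < S.length := by
        by_contra hlt
        simp [Expr.eval, hK', hlt] at hc
      simp only [wp_seq, wp_ite, wp_assign, wp_skip, Expr.InBounds, Expr.eval, State.tick,
        Expr.cost, h0, hA, hB, Function.update_apply, reduceIte,
        OfNat.ofNat_ne_one, OfNat.one_ne_ofNat]
      refine ⟨by omega, fun he => ⟨by omega, ⟨fun x a b => ?_, by omega, by omega, h4, h5,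
        by omega, ?_⟩, by omega⟩, fun he => ⟨by omega, by omega, ⟨fun x a b => ?_, by omega,
        by omega, h4, h5, by omega, ?_⟩, by omega⟩⟩
      · rw [if_neg a, h1 x a b]
      · have he' : S.getD (t.vars 1) 0 = S.getD 0 0 := by
          by_contra hne
          exact he (if_neg hne)
        rw [h7]
        congr 1
        simp only [Nat.lt_succ_iff_lt_or_eq, eq_iff_iff]
        refine and_congr_right fun _ => ⟨fun h j hj => ?_, fun h j hj => h j (Or.inl hj)⟩
        rcases hj with hj | rfl
        · exact h j hj
        · exact he'
      · rw [if_neg a, if_neg b, h1 x a b]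
      · rw [if_neg]
        rintro ⟨_, h⟩
        rw [if_pos (h _ (by omega))] at he
        omega
    · have hge : t.vars 1 + 1 = S.length := by
        by_contra hlt
        simp only [Expr.eval, hK'] at hc
        rw [if_pos (by omega)] at hc
        omega
      have hsp : Spec S ↔ (S.length % 2 = 0 ∧ ∀ j < t.vars 1, S.getD j 0 = S.getD 0 0) ∧
          S.getD 0 0 < S.getD (S.length - 1) 0 := by
        rw [spec_iff hK2, ← hge, and_assoc]
        simp only [Nat.add_lt_add_iff_right]
      simp only [wp_ite, wp_assign, wp_skip, Expr.InBounds, Expr.eval, State.tick, Expr.cost, h0,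
        hK', hB, hC]
      refine ⟨by omega, fun hz => ?_, fun hz => ⟨by omega, ?_⟩⟩
      · have hz' : S.getD 0 0 < S.getD (S.length - 1) 0 := by
          by_contra hne
          exact hz (if_neg hne)
        refine hQ _ h1 ?_ h4 h5 (by simp only; omega)
        simp only [h7, hsp, hz', and_true]
      · have hz' : ¬ S.getD 0 0 < S.getD (S.length - 1) 0 := by
          intro hne
          rw [if_pos hne] at hz
          omega
        refine hQ _ (fun x a b => ?_) ?_ h4 h5 (by simp only; omega)
        · simp only [Function.update_of_ne b, h1 x a b]
        · simp only [hsp, hz', and_false, Function.update_self, if_false]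
  · simp only [State.tick, Expr.eval, Expr.cost, Function.update_apply, reduceIte,
      OfNat.ofNat_ne_one, OfNat.one_ne_ofNat]
    refine ⟨fun x a b => ?_, le_rfl, by omega, trivial, trivial, by omega, ?_⟩
    · simp only [if_neg a, if_neg b]
    · have : ∀ j < 1, S.getD j 0 = S.getD 0 0 := fun j hj => by rw [Nat.lt_one_iff.1 hj]
      rw [h8]
      split_ifs with h
      · have := h.1
        omega
      · have : S.length % 2 ≠ 0 := fun h' => h ⟨h', this⟩
        omega

end PreferOpposite

namespace PreferOpposite

/-! ### The flip indicator -/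

/-- With the run lengths in the memory, variable 6 receives the indicator of the flips. -/
def flipCmd : Cmd :=
  .ite (.eq (.var 2) (.const 1)) (.assign 6 (.const 1))
    (.seq (parityCmd 2 8) (.seq minCmd
      (.ite (.eq (.load (.const 1)) (.const 0))
        (.seq (specCmd 0) (.assign 6 (.lt (.const 0) (.add (.var 5) (.var 9)))))
        (.seq (specCmd 1) (.seq (parityCmd 4 10)
          (.assign 6 (.sub (.sub (.var 5) (.var 9)) (.var 10))))))))

open Classical in
theorem wp_flipCmd {W n : ℕ} {Q : State → Prop} {s : State} {β : ℕ → Bool} {L : List ℕ}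
    (hn2 : 2 ≤ n) (hW : 4 * n + 20 ≤ W) (h : HasRuns n β L s) (a : Bool)
    (hQ : ∀ s' : State, s'.vars 0 = n → s'.vars 7 = s.vars 7 →
      s'.vars 6 = (if a :: ofRuns (β 1) L ∈ oppReps ∨ conj (a :: ofRuns (β 1) L) ∈ oppReps
        then 1 else 0) →
      s'.mem = s.mem → s'.out = s.out → s'.clock ≤ s.clock + 400 * n + 400 → Q s') :
    WP W flipCmd Q s := by
  have h0 := h.var_zero
  have hK := h.length
  have hb1 := h.bits 1 (by omega)
  have hsum : L.sum = n - 1 := by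
    have := congrArg List.length h.runs
    simp at this
    exact this.symm
  have hle := length_le_sum h.pos
  have hlt := List.length_pos_iff.2 h.ne_nil
  rw [flipCmd, wp_ite]
  simp only [Expr.InBounds, Expr.eval, Expr.cost]
  refine ⟨by omega, fun hc => ?_, fun hc => ?_⟩
  · have hlen : L.length = 1 := by
      rw [← hK]
      by_contra hne
      exact hc (if_neg hne)
    obtain ⟨S, rfl⟩ := List.length_eq_one_iff.1 hlen
    rw [wp_assign]
    refine ⟨by simp only [Expr.InBounds]; omega, hQ _ ?_ ?_ ?_ rfl rfl ?_⟩
    · simpa [State.tick] using h0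
    · simp [State.tick]
    · rw [if_pos (flips_of_length_one (h.pos S (by simp)))]
      simp [State.tick, Expr.eval]
    · simp only [State.tick, Expr.cost]
      omega
  · have hlen : 2 ≤ L.length := by
      have : s.vars 2 ≠ 1 := by
        intro he
        simp [he] at hc
      omega
    have hflip := flips_iff (a := a) (b := β 1) hlen h.pos
    have hLR : (L.rotate 1).length = L.length := List.length_rotate ..
    have hposR : ∀ r ∈ L.rotate 1, 0 < r := fun r hr => h.pos r (List.mem_rotate.1 hr)
    have hLW : ∀ j, L.getD j 0 < W := fun j => by
      have := getD_le_sum L j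
      omega
    have hRW : ∀ j, (L.rotate 1).getD j 0 < W := fun j => by
      have := getD_le_sum (L.rotate 1) j
      rw [(L.rotate_perm 1).sum_eq] at this
      omega
    -- Owing to the copy of the first entry behind the list, the rotated list is a contiguous block
    -- that starts one address later.
    have hmemR : ∀ j < (L.rotate 1).length, s.mem (n + 1 + j) = (L.rotate 1).getD j 0 := by
      intro j hj
      rw [hLR] at hj
      rw [getD_rotate _ _ hj, add_assoc, add_comm 1 j]
      rcases Nat.lt_succ_iff_lt_or_eq.1 (Nat.succ_lt_succ hj) with h1 | h1
      · rw [Nat.mod_eq_of_lt h1]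
        exact h.mem _ h1
      · rw [show j + 1 = L.length from h1, Nat.mod_self]
        exact h.mem_last
    rw [wp_seq]
    refine wp_parityCmd (by omega) (by simp only [State.tick]; omega) fun s₁ a₁ b₁ c₁ d₁ => ?_
    simp only [State.tick] at a₁ b₁ c₁ d₁
    have e₁ : ∀ x, x ≠ 8 → s₁.vars x = s.vars x := fun x hx => by
      rw [a₁, Function.update_of_ne hx]
    have f₁ : s₁.vars 8 = L.length % 2 := by rw [a₁, Function.update_self, hK]
    rw [wp_seq]
    refine wp_minCmd (S := L.rotate 1) (n := n) (by omega) (by rw [e₁ 0 (by omega), h0])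
      (by rw [e₁ 2 (by omega), hK, hLR]) (by omega) (by rw [b₁]; exact hmemR) hRW
      fun s₂ a₂ b₂ c₂ d₂ e₂ f₂ => ?_
    rw [wp_ite]
    simp only [Expr.InBounds, Expr.eval, Expr.cost, d₂, b₁, hb1]
    refine ⟨⟨⟨by omega, by have := Bool.toNat_le (β 1); omega⟩, by omega⟩, fun hc => ?_,
      fun hc => ?_⟩
    · have hβ : β 1 = false := by
        cases hβ : β 1
        · rfl
        · rw [hβ] at hc
          simp at hc
      have hcanon : Canon false (L.rotate 1) ↔ IsMin (L.rotate 1) :=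
        ⟨fun hC => hC.isMin, fun hM => ⟨by simpa using h.ne_nil, hposR, hM, by simp⟩⟩
      rw [hβ] at hflip
      simp only [true_and, hcanon, Bool.false_eq_true, false_and, not_false_eq_true,
        and_true] at hflip
      rw [wp_seq]
      refine wp_specCmd (S := L) (n := n) (by omega) ?_ ?_ hlen ?_ ?_ hLW
        fun s₃ a₃ b₃ c₃ d₃ e₃ => ?_
      · simp only [State.tick]
        rw [a₂ 0 (by omega) (by omega) (by omega) (by omega), e₁ 0 (by omega), h0]
      · simp only [State.tick]
        rw [a₂ 2 (by omega) (by omega) (by omega) (by omega), e₁ 2 (by omega), hK]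
      · simp only [State.tick]
        rw [a₂ 8 (by omega) (by omega) (by omega) (by omega), f₁]
      · simp only [State.tick]
        rw [d₂, b₁]
        exact h.mem
      · simp only [State.tick] at a₃ c₃ d₃ e₃
        have hv5 : s₃.vars 5 = if IsMin (L.rotate 1) then 1 else 0 := by
          rw [a₃ 5 (by omega) (by omega)]
          rcases c₂ with ⟨h5, hP, hd⟩ | ⟨h5, hm⟩
          · rw [h5, if_pos (hP.isMin hd)]
          · rw [h5, if_neg hm]
        rw [wp_assign]
        simp only [Expr.InBounds, Expr.eval, Expr.cost, hv5, b₃]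
        refine ⟨⟨by omega, by split_ifs <;> omega, by split_ifs <;> omega,
          by split_ifs <;> omega⟩, hQ _ ?_ ?_ ?_ ?_ ?_ ?_⟩
        · simp only [State.tick]
          rw [Function.update_of_ne (by omega), a₃ 0 (by omega) (by omega),
            a₂ 0 (by omega) (by omega) (by omega) (by omega), e₁ 0 (by omega), h0]
        · simp only [State.tick]
          rw [Function.update_of_ne (by omega), a₃ 7 (by omega) (by omega),
            a₂ 7 (by omega) (by omega) (by omega) (by omega), e₁ 7 (by omega)]
        · simp only [State.tick, Function.update_self, hβ, hflip]
          by_cases h1 : Spec L <;> by_cases h2 : IsMin (L.rotate 1) <;> simp [h1, h2]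
        · exact c₃.trans (d₂.trans b₁)
        · exact d₃.trans (e₂.trans c₁)
        · simp only [State.tick]
          omega
    · have hβ : β 1 = true := by
        cases hβ : β 1
        · rw [hβ] at hc
          simp at hc
        · rfl
      rw [hβ] at hflip
      simp only [Bool.true_eq_false, false_and, false_or, true_and] at hflip
      rw [wp_seq]
      refine wp_specCmd (S := L.rotate 1) (n := n) (by omega) ?_ ?_ (by omega) ?_ ?_ hRW
        fun s₃ a₃ b₃ c₃ d₃ e₃ => ?_
      · simp only [State.tick]
        rw [a₂ 0 (by omega) (by omega) (by omega) (by omega), e₁ 0 (by omega), h0]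
      · simp only [State.tick]
        rw [a₂ 2 (by omega) (by omega) (by omega) (by omega), e₁ 2 (by omega), hK, hLR]
      · simp only [State.tick]
        rw [a₂ 8 (by omega) (by omega) (by omega) (by omega), f₁, hLR]
      · simp only [State.tick]
        rw [d₂, b₁]
        exact hmemR
      · simp only [State.tick] at a₃ c₃ d₃ e₃
        have hv4 := a₃ 4 (by omega) (by omega)
        have hv5 := a₃ 5 (by omega) (by omega)
        rw [wp_seq]
        refine wp_parityCmd (by omega) (by omega) fun s₄ a₄ b₄ c₄ d₄ => ?_
        have e₄ : ∀ x, x ≠ 10 → s₄.vars x = s₃.vars x := fun x hx => by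
          rw [a₄, Function.update_of_ne hx]
        have f₄ : s₄.vars 10 = s₂.vars 4 % 2 := by rw [a₄, Function.update_self, hv4]
        rw [wp_assign]
        simp only [Expr.InBounds, Expr.eval, Expr.cost, e₄ 5 (by omega), e₄ 9 (by omega), f₄, hv5,
          b₃]
        refine ⟨⟨⟨?_, by split_ifs <;> omega⟩, by omega⟩, hQ _ ?_ ?_ ?_ ?_ ?_ ?_⟩
        · rcases c₂ with ⟨h5, -⟩ | ⟨h5, -⟩ <;> omega
        · simp only [State.tick]
          rw [Function.update_of_ne (by omega), e₄ 0 (by omega), a₃ 0 (by omega) (by omega),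
            a₂ 0 (by omega) (by omega) (by omega) (by omega), e₁ 0 (by omega), h0]
        · simp only [State.tick]
          rw [Function.update_of_ne (by omega), e₄ 7 (by omega), a₃ 7 (by omega) (by omega),
            a₂ 7 (by omega) (by omega) (by omega) (by omega), e₁ 7 (by omega)]
        -- With truncated subtraction, variable 6 is 1 exactly if the list is least, not special and
        -- of even period; by `LyndonPeriod.exists_odd_iff` the even period is what the bit 1
        -- requires.
        · simp only [State.tick, Function.update_self, hβ, hflip]
          rcases c₂ with ⟨h5, hP, hd⟩ | ⟨h5, hm⟩
          · have hcanon : Canon true (L.rotate 1) ↔ s₂.vars 4 % 2 = 0 := by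
              have hodd := hP.exists_odd_iff hd
              rw [Nat.mod_two_of_bodd]
              constructor
              · intro hC
                rw [hodd.1 (hC.odd rfl)]
                rfl
              · intro hp
                refine ⟨by simpa using h.ne_nil, hposR, hP.isMin hd, fun _ => hodd.2 ?_⟩
                cases hp' : (s₂.vars 4).bodd
                · rfl
                · rw [hp'] at hp
                  simp at hp
            rw [hcanon, h5]
            by_cases h1 : Spec (L.rotate 1)
            · simp [h1]
            · by_cases h2 : s₂.vars 4 % 2 = 0
              · simp [h1, h2]
              · simp [h1, h2]
                omega
          · have hcanon : ¬ Canon true (L.rotate 1) := fun hC => hm hC.isMin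
            simp [hcanon, h5]
        · exact b₄.trans (c₃.trans (d₂.trans b₁))
        · exact c₄.trans (d₃.trans (e₂.trans c₁))
        · simp only [State.tick]
          omega

end PreferOpposite

namespace PreferOpposite

/-! ### One round -/

theorem tail_eq_map {w : List Bool} {n : ℕ} (hw : w.length = n) :
    w.tail = (List.range (n - 1)).map (fun j => w.getD (j + 1) false) := by
  apply List.ext_getElem
  · simp [hw]
  · intro j h1 h2
    have : j + 1 < w.length := by simp at h1; omega
    simp [this]

/-- The sum modulo two of two bits. -/
def xorExpr (a b : Expr) : Expr := .sub (.const 1) (.eq a b)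

theorem eval_xorExpr {s : State} {e e' : Expr} {a b : Bool} (ha : e.eval s = a.toNat)
    (hb : e'.eval s = b.toNat) : (xorExpr e e').eval s = (xor a b).toNat := by
  simp only [xorExpr, Expr.eval, ha, hb]
  cases a <;> cases b <;> rfl

/-- Variable 7 is set to zero if the string in the memory is `10ⁿ⁻¹`. Otherwise the next bit is
emitted and the string is shifted. -/
def roundCmd : Cmd :=
  .seq runsCmd
    (.ite (.eq (.add (.add (.eq (.var 2) (.const 1)) (.eq (.load (.const 1)) (.const 0)))
        (.load (.const 0))) (.const 3))
      (.assign 7 (.const 0))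
      (.seq flipCmd
        (.seq (.assign 6 (xorExpr (xorExpr (.var 6) (.load (.const 0)))
            (xorExpr (.load (.const 1)) (.load (.sub (.var 0) (.const 1))))))
          (.seq (.emit (.var 6)) shiftCmd))))

theorem wp_roundCmd {W n : ℕ} {Q : State → Prop} {s : State} {w : List Bool} (hn2 : 2 ≤ n)
    (hW : 4 * n + 20 ≤ W) (hw : w.length = n) (h0 : s.vars 0 = n)
    (hb : ∀ i < n, s.mem i = (w.getD i false).toNat)
    (hQ₁ : w = true :: List.replicate (n - 1) false → ∀ s' : State, s'.vars 0 = n →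
      s'.vars 7 = 0 → s'.out = s.out → s'.clock ≤ s.clock + 1000 * n → Q s')
    (hQ₂ : w ≠ true :: List.replicate (n - 1) false → ∀ (s' : State) (T : ℕ), s'.vars 0 = n →
      s'.vars 7 = s.vars 7 → (∀ i < n, s'.mem i = ((step succO w).getD i false).toNat) →
      s'.out = s.out ++ [((succO w).toNat, T)] → T ≤ s.clock + 1000 * n →
      s'.clock ≤ T + 1000 * n → Q s') :
    WP W roundCmd Q s := by
  classical
  rw [roundCmd, wp_seq]
  refine wp_runsCmd (β := fun i => w.getD i false) hn2 (by omega) h0 hb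
    fun s₁ L h₁ a₁ b₁ c₁ => ?_
  have hcons : w = w.getD 0 false :: ofRuns (w.getD 1 false) L := by
    rw [← h₁.runs, ← tail_eq_map hw]
    cases w with
    | nil => simp at hw; omega
    | cons x w => rfl
  have h0₁ := h₁.var_zero
  have hb0 := h₁.bits 0 (by omega)
  have hb1 := h₁.bits 1 (by omega)
  have hbl := h₁.bits (n - 1) (by omega)
  have hle0 := Bool.toNat_le (w.getD 0 false)
  have hle1 := Bool.toNat_le (w.getD 1 false)
  have hsum : L.sum = n - 1 := by
    have := congrArg List.length h₁.runs
    simp at this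
    exact this.symm
  have hle := length_le_sum h₁.pos
  have hK := h₁.length
  -- The final string is recognized in constant time: its tail is a single run, of zeros, and its
  -- first bit is 1.
  have hinit : w = true :: List.replicate (n - 1) false ↔
      L.length = 1 ∧ w.getD 1 false = false ∧ w.getD 0 false = true := by
    have hrep : List.replicate (n - 1) false = ofRuns false [n - 1] := by simp [ofRuns_cons]
    constructor
    · intro he
      have h1 : w.getD 1 false = false := by
        rw [he]
        simp
      have h2 : L = [n - 1] := by
        rw [h1, he, List.cons.injEq, hrep] at hcons
        rw [← rle_ofRuns false h₁.pos, ← hcons.2, rle_ofRuns]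
        simp
        omega
      exact ⟨by rw [h2]; rfl, h1, by rw [he]; rfl⟩
    · rintro ⟨hL, h1, h2⟩
      obtain ⟨S, rfl⟩ := List.length_eq_one_iff.1 hL
      rw [h1, h2] at hcons
      rw [hcons, hrep, ← hsum]
      simp
  rw [wp_ite]
  simp only [Expr.InBounds, Expr.eval, Expr.cost, hb0, hb1, hK]
  have hcond : (if ((if L.length = 1 then 1 else 0) +
      (if (w.getD 1 false).toNat = 0 then 1 else 0) + (w.getD 0 false).toNat) = 3 then 1 else 0)
      = if w = true :: List.replicate (n - 1) false then 1 else 0 := by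
    simp only [hinit]
    by_cases h1 : L.length = 1 <;> cases w.getD 1 false <;> cases w.getD 0 false <;> simp [h1]
  rw [hcond]
  refine ⟨⟨⟨⟨⟨by omega, by omega⟩, ⟨⟨by omega, by omega⟩, by omega⟩, ?_⟩,
    ⟨by omega, by omega⟩, ?_⟩, by omega⟩, fun hc => ?_, fun hc => ?_⟩
  · split_ifs <;> omega
  · split_ifs <;> omega
  · have he : w = true :: List.replicate (n - 1) false := by
      by_contra hne
      exact hc (if_neg hne)
    rw [wp_assign]
    refine ⟨by simp only [Expr.InBounds]; omega, hQ₁ he _ ?_ ?_ b₁ ?_⟩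
    · simpa [State.tick] using h0₁
    · simp [State.tick, Expr.eval]
    · simp only [State.tick, Expr.cost]
      omega
  · have he : w ≠ true :: List.replicate (n - 1) false := by
      intro he
      rw [if_pos he] at hc
      omega
    rw [wp_seq]
    refine wp_flipCmd hn2 hW (h₁.tick _) (w.getD 0 false) fun s₂ a₂ b₂ c₂ d₂ e₂ f₂ => ?_
    simp only [State.tick] at b₂ d₂ e₂ f₂
    rw [← hcons] at c₂
    have hlast : w.getLastD false = w.getD (n - 1) false := by
      rw [List.getLastD_eq_getLast?, List.getLast?_eq_getElem?, hw, List.getD_eq_getElem?_getD]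
    have hc2 : s₂.vars 6 = (decide (w ∈ oppReps ∨ conj w ∈ oppReps)).toNat := by
      rw [c₂]
      split_ifs with h <;> simp [h]
    have heval : Expr.eval s₂ (xorExpr (xorExpr (.var 6) (.load (.const 0)))
        (xorExpr (.load (.const 1)) (.load (.sub (.var 0) (.const 1))))) = (succO w).toNat := by
      rw [eval_xorExpr (eval_xorExpr (e := .var 6) (e' := .load (.const 0))
        (b := w.getD 0 false) hc2 ?_) (eval_xorExpr (e := .load (.const 1))
        (e' := .load (.sub (.var 0) (.const 1))) (a := w.getD 1 false)
        (b := w.getD (n - 1) false) ?_ ?_)]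
      · rw [succO, feedback, hlast]
        by_cases h : w ∈ oppReps ∨ conj w ∈ oppReps
        · rw [if_pos h]
          simp [h]
        · rw [if_neg h]
          simp [h]
      · simp only [Expr.eval, d₂, hb0]
      · simp only [Expr.eval, d₂, hb1]
      · simp only [Expr.eval, d₂, a₂, hbl]
    have hle2 := Bool.toNat_le (succO w)
    have hlel := Bool.toNat_le (w.getD (n - 1) false)
    have hle6 := Bool.toNat_le (decide (w ∈ oppReps ∨ conj w ∈ oppReps))
    simp only [wp_seq, wp_assign, wp_emit, heval]
    refine ⟨?_, ?_, ?_⟩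
    · simp only [xorExpr, Expr.InBounds, Expr.eval, d₂, hb0, hb1, hbl, a₂, hc2]
      omega
    · simp only [Expr.InBounds, State.tick, Function.update_self]
      omega
    · refine wp_shiftCmd (n := n) (by omega) ?_ (by omega) ?_ ?_ fun s₃ a₃ b₃ c₃ d₃ e₃ => ?_
      · simpa [State.tick] using a₂
      · simp only [State.tick, Function.update_self]
        omega
      · intro i hi
        have := Bool.toNat_le (w.getD i false)
        simp only [State.tick, d₂, h₁.bits i hi]
        omega
      · simp only [State.tick, Expr.eval, Function.update_self, Expr.cost, xorExpr] at a₃ b₃ c₃ d₃ e₃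
        refine hQ₂ he s₃ _ ?_ ?_ (fun i hi => ?_) (by rw [d₃, e₂, b₁]) (by omega) (by omega)
        · rw [a₃ 0 (by omega), Function.update_of_ne (by omega), a₂]
        · rw [a₃ 7 (by omega), Function.update_of_ne (by omega), b₂, a₁ 7 (by omega) (by omega)]
        · rw [step, shift]
          have htl : w.tail.length = n - 1 := by simp [hw]
          by_cases hi' : i + 1 < n
          · rw [b₃ i hi', d₂, h₁.bits _ hi', List.getD_append _ _ _ _ (by omega)]
            congr 1
            simp [List.getD_eq_getElem?_getD]
          · rw [show i = n - 1 by omega, c₃, List.getD_append_right _ _ _ _ (by omega), htl]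
            simp

/-! ### The program -/

/-- The program for the Prefer-opposite sequence. -/
def preferOppositeCmd : Cmd :=
  .seq (.assign 7 (.const 1)) (.seq (.emit (.const 0)) (.loop (.var 7) roundCmd))

theorem succO_cons_replicate {n : ℕ} (hn : 2 ≤ n) :
    succO (true :: List.replicate (n - 1) false) = false := by
  have hc : true :: List.replicate (n - 1) false = conj (List.replicate n false) := by
    obtain ⟨m, rfl⟩ : ∃ m, n = m + 1 := ⟨n - 1, by omega⟩
    rfl
  rw [succO, if_pos (Or.inl (cons_replicate_mem hn)), hc, feedback_conj (by simpa using hn),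
    feedback_replicate hn]
  rfl

theorem step_cons_replicate {n : ℕ} (hn : 2 ≤ n) :
    step succO (true :: List.replicate (n - 1) false) = List.replicate n false := by
  rw [step, succO_cons_replicate hn, shift, List.tail_cons, ← List.replicate_succ']
  congr 1
  omega

theorem preferOpposite_eq_cons {n : ℕ} (hn : 2 ≤ n) :
    preferOpposite n = false :: generate succO (2 ^ n - 1) (List.replicate n false) := by
  rw [← (preferOpposite_succO hn).2.1, DB]
  have hlen : (true :: List.replicate (n - 1) false).length = n := by
    simp
    omega
  have hpow := Nat.two_pow_pos n
  obtain ⟨m, hm⟩ : ∃ m, 2 ^ n = m + 1 := ⟨2 ^ n - 1, by omega⟩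
  rw [hlen, hm, generate, Nat.add_sub_cancel, ← step, step_cons_replicate hn,
    succO_cons_replicate hn]

theorem iterate_eq_cons_replicate_iff {n t : ℕ} (hn : 2 ≤ n) (ht : t < 2 ^ n) :
    (step succO)^[t] (List.replicate n false) = true :: List.replicate (n - 1) false ↔
      t = 2 ^ n - 1 := by
  have h := (preferOpposite_succO hn).2.2 (true :: List.replicate (n - 1) false)
    (by simp; omega) (t + 1) 0
  rw [Function.iterate_succ_apply, step_cons_replicate hn, Function.iterate_zero_apply] at h
  rw [h, Nat.modEq_zero_iff_dvd]
  constructor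
  · intro hd
    have := Nat.le_of_dvd (by omega) hd
    omega
  · intro he
    rw [show t + 1 = 2 ^ n by omega]

/-- Words of size `O(n)` cannot hold a counter up to `2 ^ n` for large `n`, so the program stops at
`10ⁿ⁻¹`, the last state of the orbit of `0ⁿ` (`iterate_eq_cons_replicate_iff`). The zero-initialized
memory already holds `0ⁿ`, the state after the first bit. -/
theorem generatesLinearly_preferOppositeCmd :
    GeneratesLinearly preferOppositeCmd preferOpposite := by
  refine ⟨3000, fun n hn => ?_⟩
  have hpow := Nat.two_pow_pos n
  suffices h : WP (3000 * n) preferOppositeCmd (fun s =>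
      s.out.map Prod.fst = (preferOpposite n).map Bool.toNat ∧
      List.IsChain (fun t t' => t' ≤ t + 3000 * n) (0 :: (s.out.map Prod.snd ++ [s.clock])))
      (State.init n) by
    obtain ⟨s, h1, h2, h3⟩ := h
    exact ⟨s, h1, h2, h3⟩
  rw [preferOppositeCmd]
  simp only [wp_seq, wp_assign, wp_emit]
  refine ⟨by simp only [Expr.InBounds]; omega, by simp only [Expr.InBounds]; omega, ?_⟩
  -- `T` is the time of the latest output, so the clock bound controls the gap to the next one. The
  -- summand `s.vars 7` of the measure accounts for the last round, which emits nothing.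
  refine WP.loop (fun s => s.vars 0 = n ∧ ∃ t T, t < 2 ^ n ∧
      (∀ i < n, s.vars 7 = 1 →
        s.mem i = (((step succO)^[t] (List.replicate n false)).getD i false).toNat) ∧
      s.out.map Prod.fst =
        (false :: generate succO t (List.replicate n false)).map Bool.toNat ∧
      List.IsChain (fun t t' => t' ≤ t + 3000 * n) (0 :: s.out.map Prod.snd) ∧
      (0 :: s.out.map Prod.snd).getLast? = some T ∧
      (s.vars 7 = 1 ∧ s.clock ≤ T + 1000 * n + 2 ∨
        s.vars 7 = 0 ∧ t = 2 ^ n - 1 ∧ s.clock ≤ T + 2000 * n + 10))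
    (fun s => 2 ^ n - s.out.length + s.vars 7) ?_ ?_
  · rintro s ⟨h0, t, T, h1, h2, h3, h4, h5, h6⟩
    have hlen : s.out.length = t + 1 := by
      have := congrArg List.length h3
      simpa [length_generate] using this
    refine ⟨by simp only [Expr.InBounds]; omega, fun hc => ?_, fun hc => ?_⟩
    · have h7 : s.vars 7 = 1 := by
        rcases h6 with h6 | h6
        · exact h6.1
        · exact absurd h6.1 hc
      have h8 : s.clock ≤ T + 1000 * n + 2 := by omega
      refine wp_roundCmd (w := (step succO)^[t] (List.replicate n false)) hn (by omega)
        (length_step_iterate _ (by omega) (by simp) _) h0 (fun i hi => h2 i hi h7)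
        (fun he s' a b c d => ?_) (fun hne s' T' a b c d e f => ?_)
      · simp only [State.tick, Expr.cost] at a b c d
        refine ⟨⟨a, t, T, h1, ?_, by rw [c]; exact h3, by rw [c]; exact h4, by rw [c]; exact h5,
          Or.inr ⟨b, (iterate_eq_cons_replicate_iff hn h1).1 he, by omega⟩⟩, ?_⟩
        · intro i hi h
          omega
        · rw [b, c, h7]
          omega
      · simp only [State.tick, Expr.cost] at a b c d e f
        have ht : t ≠ 2 ^ n - 1 := fun h => hne ((iterate_eq_cons_replicate_iff hn h1).2 h)
        refine ⟨⟨a, t + 1, T', by omega, ?_, ?_, ?_, ?_, Or.inl ⟨b.trans h7, by omega⟩⟩, ?_⟩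
        · intro i hi _
          rw [Function.iterate_succ_apply']
          exact c i hi
        · rw [d, List.map_append, h3, generate_succ_snoc]
          simp
        · rw [d, List.map_append, ← List.cons_append, List.isChain_append]
          refine ⟨h4, by simp, fun x hx y hy => ?_⟩
          rw [h5] at hx
          simp at hx hy
          omega
        · rw [d, List.map_append, ← List.cons_append]
          exact List.getLast?_concat ..
        · rw [b, d, List.length_append, hlen]
          simp
          omega
    · have hc' : s.vars 7 = 0 := hc
      have h7 : t = 2 ^ n - 1 ∧ s.clock ≤ T + 2000 * n + 10 := by omega
      simp only [State.tick, Expr.cost]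
      refine ⟨by rw [h3, preferOpposite_eq_cons hn, h7.1], ?_⟩
      rw [← List.cons_append, List.isChain_append]
      refine ⟨h4, by simp, fun x hx y hy => ?_⟩
      rw [h5] at hx
      simp at hx hy
      omega
  -- The initial assignment and the emission take two operations each, so the first bit appears at
  -- time 4.
  · refine ⟨by simp [State.tick, State.init], 0, 4, hpow, ?_, ?_, ?_, ?_, Or.inl ⟨?_, ?_⟩⟩
    · intro i hi _
      simp [State.tick, State.init, List.getD_eq_getElem?_getD, hi]
    all_goals simp [State.tick, State.init, Expr.eval, Expr.cost, generate]
    all_goals omega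

end PreferOpposite

theorem mainTheorem2 :
    (∀ n : ℕ, 2 ≤ n →
      PreferOpposite.IsDeBruijn n (PreferOpposite.preferOpposite n) ∧
      PreferOpposite.DB PreferOpposite.succO (true :: List.replicate (n - 1) false) =
        PreferOpposite.preferOpposite n) ∧
    ∃ p : PreferOpposite.Cmd,
      PreferOpposite.GeneratesLinearly p PreferOpposite.preferOpposite :=
  ⟨fun _ hn => ⟨(PreferOpposite.preferOpposite_succO hn).1,
    (PreferOpposite.preferOpposite_succO hn).2.1⟩,
    _, PreferOpposite.generatesLinearly_preferOppositeCmd⟩
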